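/- **Setting.** Let $d\ge 1$, let $\mathcal X\subset\mathbb R^d$ be bounded and measurable with Lebesgue measure $1$, and let $g:\mathbb R^d\to\mathbb R$ be measurable with $0<g_{\min}\le g\le g_{\max}<\infty$ on $\mathcal X$ (for some constants $g_{\min}<g_{\max}$) and $\int_{\mathcal X}g^2=1$. Let $\kappa>0$. Dimensions are sequences $D=D_N\in\mathbb N$ with $D_N/N\to\kappa$. For a map $\mathcal G$ assigning to $\theta\in\mathbb R^D$ a function $\mathcal G(\theta):\mathcal X\to\mathbb R$, the data $Z^{(N)}=(Y_i,X_i)_{i\le N}$ are i.i.d. with $Y_i=\mathcal G(\theta_0)(X_i)+\varepsilon_i$, $X_i$ uniform on $\mathcal X$, $\varepsilon_i\sim\mathcal N(0,1)$ independent of $X_i$, and ground truth $\theta_0=0$; their law is $P_0^N$. Put $\ell_N(\theta)=-\frac12\sum_{i\le N}|Y_i-\mathcal G(\theta)(X_i)|^2$ and $\ell(\theta)=E_0^N\ell_N(\theta)$. For a Gaussian prior $\Pi=\mathcal N(0,\mathcal C)$ with density $\pi$, the posterior is $d\Pi(\theta|Z^{(N)})\propto e^{\ell_N(\theta)}d\Pi(\theta)$,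 with density $\pi(\cdot|Z^{(N)})$. Write $B_r=\{\|\theta\|\le r\}$, $\Theta_{r,\varepsilon}=\{\theta:\|\theta\|\in(r,r+\varepsilon)\}$, and $\tau_A=\inf\{k\ge0:\vartheta_k\in A\}$ for a chain $(\vartheta_k)$. "With high probability" means with probability tending to $1$ as $N\to\infty$; for chains the probability is the joint law of the data and the chain. *pCN with step size $\beta$*: given $\vartheta_{k-1}$, draw $\xi_k\sim\mathcal N(0,\mathcal C)$ independently, propose $p_k=\sqrt{1-\beta}\,\vartheta_{k-1}+\sqrt\beta\,\xi_k$, and set $\vartheta_k=p_k$ with probability $\min\{1,e^{\ell_N(p_k)-\ell_N(\vartheta_{k-1})}\}$, and $\vartheta_k=\vartheta_{k-1}$ otherwise. *Radial maps*: $\mathcal G_{T,t,\rho,L}(\theta)(x)=\sqrt{w(\|\theta\|)}\,g(x)$, where $w(r)=4(Tr)^2$ on $[0,t/2)$, $w(r)=(Tt)^2+T(r-t/2)$ on $[t/2,t)$, $w(r)=(Tt)^2+Tt/2+\rho(r-t)$ on $[t,L)$ and $w(r)=(Tt)^2+Tt/2+\rho(L-t)$ on $[L,\infty)$. *Step condition*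 $(c_0,L_N,\eta_N)$, for Markov kernels $\mathcal P_N(\cdot,\cdot)$ on $\mathbb R^{D}$ that may depend (measurably) on $Z^{(N)}$: $\Pi(\cdot|Z^{(N)})$ is invariant for $\mathcal P_N$ (almost surely, for all large $N$), and with $P_0^N$-probability tending to one, $\mathcal P_N(\theta,\{\vartheta:\|\theta-\vartheta\|\ge\eta_N/2\})\le e^{-c_0N}$ for all $\theta\in B_{L_N}$. **Theorem.** **(i)** Let $\mathcal C=I_D/D$. There are constants $0<t<s<1/3$, $L>1/2$, $0<\rho\le1$, $T>\rho$ such that for $\mathcal G=\mathcal G_{T,t,\rho,L}$ the following holds. (a) For every $D_N$ with $D_N/N\to\kappa$: for each $N\ge1$, $\ell$ is finite, unimodal with mode $0$ (unique global maximiser and convex superlevel sets), concave near $0$, radially symmetric, Lipschitz and nonincreasing in $\|\theta\|$; for every $r>0$, with high probability $\ell_N$ and $\pi(\cdot|Z^{(N)})$ are radially symmetric and nonincreasing in $\|\theta\|$ on $\{\|\theta\|\ge r\}$; and $\Pi(B_s|Z^{(N)})\to1$ in probability. (b) There is $\varepsilon>0$ such that for every $D_N$ with $D_N/N\to\kappa$,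 every $c_0>0$, every sequence $\eta_N\in(0,s)$ ($N$ large) and all kernels $\mathcal P_N$ satisfying the step condition $(c_0,1+\varepsilon,\eta_N)$, there are $\vartheta_0=\vartheta_{0,N}\in\Theta_{2/3,\varepsilon}$ ($N$ large) such that the chain started at $\vartheta_0$ satisfies $\tau_{B_s}\ge\exp(\min\{c_0,1\}N/2)$ with high probability. (c) (pCN) There are $c_1,c_2,\varepsilon>0$ such that for every $D_N$ with $D_N/N\to\kappa$ and all step sizes $\beta=\beta_N\in(0,c_1]$ ($N$ large), there are $\vartheta_0=\vartheta_{0,N}\in\Theta_{1,\varepsilon}$ ($N$ large) such that the pCN chain started at $\vartheta_0$ satisfies $\tau_{B_s}\ge e^{c_2D}$ with high probability. **(ii)** Let $\alpha>d/2$, $b=\alpha/d-1/2$ and $\mathcal C=\Sigma_\alpha=\mathrm{diag}(i^{-2\alpha/d}:1\le i\le D)$. There are constants $0<t<s_b<1/2<L$, $0<\rho\le1$, $T>\rho$ such that for $\mathcal G=\mathcal G_{TN^b,\,tN^{-b},\,\rho,\,LN^{-b}}$ and $s=s_bN^{-b}$ the following holds. (a) For every $D_N$ with $D_N/N\to\kappa$: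 for each $N\ge 1$, $\ell$ has the properties listed in (i)(a); for every $r>0$, with high probability $\ell_N$ is radially symmetric and nonincreasing in $\|\theta\|$ on $\{\|\theta\|\ge rN^{-b}\}$; and $\Pi(B_s|Z^{(N)})\to1$ in probability. (b) There are $\varepsilon,C>0$ such that for every $D_N$ with $D_N/N\to\kappa$, every $c_0>0$, every sequence $\eta_N\in(0,s_bN^{-b})$ ($N$ large) and all kernels satisfying the step condition $(c_0,C\sqrt N,\eta_N)$, there are $\vartheta_0\in\Theta_{N^{-b},\varepsilon N^{-b}}$ ($N$ large) such that the chain started at $\vartheta_0$ satisfies $\tau_{B_s}\ge\exp(\min\{c_0,1\}N/2)$ with high probability. (c) (pCN) There are $c_1,c_2,\varepsilon>0$ such that for every $D_N$ with $D_N/N\to\kappa$ and all step sizes $0<\beta=\beta_N\le c_1N^{-1-2b}$ ($N$ large), there are $\vartheta_0\in\Theta_{N^{-b},\varepsilon N^{-b}}$ ($N$ large) such that the pCN chain started at $\vartheta_0$ satisfies $\tau_{B_s}\ge e^{c_2D}$ with high probability. -/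

import Mathlib

open MeasureTheory ProbabilityTheory Filter Topology Set
open scoped ENNReal NNReal

noncomputable section

namespace ColdStart

/-- The parameter space `ℝ^D` (and also the ambient space `ℝ^d` of the covariates). -/
abbrev Vec (D : ℕ) : Type := EuclideanSpace ℝ (Fin D)

/-- Data sets `(Y_i, X_i)`, `i = 1, …, N`. -/
abbrev Data (d N : ℕ) : Type := Fin N → ℝ × Vec d

/-! ### High probability, balls, annuli, hitting times -/

/-- The events `A N` have probability tending to one under the laws `μ N`. -/
def WithHighProbability {Ω : ℕ → Type*} [∀ N, MeasurableSpace (Ω N)]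
    (μ : ∀ N, Measure (Ω N)) (A : ∀ N, Set (Ω N)) : Prop :=
  Tendsto (fun N => μ N (A N)ᶜ) atTop (𝓝 0)

/-- The annulus `Θ_{r,ε}` of all `θ` with `‖θ‖ ∈ (r, r + ε)`. -/
def annulus (D : ℕ) (r ε : ℝ) : Set (Vec D) := {θ | ‖θ‖ ∈ Ioo r (r + ε)}

/-- The ball `B_r` of all `θ` with `‖θ‖ ≤ r`. -/
abbrev centredBall (D : ℕ) (r : ℝ) : Set (Vec D) := Metric.closedBall 0 r

/-- The hitting time `inf {k : x k ∈ A}`, equal to `⊤` if `A` is never visited. -/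
def hittingTime {E : Type*} (A : Set E) (x : ℕ → E) : ℕ∞ :=
  ⨅ k ∈ {k : ℕ | x k ∈ A}, (k : ℕ∞)

/-! ### The regression model -/

/-- A regression map `θ ↦ 𝒢(θ)`, jointly measurable in the parameter and in the covariate. -/
structure ForwardMap (D d : ℕ) where
  toFun : Vec D → Vec d → ℝ
  measurable' : Measurable (Function.uncurry toFun)

/-- The law `P_θ` of one observation `(Y, X)`: `X` is uniform on `𝒳` (a set of volume one), and
`Y = 𝒢(θ)(X) + e` with an independent standard normal error `e`. -/
def obsLaw {D d : ℕ} (𝒳 : Set (Vec d)) (G : ForwardMap D d) (θ : Vec D) : Measure (ℝ × Vec d) :=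
  ((volume.restrict 𝒳).prod (gaussianReal 0 1)).map (fun q => (G.toFun θ q.1 + q.2, q.1))

/-- The law `P_θ^N` of the data, for the ground truth `θ = 0`. -/
def dataLaw {D d : ℕ} (𝒳 : Set (Vec d)) (G : ForwardMap D d) (N : ℕ) : Measure (Data d N) :=
  Measure.pi (fun _ => obsLaw 𝒳 G 0)

/-- The log-likelihood `ℓ_N(θ)` for the data `z`. -/
def logLik {D d N : ℕ} (G : ForwardMap D d) (z : Data d N) (θ : Vec D) : ℝ :=
  -(1 / 2) * ∑ i, |(z i).1 - G.toFun θ (z i).2| ^ 2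

/-- The average log-likelihood `ℓ(θ) = E_0^N ℓ_N(θ)`. -/
def avgLogLik {D d : ℕ} (𝒳 : Set (Vec d)) (G : ForwardMap D d) (N : ℕ) (θ : Vec D) : ℝ :=
  ∫ z, logLik G z θ ∂(dataLaw 𝒳 G N)

/-! ### Gaussian priors and posteriors -/

/-- The covariance matrix `I_D / D`. -/
def isoCov (D : ℕ) : Matrix (Fin D) (Fin D) ℝ := (D : ℝ)⁻¹ • 1

/-- The covariance matrix `Σ_α` of the truncation to the first `D` coordinates of the Gaussian
sequence with independent coordinates of variances `i ^ (-2α/d)`, `i ≥ 1` (the eigenvalues of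
the covariance of an `α`-regular Whittle–Matérn process in dimension `d`). -/
def maternCov (d : ℕ) (α : ℝ) (D : ℕ) : Matrix (Fin D) (Fin D) ℝ :=
  Matrix.diagonal (fun i => ((i : ℝ) + 1) ^ (-(2 * α / (d : ℝ))))

/-- The `N(0, C)` prior. -/
abbrev priorLaw {D : ℕ} (C : Matrix (Fin D) (Fin D) ℝ) : Measure (Vec D) := multivariateGaussian 0 C

/-- The Lebesgue density of `N(0, C)`, for a positive definite `C`. -/
def priorDensity {D : ℕ} (C : Matrix (Fin D) (Fin D) ℝ) (θ : Vec D) : ℝ :=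
  (Real.sqrt ((2 * Real.pi) ^ D * C.det))⁻¹ *
    Real.exp (-(1 / 2) * (WithLp.ofLp θ ⬝ᵥ C⁻¹.mulVec (WithLp.ofLp θ)))

/-- The posterior distribution: the probability measure with density proportional to
`exp (ℓ_N(θ))` with respect to the prior. -/
def posteriorLaw {D d N : ℕ} (G : ForwardMap D d) (C : Matrix (Fin D) (Fin D) ℝ) (z : Data d N) :
    Measure (Vec D) :=
  (priorLaw C).tilted (logLik G z)

/-- The Lebesgue density of the posterior distribution. -/
def posteriorDensity {D d N : ℕ} (G : ForwardMap D d) (C : Matrix (Fin D) (Fin D) ℝ)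
    (z : Data d N) (θ : Vec D) : ℝ :=
  Real.exp (logLik G z θ) * priorDensity C θ / ∫ ϑ, Real.exp (logLik G z ϑ) ∂(priorLaw C)

/-! ### The radial regression maps -/

/-- The radial profile `w`: quadratic on `[0, t/2)`, then linear with slope `T` on `[t/2, t)`,
then linear with slope `ρ` on `[t, L)`, and constant on `[L, ∞)`. -/
def profile (T t ρ L r : ℝ) : ℝ :=
  if r < t / 2 then 4 * (T * r) ^ 2
  else if r < t then (T * t) ^ 2 + T * (r - t / 2)
  else if r < L then (T * t) ^ 2 + T * t / 2 + ρ * (r - t)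
  else (T * t) ^ 2 + T * t / 2 + ρ * (L - t)

theorem measurable_profile (T t ρ L : ℝ) : Measurable (profile T t ρ L) := by
  unfold profile
  refine Measurable.ite measurableSet_Iio (by fun_prop) ?_
  refine Measurable.ite measurableSet_Iio (by fun_prop) ?_
  exact Measurable.ite measurableSet_Iio (by fun_prop) (by fun_prop)

/-- The regression map `𝒢(θ)(x) = √(w(‖θ‖)) g(x)`. -/
def radialMap (D : ℕ) {d : ℕ} (g : Vec d → ℝ) (hg : Measurable g) (T t ρ L : ℝ) :
    ForwardMap D d where
  toFun θ x := Real.sqrt (profile T t ρ L ‖θ‖) * g x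
  measurable' := by
    have h := measurable_profile T t ρ L
    unfold Function.uncurry
    fun_prop

/-- The sequence of regression maps whose profiles live on the scale `N ^ (-b)`: the parameters are
`T N^b`, `t N^(-b)`, `ρ`, `L N^(-b)`. -/
def scaledMap (b : ℝ) (D : ℕ → ℕ) {d : ℕ} (g : Vec d → ℝ) (hg : Measurable g) (T t ρ L : ℝ)
    (N : ℕ) : ForwardMap (D N) d :=
  radialMap (D N) g hg (T * (N : ℝ) ^ b) (t * (N : ℝ) ^ (-b)) ρ (L * (N : ℝ) ^ (-b))

/-- The admissible choices of the function `g` on the covariate space. -/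
structure IsCovariateFactor {d : ℕ} (𝒳 : Set (Vec d)) (g : Vec d → ℝ) : Prop where
  bounds : ∃ gmin gmax : ℝ, 0 < gmin ∧ gmin < gmax ∧ ∀ x ∈ 𝒳, g x ∈ Icc gmin gmax
  norm_one : ∫ x in 𝒳, g x ^ 2 = 1

/-- `f` has the unique global maximiser `m`, and all its superlevel sets are convex. -/
def IsUnimodalWithMode {D : ℕ} (f : Vec D → ℝ) (m : Vec D) : Prop :=
  (∀ θ, θ ≠ m → f θ < f m) ∧ QuasiconcaveOn ℝ univ f

/-- The average log-likelihood exists, is unimodal with mode `0`, locally log-concave near `0`,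
radially symmetric, Lipschitz continuous and monotonically decreasing in `‖θ‖`. -/
structure HasNiceAverage {D d : ℕ} (𝒳 : Set (Vec d)) (G : ForwardMap D d) (N : ℕ) : Prop where
  integrable : ∀ θ, Integrable (fun z : Data d N => logLik G z θ) (dataLaw 𝒳 G N)
  unimodal : IsUnimodalWithMode (avgLogLik 𝒳 G N) 0
  concave_near : ∃ r > 0, ConcaveOn ℝ (Metric.ball 0 r) (avgLogLik 𝒳 G N)
  radial : ∀ θ θ' : Vec D, ‖θ‖ = ‖θ'‖ → avgLogLik 𝒳 G N θ = avgLogLik 𝒳 G N θ'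
  lipschitz : ∃ K : ℝ≥0, LipschitzWith K (avgLogLik 𝒳 G N)
  antitone : ∀ θ θ' : Vec D, ‖θ‖ ≤ ‖θ'‖ → avgLogLik 𝒳 G N θ' ≤ avgLogLik 𝒳 G N θ

/-- `f` is monotonically decreasing in `‖θ‖` (in particular radially symmetric) on the set of all
`θ` with `‖θ‖ ≥ r`. -/
def RadiallyDecreasingFrom {D : ℕ} (r : ℝ) (f : Vec D → ℝ) : Prop :=
  ∀ θ θ' : Vec D, r ≤ ‖θ‖ → ‖θ‖ ≤ ‖θ'‖ → f θ' ≤ f θ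

/-! ### Markov chains driven by the data -/

/-- The law of a time-homogeneous Markov chain with initial law `μ₀` and transition kernel `K`. -/
def chainLaw {S : Type*} [MeasurableSpace S] (μ₀ : Measure S) (K : Kernel S S)
    [IsMarkovKernel K] : Measure (ℕ → S) :=
  Kernel.trajMeasure (X := fun _ => S) μ₀
    (fun n => K.comap (fun h : (i : Finset.Iic n) → S => h ⟨n, Finset.mem_Iic.2 le_rfl⟩)
      (by fun_prop))

/-- The joint law of the data `Z` and of the Markov chain `(ϑ_k)` started at `ϑ₀` whose transition
kernel `P (Z, ·)` depends on `Z`. It is realised as the law of the process `k ↦ (Z, ϑ_k)`, a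
Markov chain which never changes its first component. -/
def jointLaw {D d N : ℕ} (μ : Measure (Data d N)) (P : Kernel (Data d N × Vec D) (Vec D))
    [IsMarkovKernel P] (ϑ₀ : Vec D) : Measure (ℕ → Data d N × Vec D) :=
  chainLaw (μ.prod (Measure.dirac ϑ₀)) (Kernel.deterministic Prod.fst measurable_fst ×ₖ P)

/-- The Markov kernels `P N` have the posterior as invariant distribution, and, with high
probability under the data, steps from the ball `B_L` of size at least `η/2` have probability at
most `exp (-c₀ N)`. -/
structure StepAssumption {d : ℕ} {D : ℕ → ℕ} (𝒳 : Set (Vec d)) (G : ∀ N, ForwardMap (D N) d)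
    (C : ∀ N, Matrix (Fin (D N)) (Fin (D N)) ℝ)
    (P : ∀ N, Kernel (Data d N × Vec (D N)) (Vec (D N))) (c₀ : ℝ) (L η : ℕ → ℝ) : Prop where
  invariant : ∀ᶠ N in atTop, ∀ᵐ z ∂(dataLaw 𝒳 (G N) N),
    ((P N).sectR z).Invariant (posteriorLaw (G N) (C N) z)
  small_steps : WithHighProbability (fun N => dataLaw 𝒳 (G N) N) (fun N =>
    {z | ∀ θ ∈ centredBall (D N) (L N),
      P N (z, θ) {ϑ | η N / 2 ≤ ‖θ - ϑ‖} ≤ ENNReal.ofReal (Real.exp (-(c₀ * N)))})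

/-- With high probability under the joint law of the data and of the chain with kernel `P N` and
initial point `ϑ₀ N`, the hitting time of the ball `B_{s N}` is at least `exp (a N)`. -/
def HitsLate {d : ℕ} {D : ℕ → ℕ} (𝒳 : Set (Vec d)) (G : ∀ N, ForwardMap (D N) d)
    (P : ∀ N, Kernel (Data d N × Vec (D N)) (Vec (D N))) [∀ N, IsMarkovKernel (P N)]
    (ϑ₀ : ∀ N, Vec (D N)) (s a : ℕ → ℝ) : Prop :=
  WithHighProbability (fun N => jointLaw (dataLaw 𝒳 (G N) N) (P N) (ϑ₀ N)) (fun N =>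
    {ω | ENNReal.ofReal (Real.exp (a N)) ≤
      ((hittingTime (centredBall (D N) (s N)) (fun k => (ω k).2) : ℕ∞) : ℝ≥0∞)})

/-! ### Preconditioned Crank–Nicolson -/

/-- One step of pCN from `θ` for the log-likelihood `l`, with Gaussian increment `ξ` and a uniform
variable `u` that decides on acceptance: the proposal is `√(1-β) θ + √β ξ`, and it is accepted
if `u ≤ min {1, exp (l(p) - l(θ))}`. -/
def pcnStep {D : ℕ} (β : ℝ) (l : Vec D → ℝ) (θ ξ : Vec D) (u : ℝ) : Vec D :=
  let p : Vec D := Real.sqrt (1 - β) • θ + Real.sqrt β • ξ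
  if u ≤ min 1 (Real.exp (l p - l θ)) then p else θ

theorem measurable_logLik {D d N : ℕ} (G : ForwardMap D d) :
    Measurable (fun q : Data d N × Vec D => logLik G q.1 q.2) := by
  have hG := G.measurable'
  unfold logLik
  refine Measurable.const_mul (Finset.measurable_fun_sum _ fun i _ => ?_) _
  have h : Measurable (fun q : Data d N × Vec D => G.toFun q.2 (q.1 i).2) :=
    hG.comp (by fun_prop : Measurable fun q : Data d N × Vec D => (q.2, (q.1 i).2))
  exact (((by fun_prop : Measurable fun q : Data d N × Vec D => (q.1 i).1).sub h).abs).pow_const 2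

theorem measurable_pcnStep_aux {A : Type*} [MeasurableSpace A] {D : ℕ} (β : ℝ)
    (l : A → Vec D → ℝ) (hl : Measurable (Function.uncurry l)) :
    Measurable (fun q : (A × Vec D) × (Vec D × ℝ) =>
      pcnStep β (l q.1.1) q.1.2 q.2.1 q.2.2) := by
  have hp : Measurable (fun q : (A × Vec D) × (Vec D × ℝ) =>
      Real.sqrt (1 - β) • q.1.2 + Real.sqrt β • q.2.1) := by fun_prop
  have h1 : Measurable (fun q : (A × Vec D) × (Vec D × ℝ) =>
      l q.1.1 (Real.sqrt (1 - β) • q.1.2 + Real.sqrt β • q.2.1)) :=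
    hl.comp ((measurable_fst.comp measurable_fst).prodMk hp)
  have h2 : Measurable (fun q : (A × Vec D) × (Vec D × ℝ) => l q.1.1 q.1.2) :=
    hl.comp measurable_fst
  exact Measurable.ite (measurableSet_le (measurable_snd.comp measurable_snd)
    (measurable_const.min (h1.sub h2).exp)) hp (measurable_snd.comp measurable_fst)

theorem measurable_pcnStep {D d N : ℕ} (G : ForwardMap D d) (β : ℝ) :
    Measurable (fun q : (Data d N × Vec D) × (Vec D × ℝ) =>
      pcnStep β (logLik G q.1.1) q.1.2 q.2.1 q.2.2) :=
  measurable_pcnStep_aux β (fun z : Data d N => logLik G z) (measurable_logLik G)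

/-- The transition kernel of pCN with step size `β` for the posterior arising from the `N(0, C)`
prior and the data: the law of one pCN step, where the increment `ξ ∼ N(0, C)` and the uniform
variable on `[0, 1]` are independent. -/
def pcnKernel {D d : ℕ} (N : ℕ) (G : ForwardMap D d) (C : Matrix (Fin D) (Fin D) ℝ) (β : ℝ) :
    Kernel (Data d N × Vec D) (Vec D) :=
  (Kernel.id ×ₖ Kernel.const (Data d N × Vec D)
    ((priorLaw C).prod (volume.restrict (Icc (0 : ℝ) 1)))).map
    (fun q => pcnStep β (logLik G q.1.1) q.1.2 q.2.1 q.2.2)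

theorem isProbabilityMeasure_uniform :
    IsProbabilityMeasure (volume.restrict (Icc (0 : ℝ) 1)) := ⟨by simp⟩

instance isMarkovKernel_pcnKernel {D d : ℕ} (N : ℕ) (G : ForwardMap D d)
    (C : Matrix (Fin D) (Fin D) ℝ) (β : ℝ) : IsMarkovKernel (pcnKernel N G C β) := by
  have := isProbabilityMeasure_uniform
  unfold pcnKernel
  exact Kernel.IsMarkovKernel.map _ (measurable_pcnStep G β)

end ColdStart

end

open ColdStart

/-! The obstruction is an entropy barrier. Since `w(0) = 0`, the data are pure noise, and `ℓ_N(θ)`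
depends on `θ` only through `w = w(‖θ‖)`: it equals `-½ ∑ Y_i² + √w S - w I / 2` with `S = ∑ Y_i
g(X_i)` and `I = ∑ g(X_i)²`. With high probability `|S| ≤ δ N` for any fixed `δ > 0`, and `I` lies
between `gmin² N` and `gmax² N`. On this event everything is deterministic (`goodData`,
`tendsto_compl_goodData`).

In dimension `D ∼ κ N` the prior gives a ball of radius `r N^(-b)` mass at most `e^(-aN)`, with `a`
as large as desired once `r` is small, while an annulus at radius `N^(-b)` keeps mass at least
`e^(-aN)` for one fixed `a` (`PriorScaling`). Beyond the knee `t` the profile has slope `ρ` only, so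
there the log-likelihood varies by at most `c N`, with `c` free of `T`: the steep part of `w` is a
common constant and cancels. Hence for small `s` a thin shell outside `B_s` is exponentially less
likely under the posterior than the annulus. Inside the knee the slope `T` is chosen last, so large
that the gain in likelihood pays for the tiny prior mass of the ball of radius `t/2`; thus the
posterior still concentrates on `B_s`.

A chain with short steps has to land in the shell before it enters `B_s`. Started from the
posterior, it is in the shell at a given time with exactly the posterior mass of the shell, by
invariance. Comparing densities turns this into a bound for starts drawn from the prior restricted
to the annulus, averaged over good data; some fixed point of the annulus is no worse than the
average, which gives a starting point independent of the data (`setLIntegral_le_of_tilted`,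
`exists_start_hit_le`). A union bound over exponentially many steps concludes (`exists_hitsLate`).

pCN is one such chain: it is reversible for the posterior (`pcnKernel_invariant`), and a long step
requires a Gaussian increment of atypical norm (`pcnKernel_step_le`). -/

noncomputable section

namespace ColdStart

/-! ### Gaussian small balls, tails and boxes -/

/-- The standard Gaussian measure on `Fin D → ℝ`. -/
abbrev gaussPi (D : ℕ) : Measure (Fin D → ℝ) := Measure.pi (fun _ => gaussianReal 0 1)

/-- The linear map scaling the `i`-th coordinate by `√(v i)`. -/
def scaleCoord {D : ℕ} (v : Fin D → ℝ) (z : Fin D → ℝ) : Vec D :=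
  WithLp.toLp 2 (fun i => Real.sqrt (v i) * z i)

theorem measurable_scaleCoord {D : ℕ} (v : Fin D → ℝ) : Measurable (scaleCoord v) := by
  unfold scaleCoord
  fun_prop

theorem norm_sq_scaleCoord {D : ℕ} {v : Fin D → ℝ} (hv : ∀ i, 0 ≤ v i) (z : Fin D → ℝ) :
    ‖scaleCoord v z‖ ^ 2 = ∑ i, v i * z i ^ 2 := by
  rw [EuclideanSpace.real_norm_sq_eq]
  refine Finset.sum_congr rfl fun i _ => ?_
  simp [scaleCoord, mul_pow, Real.sq_sqrt (hv i)]

/-- Both characteristic functions factor over the coordinates. The representation reduces every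
prior estimate to independent standard normals. -/
theorem priorLaw_diagonal {D : ℕ} {v : Fin D → ℝ} (hv : ∀ i, 0 ≤ v i) :
    priorLaw (Matrix.diagonal v) = (gaussPi D).map (scaleCoord v) := by
  have hS : (Matrix.diagonal v).PosSemidef := Matrix.PosSemidef.diagonal hv
  have : IsProbabilityMeasure ((gaussPi D).map (scaleCoord v)) :=
    Measure.isProbabilityMeasure_map (measurable_scaleCoord v).aemeasurable
  apply Measure.ext_of_charFun
  ext t
  rw [charFun_multivariateGaussian hS, charFun_apply,
    integral_map (measurable_scaleCoord v).aemeasurable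
      (Measurable.aestronglyMeasurable (by fun_prop))]
  have h1 : ∀ z : Fin D → ℝ, Complex.exp ((inner ℝ (scaleCoord v z) t : ℝ) * Complex.I)
      = ∏ i, Complex.exp (((Real.sqrt (v i) * t i : ℝ) : ℂ) * (z i : ℂ) * Complex.I) := by
    intro z
    rw [← Complex.exp_sum, PiLp.inner_apply]
    congr 1
    push_cast
    rw [Finset.sum_mul]
    refine Finset.sum_congr rfl fun i _ => ?_
    simp [scaleCoord]
    ring
  simp_rw [h1]
  rw [integral_fintype_prod_eq_prod
    (f := fun i (x : ℝ) => Complex.exp (((Real.sqrt (v i) * t i : ℝ) : ℂ) * (x : ℂ) * Complex.I))]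
  simp_rw [← charFun_apply_real, charFun_gaussianReal]
  rw [← Complex.exp_sum]
  congr 1
  simp only [inner_zero_right, Complex.ofReal_zero, zero_mul, zero_sub, mul_zero, NNReal.coe_one,
    Complex.ofReal_one, one_mul, Matrix.mulVec_diagonal, dotProduct]
  push_cast
  rw [Finset.sum_div, ← Finset.sum_neg_distrib]
  refine Finset.sum_congr rfl fun i _ => ?_
  have : ((Real.sqrt (v i) : ℝ) : ℂ) ^ 2 = (v i : ℂ) := by
    rw [← Complex.ofReal_pow, Real.sq_sqrt (hv i)]
  rw [mul_pow, this]
  ring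

theorem lintegral_exp_neg_mul_sq_gaussianReal {lam : ℝ} (h : -(1 / 2) < lam) :
    ∫⁻ x, ENNReal.ofReal (Real.exp (-lam * x ^ 2)) ∂(gaussianReal 0 1)
      = ENNReal.ofReal (Real.sqrt (1 + 2 * lam))⁻¹ := by
  rw [gaussianReal_of_var_ne_zero _ one_ne_zero,
    lintegral_withDensity_eq_lintegral_mul _ (measurable_gaussianPDF 0 1) (by fun_prop)]
  have hb : 0 < lam + 1 / 2 := by linarith
  have hint := integrable_exp_neg_mul_sq hb
  have : ∀ x : ℝ, (gaussianPDF 0 1 * fun x => ENNReal.ofReal (Real.exp (-lam * x ^ 2))) x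
      = ENNReal.ofReal ((Real.sqrt (2 * Real.pi))⁻¹ * Real.exp (-(lam + 1 / 2) * x ^ 2)) := by
    intro x
    simp only [Pi.mul_apply, gaussianPDF, gaussianPDFReal]
    rw [← ENNReal.ofReal_mul (by positivity)]
    congr 1
    simp only [NNReal.coe_one, mul_one, sub_zero]
    rw [mul_assoc, ← Real.exp_add]
    congr 2
    ring
  simp_rw [this]
  rw [← ofReal_integral_eq_lintegral_ofReal (hint.const_mul _)
    (Eventually.of_forall fun x => by positivity), integral_const_mul, integral_gaussian]
  congr 1
  rw [← Real.sqrt_inv, ← Real.sqrt_mul (by positivity), ← Real.sqrt_inv]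
  congr 1
  have := Real.pi_pos
  have h2 : 1 + 2 * lam ≠ 0 := by linarith
  rw [show lam + 1 / 2 = (1 + 2 * lam) / 2 by ring]
  field_simp

theorem lintegral_prod_gaussPi {D : ℕ} {f : ℝ → ℝ≥0∞} (hf : Measurable f) :
    ∫⁻ z, ∏ i, f (z i) ∂(gaussPi D) = (∫⁻ x, f x ∂(gaussianReal 0 1)) ^ D := by
  have hind : iIndepFun (fun (i : Fin D) (z : Fin D → ℝ) => f (z i)) (gaussPi D) :=
    iIndepFun_pi (X := fun _ => f) fun _ => hf.aemeasurable
  rw [lintegral_prod_eq_prod_lintegral_of_indepFun _ _ hind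
    fun i => hf.comp (measurable_pi_apply i)]
  have h1 : ∀ i : Fin D, ∫⁻ z, f (z i) ∂(gaussPi D) = ∫⁻ x, f x ∂(gaussianReal 0 1) := fun i =>
    (measurePreserving_eval (fun _ : Fin D => gaussianReal 0 1) i).lintegral_comp hf
  simp [h1]

/-- Exponential Markov inequality for `∑ z_i²`; `lam > 0` controls small balls, `lam < 0` tails. -/
theorem gaussPi_sum_sq_le {D : ℕ} {lam : ℝ} (h : -(1 / 2) < lam) (q : ℝ) :
    gaussPi D {z | lam * ∑ i, z i ^ 2 ≤ lam * (q * D)} ≤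
      ENNReal.ofReal ((Real.exp (lam * q) * (Real.sqrt (1 + 2 * lam))⁻¹) ^ D) := by
  have key := mul_meas_ge_le_lintegral₀ (μ := gaussPi D)
    (f := fun z => ∏ i, ENNReal.ofReal (Real.exp (-lam * (z i) ^ 2)))
    (Finset.measurable_fun_prod _ fun i _ => by fun_prop).aemeasurable
    (ENNReal.ofReal (Real.exp (-(lam * (q * D)))))
  rw [lintegral_prod_gaussPi (f := fun x => ENNReal.ofReal (Real.exp (-lam * x ^ 2)))
    (by fun_prop), lintegral_exp_neg_mul_sq_gaussianReal h] at key
  have hset : {z : Fin D → ℝ | lam * ∑ i, z i ^ 2 ≤ lam * (q * D)} ⊆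
      {z | ENNReal.ofReal (Real.exp (-(lam * (q * D)))) ≤
        ∏ i, ENNReal.ofReal (Real.exp (-lam * (z i) ^ 2))} := by
    intro z hz
    simp only [mem_ofPred_eq] at hz ⊢
    rw [← ENNReal.ofReal_prod_of_nonneg (fun _ _ => by positivity), ← Real.exp_sum]
    apply ENNReal.ofReal_le_ofReal
    rw [Real.exp_le_exp, ← Finset.mul_sum]
    linarith
  refine (measure_mono hset).trans ?_
  rw [mul_comm, ← ENNReal.le_div_iff_mul_le (by left; simp [Real.exp_pos]) (by left; simp)] at key
  refine key.trans (le_of_eq ?_)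
  rw [← ENNReal.ofReal_pow (by positivity), ← ENNReal.ofReal_div_of_pos (Real.exp_pos _)]
  congr 1
  rw [mul_pow, ← Real.exp_nat_mul, Real.exp_neg, div_inv_eq_mul, mul_comm]
  congr 2
  ring

/-- Exponential Markov with `lam = 1/q` costs a factor `e (1 + 2/q)^(-1/2)` per coordinate, which
becomes arbitrarily small with `q`. The choice of `q` makes `2/q = e^(2A+2)`. -/
theorem exists_gaussPi_small_ball_le (A : ℝ) : ∃ q > 0, ∀ D : ℕ,
    gaussPi D {z | ∑ i, z i ^ 2 ≤ q * D} ≤ ENNReal.ofReal (Real.exp (-(A * D))) := by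
  refine ⟨2 * Real.exp (-(2 * A + 2)), by positivity, fun D => ?_⟩
  set q := 2 * Real.exp (-(2 * A + 2)) with hq
  have hq0 : 0 < q := by positivity
  have hq1 : 0 < 1 / q := by positivity
  have h := gaussPi_sum_sq_le (D := D) (lam := 1 / q) (by linarith) q
  have hs : {z : Fin D → ℝ | ∑ i, z i ^ 2 ≤ q * D} ⊆
      {z | 1 / q * ∑ i, z i ^ 2 ≤ 1 / q * (q * D)} := fun z hz => by
    simp only [mem_ofPred_eq] at hz ⊢
    exact mul_le_mul_of_nonneg_left hz hq1.le
  refine (measure_mono hs).trans (h.trans (ENNReal.ofReal_le_ofReal ?_))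
  have h2 : Real.exp (A + 1) ≤ Real.sqrt (1 + 2 * (1 / q)) := by
    apply Real.le_sqrt_of_sq_le
    rw [hq, ← Real.exp_nat_mul, mul_one_div, div_mul_cancel_left₀ (two_ne_zero' ℝ),
      ← Real.exp_neg, neg_neg]
    push_cast
    rw [mul_add, mul_one]
    linarith
  calc (Real.exp (1 / q * q) * (Real.sqrt (1 + 2 * (1 / q)))⁻¹) ^ D
      ≤ (Real.exp 1 * (Real.exp (A + 1))⁻¹) ^ D := by
        rw [one_div_mul_cancel hq0.ne']
        gcongr
    _ = Real.exp (-(A * D)) := by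
        rw [← Real.exp_neg, ← Real.exp_add, ← Real.exp_nat_mul]
        congr 1
        ring

/-- Exponential Markov with `lam = -1/4`: each coordinate contributes `√2 e^(-(|A|+1))`, and `√2 ≤
e`. -/
theorem exists_gaussPi_tail_le (A : ℝ) : ∃ q > 0, ∀ D : ℕ,
    gaussPi D {z | q * D ≤ ∑ i, z i ^ 2} ≤ ENNReal.ofReal (Real.exp (-(A * D))) := by
  refine ⟨4 * (|A| + 1), by positivity, fun D => ?_⟩
  have h := gaussPi_sum_sq_le (D := D) (lam := -(1 / 4)) (by norm_num) (4 * (|A| + 1))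
  have hs : {z : Fin D → ℝ | 4 * (|A| + 1) * D ≤ ∑ i, z i ^ 2} ⊆
      {z | -(1 / 4) * ∑ i, z i ^ 2 ≤ -(1 / 4) * (4 * (|A| + 1) * D)} := fun z hz => by
    simp only [mem_ofPred_eq] at hz ⊢
    exact mul_le_mul_of_nonpos_left hz (by norm_num)
  refine (measure_mono hs).trans (h.trans (ENNReal.ofReal_le_ofReal ?_))
  have h2 : Real.exp (-1) ≤ Real.sqrt (1 + 2 * -(1 / 4)) := by
    apply Real.le_sqrt_of_sq_le
    rw [← Real.exp_nat_mul]
    have := Real.exp_one_gt_d9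
    have h3 : Real.exp (((2 : ℕ) : ℝ) * -1) * Real.exp 1 ≤ 1 := by
      rw [← Real.exp_add]
      exact Real.exp_le_one_iff.2 (by norm_num)
    have h4 := Real.exp_pos (((2 : ℕ) : ℝ) * -1)
    norm_num at *
    nlinarith
  calc (Real.exp (-(1 / 4) * (4 * (|A| + 1))) * (Real.sqrt (1 + 2 * -(1 / 4)))⁻¹) ^ D
      ≤ (Real.exp (-(1 / 4) * (4 * (|A| + 1))) * (Real.exp (-1))⁻¹) ^ D := by
        gcongr
    _ = Real.exp (-(|A| * D)) := by
        rw [← Real.exp_neg, ← Real.exp_add, ← Real.exp_nat_mul]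
        congr 1
        ring
    _ ≤ Real.exp (-(A * D)) := by
        gcongr
        exact le_abs_self A

theorem le_gaussianReal_Ioo {k M : ℝ} (hk : 0 ≤ k) (hM : 2 * k ≤ M) :
    ENNReal.ofReal (gaussianPDFReal 0 1 M * k) ≤ gaussianReal 0 1 (Ioo k (2 * k)) := by
  rw [gaussianReal_apply _ one_ne_zero]
  calc ENNReal.ofReal (gaussianPDFReal 0 1 M * k)
      = ∫⁻ _ in Ioo k (2 * k), ENNReal.ofReal (gaussianPDFReal 0 1 M) := by
        rw [setLIntegral_const, Real.volume_Ioo, ← ENNReal.ofReal_mul (gaussianPDFReal_nonneg _ _ _)]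
        congr 1
        ring
    _ ≤ _ := by
        refine setLIntegral_mono (measurable_gaussianPDF 0 1) fun x hx => ?_
        apply ENNReal.ofReal_le_ofReal
        simp only [gaussianPDFReal, sub_zero, NNReal.coe_one, mul_one]
        have h1 : 0 ≤ x := hk.trans hx.1.le
        have h2 : x ≤ M := hx.2.le.trans hM
        gcongr

theorem le_gaussPi_box {D : ℕ} {k : Fin D → ℝ} {M : ℝ} (hk : ∀ i, 0 ≤ k i)
    (hM : ∀ i, 2 * k i ≤ M) :
    ENNReal.ofReal (∏ i, gaussianPDFReal 0 1 M * k i) ≤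
      gaussPi D (Set.pi univ fun i => Ioo (k i) (2 * k i)) := by
  rw [Measure.pi_pi, ENNReal.ofReal_prod_of_nonneg
    (fun i _ => mul_nonneg (gaussianPDFReal_nonneg _ _ _) (hk i))]
  exact Finset.prod_le_prod' fun i _ => le_gaussianReal_Ioo (hk i) (hM i)

/-! ### Prior mass estimates on the scale `N^(-b)` -/

/-- Exponential estimates for the masses of small balls, of an annulus and of the tails under the
priors `N(0, C_D)`, on the scale `N ^ (-b)`, when `D ∼ κ N`. -/
structure PriorScaling (C : ∀ D, Matrix (Fin D) (Fin D) ℝ) (κ b : ℝ) (τ : ℕ → ℝ) : Prop where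
  small_ball_le : ∀ a : ℝ, ∃ r > 0, ∀ D : ℕ → ℕ,
    Tendsto (fun N => (D N : ℝ) / (N : ℝ)) atTop (𝓝 κ) → ∀ᶠ N : ℕ in atTop,
      priorLaw (C (D N)) (centredBall (D N) (r * (N : ℝ) ^ (-b))) ≤
        ENNReal.ofReal (Real.exp (-(a * N)))
  le_small_ball : ∀ r > 0, ∃ a > 0, ∀ D : ℕ → ℕ,
    Tendsto (fun N => (D N : ℝ) / (N : ℝ)) atTop (𝓝 κ) → ∀ᶠ N : ℕ in atTop,
      ENNReal.ofReal (Real.exp (-(a * N))) ≤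
        priorLaw (C (D N)) (centredBall (D N) (r * (N : ℝ) ^ (-b)))
  le_annulus : ∃ ε > 0, ∃ a > 0, ∀ D : ℕ → ℕ,
    Tendsto (fun N => (D N : ℝ) / (N : ℝ)) atTop (𝓝 κ) → ∀ᶠ N : ℕ in atTop,
      ENNReal.ofReal (Real.exp (-(a * N))) ≤
        priorLaw (C (D N)) (annulus (D N) ((N : ℝ) ^ (-b)) (ε * (N : ℝ) ^ (-b)))
  tail_le : ∀ a : ℝ, ∃ R > 0, ∀ D : ℕ → ℕ,
    Tendsto (fun N => (D N : ℝ) / (N : ℝ)) atTop (𝓝 κ) → ∀ᶠ N : ℕ in atTop,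
      priorLaw (C (D N)) {θ | R * τ N < ‖θ‖} ≤ ENNReal.ofReal (Real.exp (-(a * N)))

theorem eventually_dim_bounds {κ : ℝ} (hκ : 0 < κ) {D : ℕ → ℕ}
    (hD : Tendsto (fun N => (D N : ℝ) / (N : ℝ)) atTop (𝓝 κ)) :
    ∀ᶠ N : ℕ in atTop, 0 < (N : ℝ) ∧ 0 < (D N : ℝ) ∧ κ / 2 * N ≤ D N ∧ (D N : ℝ) ≤ 2 * κ * N := by
  filter_upwards [hD.eventually (Icc_mem_nhds (show κ / 2 < κ by linarith)
    (show κ < 2 * κ by linarith)), eventually_gt_atTop 0] with N h1 h2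
  have hN : 0 < (N : ℝ) := by exact_mod_cast h2
  have h3 : κ / 2 * N ≤ D N := (le_div_iff₀ hN).1 h1.1
  exact ⟨hN, lt_of_lt_of_le (by positivity) h3, h3, (div_le_iff₀ hN).1 h1.2⟩

section Diagonal

variable {v : ∀ D : ℕ, Fin D → ℝ} {κ b m M a₀ : ℝ} {τ : ℕ → ℝ}

/-- Every variance is at least of order `N^(-2b)/N`, so a small ball for `θ` forces `∑ z_i²` to be a
small multiple of `D`. -/
theorem small_ball_le_diagonal (hκ : 0 < κ) (hv : ∀ D i, 0 < v D i) (hm : 0 < m)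
    (hlow : ∀ D : ℕ → ℕ, Tendsto (fun N => (D N : ℝ) / (N : ℝ)) atTop (𝓝 κ) →
      ∀ᶠ N : ℕ in atTop, ∀ i, m * ((N : ℝ) ^ (-b)) ^ 2 / N ≤ v (D N) i) (a : ℝ) :
    ∃ r > 0, ∀ D : ℕ → ℕ,
    Tendsto (fun N => (D N : ℝ) / (N : ℝ)) atTop (𝓝 κ) → ∀ᶠ N : ℕ in atTop,
      priorLaw (Matrix.diagonal (v (D N))) (centredBall (D N) (r * (N : ℝ) ^ (-b))) ≤
        ENNReal.ofReal (Real.exp (-(a * N))) := by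
  obtain ⟨q, hq, hball⟩ := exists_gaussPi_small_ball_le (2 * |a| / κ)
  refine ⟨Real.sqrt (m * q * (κ / 2)), by positivity, fun D hD => ?_⟩
  filter_upwards [hlow D hD, eventually_dim_bounds hκ hD] with N hN ⟨hN0, hD0, hD1, hD2⟩
  rw [priorLaw_diagonal (fun i => (hv _ i).le), Measure.map_apply (measurable_scaleCoord _)
    measurableSet_closedBall]
  have hs : 0 < (N : ℝ) ^ (-b) := by positivity
  refine (measure_mono ?_).trans ((hball (D N)).trans (ENNReal.ofReal_le_ofReal ?_))
  · intro z hz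
    simp only [mem_preimage, Metric.mem_closedBall, dist_zero_right, mem_ofPred_eq] at hz ⊢
    have h1 := pow_le_pow_left₀ (norm_nonneg _) hz 2
    rw [norm_sq_scaleCoord (fun i => (hv _ i).le), mul_pow, Real.sq_sqrt (by positivity)] at h1
    have h2 : m * ((N : ℝ) ^ (-b)) ^ 2 / N * ∑ i, z i ^ 2 ≤ ∑ i, v (D N) i * z i ^ 2 := by
      rw [Finset.mul_sum]
      exact Finset.sum_le_sum fun i _ => mul_le_mul_of_nonneg_right (hN i) (sq_nonneg _)
    have h3 : 0 < m * ((N : ℝ) ^ (-b)) ^ 2 / N := by positivity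
    have h4 : m * q * (κ / 2) * ((N : ℝ) ^ (-b)) ^ 2
        = m * ((N : ℝ) ^ (-b)) ^ 2 / N * (q * (κ / 2 * N)) := by field_simp
    have h5 := le_of_mul_le_mul_left ((h2.trans h1).trans h4.le) h3
    exact h5.trans (by gcongr)
  · rw [Real.exp_le_exp, neg_le_neg_iff]
    calc a * N ≤ |a| * N := by gcongr; exact le_abs_self a
      _ = 2 * |a| / κ * (κ / 2 * N) := by field_simp
      _ ≤ _ := by gcongr

theorem tail_le_diagonal (hκ : 0 < κ) (hv : ∀ D i, 0 < v D i) (hM : 0 < M)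
    (hτ : ∀ᶠ N in atTop, 0 < τ N)
    (hup : ∀ D : ℕ → ℕ, Tendsto (fun N => (D N : ℝ) / (N : ℝ)) atTop (𝓝 κ) →
      ∀ᶠ N : ℕ in atTop, ∀ i, v (D N) i ≤ M * τ N ^ 2 / N) (a : ℝ) :
    ∃ R > 0, ∀ D : ℕ → ℕ,
    Tendsto (fun N => (D N : ℝ) / (N : ℝ)) atTop (𝓝 κ) → ∀ᶠ N : ℕ in atTop,
      priorLaw (Matrix.diagonal (v (D N))) {θ | R * τ N < ‖θ‖} ≤
        ENNReal.ofReal (Real.exp (-(a * N))) := by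
  obtain ⟨q, hq, htail⟩ := exists_gaussPi_tail_le (2 * |a| / κ)
  refine ⟨Real.sqrt (M * q * (2 * κ)), by positivity, fun D hD => ?_⟩
  filter_upwards [hup D hD, eventually_dim_bounds hκ hD, hτ] with N hN ⟨hN0, hD0, hD1, hD2⟩ hτN
  rw [priorLaw_diagonal (fun i => (hv _ i).le), Measure.map_apply (measurable_scaleCoord _)
    (measurableSet_lt (by fun_prop) (by fun_prop))]
  refine (measure_mono ?_).trans ((htail (D N)).trans (ENNReal.ofReal_le_ofReal ?_))
  · intro z hz
    simp only [mem_preimage, mem_ofPred_eq] at hz ⊢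
    have h1 := pow_le_pow_left₀ (by positivity) hz.le 2
    rw [norm_sq_scaleCoord (fun i => (hv _ i).le), mul_pow, Real.sq_sqrt (by positivity)] at h1
    have h2 : ∑ i, v (D N) i * z i ^ 2 ≤ M * τ N ^ 2 / N * ∑ i, z i ^ 2 := by
      rw [Finset.mul_sum]
      exact Finset.sum_le_sum fun i _ => mul_le_mul_of_nonneg_right (hN i) (sq_nonneg _)
    have h3 : 0 < M * τ N ^ 2 / N := by positivity
    have h4 : M * q * (2 * κ) * τ N ^ 2 = M * τ N ^ 2 / N * (q * (2 * κ * N)) := by field_simp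
    have h5 := le_of_mul_le_mul_left (h4.ge.trans (h1.trans h2)) h3
    exact le_trans (by gcongr) h5
  · rw [Real.exp_le_exp, neg_le_neg_iff]
    calc a * N ≤ |a| * N := by gcongr; exact le_abs_self a
      _ = 2 * |a| / κ * (κ / 2 * N) := by field_simp
      _ ≤ _ := by gcongr

/-- The box `k_i < z_i < 2 k_i` is chosen so that all coordinates of `θ` contribute equally to
`‖θ‖²`, which confines the norm to a shell. Its mass is at least `∏ p k_i`, with `p` a common lower
bound of the normal density. This is exponential in `N` as soon as the product of the normalized
variances is, which is what `hprod` provides. -/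
theorem le_shell_diagonal (hκ : 0 < κ) (hv : ∀ D i, 0 < v D i) (hm : 0 < m)
    (hlow : ∀ D : ℕ → ℕ, Tendsto (fun N => (D N : ℝ) / (N : ℝ)) atTop (𝓝 κ) →
      ∀ᶠ N : ℕ in atTop, ∀ i, m * ((N : ℝ) ^ (-b)) ^ 2 / N ≤ v (D N) i)
    (hprod : ∀ D : ℕ → ℕ, Tendsto (fun N => (D N : ℝ) / (N : ℝ)) atTop (𝓝 κ) →
      ∀ᶠ N : ℕ in atTop, ∏ i, (v (D N) i * N / ((N : ℝ) ^ (-b)) ^ 2) ≤ Real.exp (a₀ * N))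
    {c : ℝ} (hc : 0 < c) :
    ∃ a > 0, ∀ D : ℕ → ℕ,
    Tendsto (fun N => (D N : ℝ) / (N : ℝ)) atTop (𝓝 κ) → ∀ᶠ N : ℕ in atTop,
      ENNReal.ofReal (Real.exp (-(a * N))) ≤ priorLaw (Matrix.diagonal (v (D N)))
        {θ | c ^ 2 * (κ / 2) * ((N : ℝ) ^ (-b)) ^ 2 < ‖θ‖ ^ 2 ∧
          ‖θ‖ ^ 2 < 4 * c ^ 2 * (2 * κ) * ((N : ℝ) ^ (-b)) ^ 2} := by
  -- All `u_i ≥ m`, so every box side lies below `2c/√m` and the density there is at least `p`.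
  set p := gaussianPDFReal 0 1 (2 * (c / Real.sqrt m)) with hp
  have hp0 : 0 < p := gaussianPDFReal_pos _ _ _ one_ne_zero
  have hpc : 0 < p * c := by positivity
  refine ⟨|Real.log (p * c)| * (2 * κ) + |a₀| / 2 + 1, by positivity, fun D hD => ?_⟩
  filter_upwards [hlow D hD, hprod D hD, eventually_dim_bounds hκ hD]
    with N hN hNp ⟨hN0, hD0, hD1, hD2⟩
  have hs : 0 < (N : ℝ) ^ (-b) := by positivity
  set q := (N : ℝ) ^ (-b) with hq
  set u : Fin (D N) → ℝ := fun i => v (D N) i * N / q ^ 2 with hu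
  have hu0 : ∀ i, 0 < u i := fun i => by have := hv (D N) i; positivity
  have hum : ∀ i, m ≤ u i := by
    intro i
    rw [hu]
    simp only
    rw [le_div_iff₀ (by positivity)]
    have := hN i
    rwa [div_le_iff₀ hN0] at this
  set k : Fin (D N) → ℝ := fun i => c / Real.sqrt (u i) with hk
  have hk0 : ∀ i, 0 < k i := fun i => by have := hu0 i; positivity
  have hk1 : ∀ i, 2 * k i ≤ 2 * (c / Real.sqrt m) := fun i => by
    have := hum i
    simp only [hk]
    gcongr
  have hvk : ∀ i, v (D N) i * k i ^ 2 = c ^ 2 * q ^ 2 / N := by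
    intro i
    have h1 := (hv (D N) i).ne'
    simp only [hk]
    rw [div_pow, Real.sq_sqrt (hu0 i).le]
    simp only [hu]
    field_simp
  have hmeas : MeasurableSet {θ : Vec (D N) | c ^ 2 * (κ / 2) * q ^ 2 < ‖θ‖ ^ 2 ∧
      ‖θ‖ ^ 2 < 4 * c ^ 2 * (2 * κ) * q ^ 2} :=
    (measurableSet_Ioo (a := c ^ 2 * (κ / 2) * q ^ 2)
      (b := 4 * c ^ 2 * (2 * κ) * q ^ 2)).preimage (f := fun θ : Vec (D N) => ‖θ‖ ^ 2) (by fun_prop)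
  rw [priorLaw_diagonal (fun i => (hv _ i).le), Measure.map_apply (measurable_scaleCoord _) hmeas]
  refine le_trans ?_ ((le_gaussPi_box (fun i => (hk0 i).le) hk1).trans (measure_mono ?_))
  · apply ENNReal.ofReal_le_ofReal
    rw [← hp]
    -- Individual variances enter the box volume only through their product.
    have h1 : ∏ i, p * k i = (p * c) ^ (D N) / Real.sqrt (∏ i, u i) := by
      rw [Real.sqrt_prod _ (fun i _ => (hu0 i).le)]
      simp only [hk, mul_div_assoc', Finset.prod_div_distrib]
      simp
    rw [h1]
    have h2 : Real.sqrt (∏ i, u i) ≤ Real.exp (|a₀| / 2 * N) := by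
      rw [Real.sqrt_le_left (by positivity), ← Real.exp_nat_mul]
      refine hNp.trans (Real.exp_le_exp.2 ?_)
      push_cast
      have : a₀ * N ≤ |a₀| * N := by gcongr; exact le_abs_self _
      linarith
    have h3 : Real.exp (-(|Real.log (p * c)| * (2 * κ) * N)) ≤ (p * c) ^ (D N) := by
      rw [← Real.exp_log hpc, ← Real.exp_nat_mul, Real.exp_log hpc, Real.exp_le_exp]
      have h4 := neg_abs_le (Real.log (p * c))
      have h5 : |Real.log (p * c)| * (D N) ≤ |Real.log (p * c)| * (2 * κ * N) := by gcongr
      have h6 : (D N : ℝ) * (-|Real.log (p * c)|) ≤ D N * Real.log (p * c) := by gcongr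
      linarith
    have hpos : 0 < Real.sqrt (∏ i, u i) := Real.sqrt_pos.2 (Finset.prod_pos fun i _ => hu0 i)
    rw [le_div_iff₀ hpos]
    calc _ ≤ Real.exp (-((|Real.log (p * c)| * (2 * κ) + |a₀| / 2 + 1) * N)) *
          Real.exp (|a₀| / 2 * N) := by gcongr
      _ = Real.exp (-(|Real.log (p * c)| * (2 * κ) * N) - N) := by
        rw [← Real.exp_add]; congr 1; ring
      _ ≤ Real.exp (-(|Real.log (p * c)| * (2 * κ) * N)) := by gcongr; linarith
      _ ≤ _ := h3
  · intro z hz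
    simp only [Set.mem_pi, mem_univ, forall_true_left, mem_Ioo] at hz
    simp only [mem_preimage, mem_ofPred_eq]
    rw [norm_sq_scaleCoord (fun i => (hv _ i).le)]
    have hne : (Finset.univ : Finset (Fin (D N))).Nonempty :=
      Finset.card_pos.1 (by simpa using hD0)
    have e1 : c ^ 2 * q ^ 2 / N < 4 * (c ^ 2 * q ^ 2 / N) := by
      have : 0 < c ^ 2 * q ^ 2 / N := by positivity
      linarith
    constructor
    · calc c ^ 2 * (κ / 2) * q ^ 2 = c ^ 2 * q ^ 2 / N * (κ / 2 * N) := by field_simp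
        _ ≤ c ^ 2 * q ^ 2 / N * D N := by gcongr
        _ = ∑ i : Fin (D N), v (D N) i * k i ^ 2 := by simp [hvk]; ring
        _ < _ := Finset.sum_lt_sum_of_nonempty hne fun i _ => by
          have h1 := (hz i).1
          have h2 := hk0 i
          have h3 := hv (D N) i
          gcongr
    · calc ∑ i, v (D N) i * z i ^ 2 < ∑ i : Fin (D N), v (D N) i * (2 * k i) ^ 2 :=
          Finset.sum_lt_sum_of_nonempty hne fun i _ => by
            have h1 := (hz i).2
            have h2 := hk0 i
            have h4 := (hz i).1
            have h3 := hv (D N) i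
            have h5 : 0 < z i := h2.trans h4
            gcongr
        _ = 4 * (c ^ 2 * q ^ 2 / N) * D N := by
          simp only [mul_pow, mul_left_comm _ ((2 : ℝ) ^ 2), hvk]
          simp
          ring
        _ ≤ 4 * (c ^ 2 * q ^ 2 / N) * (2 * κ * N) := by gcongr
        _ = _ := by field_simp

theorem priorScaling_diagonal (hκ : 0 < κ) (hv : ∀ D i, 0 < v D i) (hm : 0 < m) (hM : 0 < M)
    (hτ : ∀ᶠ N in atTop, 0 < τ N)
    (hlow : ∀ D : ℕ → ℕ, Tendsto (fun N => (D N : ℝ) / (N : ℝ)) atTop (𝓝 κ) →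
      ∀ᶠ N : ℕ in atTop, ∀ i, m * ((N : ℝ) ^ (-b)) ^ 2 / N ≤ v (D N) i)
    (hup : ∀ D : ℕ → ℕ, Tendsto (fun N => (D N : ℝ) / (N : ℝ)) atTop (𝓝 κ) →
      ∀ᶠ N : ℕ in atTop, ∀ i, v (D N) i ≤ M * τ N ^ 2 / N)
    (hprod : ∀ D : ℕ → ℕ, Tendsto (fun N => (D N : ℝ) / (N : ℝ)) atTop (𝓝 κ) →
      ∀ᶠ N : ℕ in atTop, ∏ i, (v (D N) i * N / ((N : ℝ) ^ (-b)) ^ 2) ≤ Real.exp (a₀ * N)) :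
    PriorScaling (fun D => Matrix.diagonal (v D)) κ b τ where
  small_ball_le := small_ball_le_diagonal hκ hv hm hlow
  tail_le := tail_le_diagonal hκ hv hM hτ hup
  le_small_ball := by
    intro r hr
    obtain ⟨a, ha, h⟩ := le_shell_diagonal hκ hv hm hlow hprod
      (show 0 < r / Real.sqrt (8 * κ) by positivity)
    refine ⟨a, ha, fun D hD => ?_⟩
    filter_upwards [h D hD, eventually_dim_bounds hκ hD] with N hN ⟨hN0, _⟩
    refine hN.trans (measure_mono fun θ hθ => ?_)
    simp only [mem_ofPred_eq, Metric.mem_closedBall, dist_zero_right] at hθ ⊢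
    have hs : 0 < (N : ℝ) ^ (-b) := by positivity
    refine (pow_le_pow_iff_left₀ (norm_nonneg _) (by positivity) two_ne_zero).1 ?_
    refine hθ.2.le.trans (le_of_eq ?_)
    rw [div_pow, Real.sq_sqrt (by positivity)]
    field_simp
    ring
  le_annulus := by
    -- With `c² = 2/κ` the shell becomes `N^(-b) < ‖θ‖ < 4 N^(-b)`, hence the width `3`.
    obtain ⟨a, ha, h⟩ := le_shell_diagonal hκ hv hm hlow hprod
      (show 0 < Real.sqrt (2 / κ) by positivity)
    refine ⟨3, by norm_num, a, ha, fun D hD => ?_⟩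
    filter_upwards [h D hD, eventually_dim_bounds hκ hD] with N hN ⟨hN0, _⟩
    refine hN.trans (measure_mono fun θ hθ => ?_)
    simp only [mem_ofPred_eq, annulus, mem_Ioo] at hθ ⊢
    have hs : 0 < (N : ℝ) ^ (-b) := by positivity
    rw [Real.sq_sqrt (by positivity)] at hθ
    have e1 : 2 / κ * (κ / 2) * ((N : ℝ) ^ (-b)) ^ 2 = ((N : ℝ) ^ (-b)) ^ 2 := by field_simp
    have e2 : 4 * (2 / κ) * (2 * κ) * ((N : ℝ) ^ (-b)) ^ 2 = (4 * (N : ℝ) ^ (-b)) ^ 2 := by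
      field_simp
      ring
    rw [e1, e2] at hθ
    refine ⟨lt_of_pow_lt_pow_left₀ 2 (norm_nonneg _) hθ.1, ?_⟩
    have := lt_of_pow_lt_pow_left₀ 2 (by positivity) hθ.2
    linarith

end Diagonal

theorem priorScaling_isoCov {κ : ℝ} (hκ : 0 < κ) :
    PriorScaling isoCov κ 0 (fun _ => 1) := by
  have hC : isoCov = fun D => Matrix.diagonal (fun _ : Fin D => (D : ℝ)⁻¹) := by
    funext D
    rw [isoCov, Matrix.smul_one_eq_diagonal]
  rw [hC]
  refine priorScaling_diagonal (v := fun D _ => (D : ℝ)⁻¹) (m := (2 * κ)⁻¹) (M := 2 / κ)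
    (a₀ := 2 * κ * |Real.log (2 / κ)|) hκ ?_ (by positivity) (by positivity) (by simp) ?_ ?_ ?_
  · intro D i
    have : 0 < (D : ℝ) := by exact_mod_cast i.pos
    positivity
  · intro D hD
    filter_upwards [eventually_dim_bounds hκ hD] with N ⟨hN0, hD0, hD1, hD2⟩ i
    simp only [neg_zero, Real.rpow_zero, one_pow, mul_one]
    rw [inv_eq_one_div, div_div, one_div]
    gcongr
  · intro D hD
    filter_upwards [eventually_dim_bounds hκ hD] with N ⟨hN0, hD0, hD1, hD2⟩ i
    simp only [one_pow, mul_one]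
    rw [div_div, ← one_div_div, one_div]
    gcongr
    linarith
  · intro D hD
    filter_upwards [eventually_dim_bounds hκ hD] with N ⟨hN0, hD0, hD1, hD2⟩
    simp only [neg_zero, Real.rpow_zero, one_pow, div_one, Finset.prod_const, Finset.card_univ,
      Fintype.card_fin]
    have h1 : (D N : ℝ)⁻¹ * N ≤ 2 / κ := by
      rw [inv_mul_le_iff₀ hD0]
      calc (N : ℝ) = κ / 2 * N * (2 / κ) := by field_simp
        _ ≤ _ := by gcongr
    calc ((D N : ℝ)⁻¹ * N) ^ D N ≤ (2 / κ) ^ D N := by gcongr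
      _ = Real.exp (D N * Real.log (2 / κ)) := by
        rw [Real.exp_nat_mul, Real.exp_log (by positivity)]
      _ ≤ _ := by
        rw [Real.exp_le_exp]
        calc D N * Real.log (2 / κ) ≤ D N * |Real.log (2 / κ)| := by gcongr; exact le_abs_self _
          _ ≤ 2 * κ * N * |Real.log (2 / κ)| := by gcongr
          _ = _ := by ring

/-- The variances `i^(-γ)`, `γ = 2b + 1`, have their minimum at `i = D`, of order `N^(-2b)/N`; this
fixes the small-ball scale. The maximum is `1`, so the tail is controlled only at radius of order
`√N`. The normalized product is `(N^D / D!)^γ`, exponential in `N` because `D^D / D! ≤ e^D`. -/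
theorem priorScaling_maternCov {κ : ℝ} (hκ : 0 < κ) {d : ℕ} {α b : ℝ} (hb : 0 < b)
    (hαb : b = α / d - 1 / 2) :
    PriorScaling (maternCov d α) κ b (fun N => Real.sqrt N) := by
  set γ : ℝ := 2 * b + 1 with hγ
  have hC : maternCov d α = fun D => Matrix.diagonal (fun i : Fin D => ((i : ℝ) + 1) ^ (-γ)) := by
    funext D
    rw [maternCov]
    congr
    funext i
    congr 2
    rw [hγ, hαb]
    ring
  have hγ0 : 0 < γ := by positivity
  rw [hC]
  have hscale : ∀ N : ℕ, 0 < (N : ℝ) → ((N : ℝ) ^ (-b)) ^ 2 / N = (N : ℝ) ^ (-γ) := by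
    intro N hN
    rw [← Real.rpow_natCast, ← Real.rpow_mul hN.le, ← Real.rpow_sub_one hN.ne']
    congr 1
    rw [hγ]
    push_cast
    ring
  refine priorScaling_diagonal (v := fun D i => ((i : ℝ) + 1) ^ (-γ)) (m := (2 * κ) ^ (-γ)) (M := 1)
    (a₀ := γ * (2 * κ + 2 * κ * |Real.log (2 / κ)|)) hκ ?_ (by positivity) (by positivity) ?_ ?_ ?_ ?_
  · intro D i
    positivity
  · filter_upwards [eventually_gt_atTop 0] with N hN
    positivity
  · intro D hD
    filter_upwards [eventually_dim_bounds hκ hD] with N ⟨hN0, hD0, hD1, hD2⟩ i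
    rw [mul_div_assoc, hscale N hN0, ← Real.mul_rpow (by positivity) (by positivity)]
    apply Real.rpow_le_rpow_of_nonpos (by positivity) _ (by linarith)
    refine le_trans ?_ hD2
    exact_mod_cast i.isLt
  · intro D hD
    filter_upwards [eventually_dim_bounds hκ hD] with N ⟨hN0, hD0, hD1, hD2⟩ i
    rw [Real.sq_sqrt hN0.le, mul_div_cancel_right₀ _ hN0.ne']
    exact Real.rpow_le_one_of_one_le_of_nonpos (by simp) (by linarith)
  · intro D hD
    filter_upwards [eventually_dim_bounds hκ hD] with N ⟨hN0, hD0, hD1, hD2⟩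
    have hterm : ∀ i : Fin (D N), ((i : ℝ) + 1) ^ (-γ) * N / ((N : ℝ) ^ (-b)) ^ 2
        = (N / ((i : ℝ) + 1)) ^ γ := by
      intro i
      have hp : 0 < ((N : ℝ) ^ (-b)) ^ 2 := by positivity
      rw [mul_div_assoc, ← inv_div (((N : ℝ) ^ (-b)) ^ 2), hscale N hN0,
        Real.rpow_neg hN0.le, inv_inv, Real.rpow_neg (by positivity),
        Real.div_rpow hN0.le (by positivity), div_eq_mul_inv, mul_comm]
    rw [Finset.prod_congr rfl fun i _ => hterm i,
      Real.finsetProd_rpow _ _ (fun i _ => by positivity)]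
    have hfac : ∏ i : Fin (D N), (N : ℝ) / ((i : ℝ) + 1) = (N : ℝ) ^ (D N) / (D N).factorial := by
      rw [Finset.prod_div_distrib, Fin.prod_univ_eq_prod_range (fun i : ℕ => (i : ℝ) + 1),
        ← Finset.prod_range_add_one_eq_factorial]
      push_cast
      simp
    rw [hfac, mul_assoc, Real.exp_mul, ← Real.exp_mul, mul_comm, Real.exp_mul]
    apply Real.rpow_le_rpow (by positivity) _ hγ0.le
    have h1 : (N : ℝ) ^ (D N) ≤ (D N) ^ (D N) * (2 / κ) ^ (D N) := by
      rw [← mul_pow]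
      gcongr
      calc (N : ℝ) = κ / 2 * N * (2 / κ) := by field_simp
        _ ≤ _ := by gcongr
    calc (N : ℝ) ^ (D N) / (D N).factorial
        ≤ (D N) ^ (D N) * (2 / κ) ^ (D N) / (D N).factorial := by gcongr
      _ = (D N : ℝ) ^ (D N) / (D N).factorial * (2 / κ) ^ (D N) := by ring
      _ ≤ Real.exp (D N) * Real.exp (D N * Real.log (2 / κ)) := by
        rw [Real.exp_nat_mul, Real.exp_log (by positivity)]
        gcongr
        exact Real.pow_div_factorial_le_exp _ hD0.le _
      _ ≤ _ := by
        rw [← Real.exp_add, Real.exp_le_exp]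
        have h2 : D N * Real.log (2 / κ) ≤ D N * |Real.log (2 / κ)| := by
          gcongr; exact le_abs_self _
        have h3 : D N * |Real.log (2 / κ)| ≤ 2 * κ * N * |Real.log (2 / κ)| := by gcongr
        linarith

/-! ### The radial profile -/

section Profile

variable {T t ρ L r r' : ℝ}

/-- As a sum of three clamped pieces, `w` is visibly monotone and Lipschitz on the half-line. -/
theorem profile_eq_clamp (ht : 0 < t) (htL : t ≤ L) :
    profile T t ρ L r = 4 * T ^ 2 * (min r (t / 2)) ^ 2 + T * (min (max r (t / 2)) t - t / 2)
      + ρ * (min (max r t) L - t) := by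
  unfold profile
  split_ifs with h1 h2 h3
  · rw [min_eq_left h1.le, max_eq_right h1.le, max_eq_right (by linarith), min_eq_left htL,
      min_eq_left (by linarith)]
    ring
  · push Not at h1
    rw [min_eq_right h1, max_eq_left h1, max_eq_right h2.le, min_eq_left htL, min_eq_left h2.le]
    ring
  · push Not at h1 h2
    rw [min_eq_right h1, max_eq_left h1, max_eq_left h2, min_eq_left h3.le, min_eq_right h2]
    ring
  · push Not at h1 h2 h3
    rw [min_eq_right h1, max_eq_left h1, max_eq_left h2, min_eq_right h3, min_eq_right h2]
    ring

theorem profile_mono (ht : 0 < t) (htL : t ≤ L) (hT : 0 ≤ T) (hρ : 0 ≤ ρ) (hr : 0 ≤ r)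
    (hrr : r ≤ r') : profile T t ρ L r ≤ profile T t ρ L r' := by
  rw [profile_eq_clamp ht htL, profile_eq_clamp ht htL]
  have h0 : 0 ≤ min r (t / 2) := le_min hr (by linarith)
  gcongr

theorem profile_zero (ht : 0 < t) : profile T t ρ L 0 = 0 := by
  simp [profile, ht]

theorem profile_nonneg (ht : 0 < t) (htL : t ≤ L) (hT : 0 ≤ T) (hρ : 0 ≤ ρ) (hr : 0 ≤ r) :
    0 ≤ profile T t ρ L r :=
  (profile_zero (T := T) (ρ := ρ) (L := L) ht).symm.le.trans (profile_mono ht htL hT hρ le_rfl hr)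

theorem profile_of_lt_half (h : r < t / 2) : profile T t ρ L r = 4 * (T * r) ^ 2 := if_pos h

theorem profile_half (ht : 0 < t) : profile T t ρ L (t / 2) = (T * t) ^ 2 := by
  simp [profile, ht]

theorem profile_knee (ht : 0 < t) (htL : t ≤ L) :
    profile T t ρ L t = (T * t) ^ 2 + T * t / 2 := by
  rw [profile_eq_clamp ht htL, min_eq_right (by linarith), max_eq_left (by linarith),
    max_self, min_self, min_eq_left htL]
  ring

theorem profile_le (ht : 0 < t) (htL : t ≤ L) (hT : 0 ≤ T) (hρ : 0 ≤ ρ) (hr : 0 ≤ r) :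
    profile T t ρ L r ≤ (T * t) ^ 2 + T * t / 2 + ρ * L := by
  rw [profile_eq_clamp ht htL]
  have h1 : min (max r (t / 2)) t ≤ t := min_le_right _ _
  have h2 : min (max r t) L ≤ L := min_le_right _ _
  have h3 : min r (t / 2) ≤ t / 2 := min_le_right _ _
  have h0 : 0 ≤ min r (t / 2) := le_min hr (by linarith)
  calc _ ≤ 4 * T ^ 2 * (t / 2) ^ 2 + T * (t - t / 2) + ρ * (L - 0) := by gcongr
    _ = _ := by ring

theorem profile_pos (ht : 0 < t) (htL : t ≤ L) (hT : 0 < T) (hρ : 0 ≤ ρ) (hr : 0 < r) :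
    0 < profile T t ρ L r := by
  rw [profile_eq_clamp ht htL]
  have h1 : t / 2 ≤ min (max r (t / 2)) t := le_min (le_max_right _ _) (by linarith)
  have h2 : t ≤ min (max r t) L := le_min (le_max_right _ _) htL
  have h0 : 0 < min r (t / 2) := lt_min hr (by linarith)
  have h3 : 0 ≤ T * (min (max r (t / 2)) t - t / 2) := mul_nonneg hT.le (by linarith)
  have h4 : 0 ≤ ρ * (min (max r t) L - t) := mul_nonneg hρ (by linarith)
  positivity

theorem exists_profile_lipschitz (ht : 0 < t) (htL : t ≤ L) :
    ∃ K : ℝ, 0 ≤ K ∧ ∀ r r', 0 ≤ r → 0 ≤ r' →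
      |profile T t ρ L r - profile T t ρ L r'| ≤ K * |r - r'| := by
  refine ⟨4 * T ^ 2 * t + |T| + |ρ|, by positivity, fun r r' hr hr' => ?_⟩
  rw [profile_eq_clamp ht htL, profile_eq_clamp ht htL]
  have hmin : |min r (t / 2) - min r' (t / 2)| ≤ |r - r'| := by
    simpa using abs_min_sub_min_le_max r (t / 2) r' (t / 2)
  have hc : ∀ a b : ℝ, |min (max r a) b - min (max r' a) b| ≤ |r - r'| := by
    intro a b
    have h1 := abs_min_sub_min_le_max (max r a) b (max r' a) b
    have h2 := abs_max_sub_max_le_max r a r' a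
    simp only [sub_self, abs_zero, abs_nonneg, sup_of_le_left] at h1 h2
    exact h1.trans h2
  have h0 : 0 ≤ min r (t / 2) := le_min hr (by linarith)
  have h0' : 0 ≤ min r' (t / 2) := le_min hr' (by linarith)
  have hsum : |min r (t / 2) + min r' (t / 2)| ≤ t := by
    rw [abs_of_nonneg (by positivity)]
    linarith [min_le_right r (t / 2), min_le_right r' (t / 2)]
  have e : 4 * T ^ 2 * (min r (t / 2)) ^ 2 + T * (min (max r (t / 2)) t - t / 2)
      + ρ * (min (max r t) L - t) - (4 * T ^ 2 * (min r' (t / 2)) ^ 2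
      + T * (min (max r' (t / 2)) t - t / 2) + ρ * (min (max r' t) L - t))
      = 4 * T ^ 2 * ((min r (t / 2) + min r' (t / 2)) * (min r (t / 2) - min r' (t / 2)))
      + T * (min (max r (t / 2)) t - min (max r' (t / 2)) t)
      + ρ * (min (max r t) L - min (max r' t) L) := by ring
  rw [e]
  refine (abs_add_three _ _ _).trans ?_
  rw [abs_mul (4 * T ^ 2), abs_mul T, abs_mul ρ, abs_mul (min r (t / 2) + _),
    abs_of_nonneg (show 0 ≤ 4 * T ^ 2 by positivity)]
  calc _ ≤ 4 * T ^ 2 * (t * |r - r'|) + |T| * |r - r'| + |ρ| * |r - r'| := by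
        refine add_le_add (add_le_add ?_ ?_) ?_
        · gcongr
        · exact mul_le_mul_of_nonneg_left (hc _ _) (abs_nonneg _)
        · exact mul_le_mul_of_nonneg_left (hc _ _) (abs_nonneg _)
    _ = _ := by ring

end Profile

/-! ### The law of the data -/

/-- The law of `(e, X)` with `X` uniform on `𝒳` and independent standard normal `e`. -/
def noiseLaw {d : ℕ} (𝒳 : Set (Vec d)) : Measure (ℝ × Vec d) :=
  (gaussianReal 0 1).prod (volume.restrict 𝒳)

/-- The score statistic `∑ Y_i g(X_i)`. -/
def score {d N : ℕ} (g : Vec d → ℝ) (z : Data d N) : ℝ := ∑ i, (z i).1 * g (z i).2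

/-- The information statistic `∑ g(X_i)²`. -/
def information {d N : ℕ} (g : Vec d → ℝ) (z : Data d N) : ℝ := ∑ i, g (z i).2 ^ 2

/-- The data sets with small score and with information between `m N` and `M N`. -/
def goodData {d : ℕ} (g : Vec d → ℝ) (m M δ : ℝ) (N : ℕ) : Set (Data d N) :=
  {z | |score g z| ≤ δ * N ∧ m * N ≤ information g z ∧ information g z ≤ M * N}

section Data

variable {d : ℕ} {𝒳 : Set (Vec d)} {g : Vec d → ℝ} {T t ρ L : ℝ}

theorem isProbabilityMeasure_restrict (h𝒳v : volume 𝒳 = 1) :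
    IsProbabilityMeasure (volume.restrict 𝒳) := ⟨by simp [h𝒳v]⟩

theorem isProbabilityMeasure_noiseLaw (h𝒳v : volume 𝒳 = 1) :
    IsProbabilityMeasure (noiseLaw 𝒳) := by
  have := isProbabilityMeasure_restrict h𝒳v
  unfold noiseLaw
  infer_instance

/-- At the truth `θ = 0` the regression function vanishes, so `Y` is the noise itself; the data law
is the same for all parameters of the map and all `D`. -/
theorem dataLaw_radialMap (h𝒳v : volume 𝒳 = 1) {D : ℕ} (hgm : Measurable g) (ht : 0 < t) (N : ℕ) :
    dataLaw 𝒳 (radialMap D g hgm T t ρ L) N = Measure.pi (fun _ => noiseLaw 𝒳) := by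
  have := isProbabilityMeasure_restrict h𝒳v
  unfold dataLaw
  congr
  funext _
  unfold obsLaw noiseLaw
  have hswap : (fun q : Vec d × ℝ => ((radialMap D g hgm T t ρ L).toFun 0 q.1 + q.2, q.1)) =
      Prod.swap := by
    funext q
    simp [radialMap, profile_zero ht, Prod.swap]
  rw [hswap, Measure.prod_swap]

/-- Expanding the squares leaves the data only in two scalar statistics besides a constant; all
later comparisons of likelihoods are comparisons of values of `w`. -/
theorem logLik_radialMap {D N : ℕ} (hgm : Measurable g) (z : Data d N) {θ : Vec D}
    (hw : 0 ≤ profile T t ρ L ‖θ‖) :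
    logLik (radialMap D g hgm T t ρ L) z θ = -(1 / 2) * ∑ i, (z i).1 ^ 2
      + Real.sqrt (profile T t ρ L ‖θ‖) * score g z
      - profile T t ρ L ‖θ‖ * information g z / 2 := by
  have h := Real.sq_sqrt hw
  unfold logLik score information
  set c := Real.sqrt (profile T t ρ L ‖θ‖) with hc
  rw [← h, Finset.mul_sum, Finset.mul_sum, Finset.mul_sum, Finset.mul_sum, Finset.sum_div,
    ← Finset.sum_add_distrib, ← Finset.sum_sub_distrib]
  refine Finset.sum_congr rfl fun i _ => ?_
  simp only [radialMap, ← hc, sq_abs]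
  ring

variable {gmin gmax : ℝ}

theorem ae_restrict_bound (h𝒳m : MeasurableSet 𝒳) (h0 : 0 < gmin)
    (hb : ∀ x ∈ 𝒳, g x ∈ Icc gmin gmax) : ∀ᵐ x ∂(volume.restrict 𝒳), ‖g x‖ ≤ gmax := by
  filter_upwards [ae_restrict_mem h𝒳m] with x hx
  rw [Real.norm_of_nonneg (h0.le.trans (hb x hx).1)]
  exact (hb x hx).2

theorem memLp_covariateFactor (h𝒳m : MeasurableSet 𝒳) (h𝒳v : volume 𝒳 = 1) (hgm : Measurable g)
    (h0 : 0 < gmin) (hb : ∀ x ∈ 𝒳, g x ∈ Icc gmin gmax) :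
    MemLp g 2 (volume.restrict 𝒳) := by
  have := isProbabilityMeasure_restrict h𝒳v
  exact MemLp.of_bound hgm.aestronglyMeasurable gmax (ae_restrict_bound h𝒳m h0 hb)

theorem memLp_id_gauss : MemLp (fun x : ℝ => x) 2 (gaussianReal 0 1) :=
  memLp_id_gaussianReal 2

theorem integrable_residual_sq (h𝒳m : MeasurableSet 𝒳) (h𝒳v : volume 𝒳 = 1) (hgm : Measurable g)
    (h0 : 0 < gmin) (hb : ∀ x ∈ 𝒳, g x ∈ Icc gmin gmax) (hone : ∫ x in 𝒳, g x ^ 2 = 1) (c : ℝ) :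
    Integrable (fun q : ℝ × Vec d => |q.1 - c * g q.2| ^ 2) (noiseLaw 𝒳) ∧
      ∫ q, |q.1 - c * g q.2| ^ 2 ∂(noiseLaw 𝒳) = 1 + c ^ 2 := by
  have := isProbabilityMeasure_restrict h𝒳v
  have hg2 := memLp_covariateFactor h𝒳m h𝒳v hgm h0 hb
  have i1 : Integrable (fun q : ℝ × Vec d => q.1 ^ 2) (noiseLaw 𝒳) :=
    memLp_id_gauss.integrable_sq.comp_fst _
  have i2 : Integrable (fun q : ℝ × Vec d => g q.2 ^ 2) (noiseLaw 𝒳) :=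
    hg2.integrable_sq.comp_snd _
  have i3 : Integrable (fun q : ℝ × Vec d => q.1 * g q.2) (noiseLaw 𝒳) :=
    (memLp_id_gauss.integrable one_le_two).mul_prod (hg2.integrable one_le_two)
  have e : (fun q : ℝ × Vec d => |q.1 - c * g q.2| ^ 2) =
      fun q => q.1 ^ 2 + (c ^ 2 * g q.2 ^ 2 - 2 * c * (q.1 * g q.2)) := by
    funext q
    rw [sq_abs]
    ring
  rw [e]
  have e1 : ∫ q, q.1 ^ 2 ∂(noiseLaw 𝒳) = 1 := by
    have h1 : ∫ q, q.1 ^ 2 ∂(noiseLaw 𝒳) = ∫ x, x ^ 2 ∂(gaussianReal 0 1) := by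
      unfold noiseLaw
      simpa using integral_fun_fst (μ := gaussianReal 0 1) (ν := volume.restrict 𝒳)
        (fun x : ℝ => x ^ 2)
    have h2 := variance_of_integral_eq_zero (X := fun x : ℝ => x) (μ := gaussianReal 0 1)
      (by fun_prop) (by simp)
    rw [h1, ← h2]
    simp
  have e2 : ∫ q, g q.2 ^ 2 ∂(noiseLaw 𝒳) = 1 := by
    rw [← hone]
    unfold noiseLaw
    simpa using integral_fun_snd (μ := gaussianReal 0 1) (ν := volume.restrict 𝒳)
      (fun x => g x ^ 2)
  have e3 : ∫ q, q.1 * g q.2 ∂(noiseLaw 𝒳) = 0 := by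
    rw [noiseLaw, integral_prod_mul (fun x : ℝ => x) g]
    simp
  have i4 : Integrable (fun q : ℝ × Vec d => c ^ 2 * g q.2 ^ 2 - 2 * c * (q.1 * g q.2))
      (noiseLaw 𝒳) := (i2.const_mul _).sub (i3.const_mul _)
  refine ⟨i1.add i4, ?_⟩
  rw [integral_add i1 i4,
    integral_sub (i2.const_mul _) (i3.const_mul _), integral_const_mul, integral_const_mul, e1, e2,
    e3]
  ring

theorem avgLogLik_radialMap (h𝒳m : MeasurableSet 𝒳) (h𝒳v : volume 𝒳 = 1) (hgm : Measurable g)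
    (hg : IsCovariateFactor 𝒳 g) (ht : 0 < t) {D : ℕ} (N : ℕ) {θ : Vec D}
    (hw : 0 ≤ profile T t ρ L ‖θ‖) :
    Integrable (fun z : Data d N => logLik (radialMap D g hgm T t ρ L) z θ)
      (dataLaw 𝒳 (radialMap D g hgm T t ρ L) N) ∧
    avgLogLik 𝒳 (radialMap D g hgm T t ρ L) N θ = -(N / 2) * (1 + profile T t ρ L ‖θ‖) := by
  obtain ⟨⟨gmin, gmax, h0, -, hb⟩, hone⟩ := hg
  have := isProbabilityMeasure_noiseLaw h𝒳v
  obtain ⟨hi, he⟩ := integrable_residual_sq h𝒳m h𝒳v hgm h0 hb hone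
    (Real.sqrt (profile T t ρ L ‖θ‖))
  unfold avgLogLik
  rw [dataLaw_radialMap h𝒳v hgm ht]
  unfold logLik
  have hi' : ∀ i : Fin N, Integrable (fun z : Data d N =>
      |(z i).1 - (radialMap D g hgm T t ρ L).toFun θ (z i).2| ^ 2)
      (Measure.pi (fun _ => noiseLaw 𝒳)) := fun i =>
    (measurePreserving_eval (fun _ : Fin N => noiseLaw 𝒳) i).integrable_comp_of_integrable hi
  refine ⟨(integrable_finsetSum _ fun i _ => hi' i).const_mul _, ?_⟩
  rw [integral_const_mul, integral_finsetSum _ fun i _ => hi' i]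
  have he' : ∀ i : Fin N, ∫ z : Data d N,
      |(z i).1 - (radialMap D g hgm T t ρ L).toFun θ (z i).2| ^ 2
      ∂(Measure.pi (fun _ => noiseLaw 𝒳)) = 1 + profile T t ρ L ‖θ‖ := by
    intro i
    rw [integral_comp_eval (μ := fun _ : Fin N => noiseLaw 𝒳) (i := i)
      (f := fun q => |q.1 - (radialMap D g hgm T t ρ L).toFun θ q.2| ^ 2) hi.aestronglyMeasurable]
    rw [Real.sq_sqrt hw] at he
    exact he
  simp only [he']
  simp
  ring

/-- The average log-likelihood is `-(N/2)(1 + w(‖θ‖))`, so each assertion is a property of `w`: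
monotone, Lipschitz, zero only at the origin, quadratic on `[0, t/2)`. -/
theorem hasNiceAverage_radialMap (h𝒳m : MeasurableSet 𝒳) (h𝒳v : volume 𝒳 = 1)
    (hgm : Measurable g) (hg : IsCovariateFactor 𝒳 g) (ht : 0 < t) (htL : t ≤ L) (hT : 0 < T)
    (hρ : 0 ≤ ρ) (D : ℕ) {N : ℕ} (hN : 1 ≤ N) :
    HasNiceAverage 𝒳 (radialMap D g hgm T t ρ L) N := by
  have hw : ∀ θ : Vec D, 0 ≤ profile T t ρ L ‖θ‖ := fun θ =>
    profile_nonneg ht htL hT.le hρ (norm_nonneg θ)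
  have havg : avgLogLik 𝒳 (radialMap D g hgm T t ρ L) N =
      fun θ => -((N : ℝ) / 2) * (1 + profile T t ρ L ‖θ‖) :=
    funext fun θ => (avgLogLik_radialMap h𝒳m h𝒳v hgm hg ht N (hw θ)).2
  have hN0 : 0 < (N : ℝ) := by exact_mod_cast hN
  have hanti : ∀ θ θ' : Vec D, ‖θ‖ ≤ ‖θ'‖ →
      avgLogLik 𝒳 (radialMap D g hgm T t ρ L) N θ' ≤
        avgLogLik 𝒳 (radialMap D g hgm T t ρ L) N θ := by
    intro θ θ' h
    have := profile_mono (T := T) (ρ := ρ) ht htL hT.le hρ (norm_nonneg θ) h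
    rw [havg]
    simp only
    nlinarith
  refine ⟨fun θ => (avgLogLik_radialMap h𝒳m h𝒳v hgm hg ht N (hw θ)).1, ⟨?_, ?_⟩,
    ⟨t / 2, by positivity, ?_⟩, fun θ θ' h => ?_, ?_, hanti⟩
  · intro θ hθ
    rw [havg]
    have := profile_pos (T := T) (ρ := ρ) ht htL hT hρ (norm_pos_iff.2 hθ)
    simp only [norm_zero, profile_zero ht]
    nlinarith
  -- A decreasing function of the norm is quasiconcave, because a convex combination is no longer
  -- than the longer endpoint.
  · intro r θ₁ h₁ θ₂ h₂ a b ha hb hab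
    simp only [mem_ofPred_eq, mem_univ, true_and] at h₁ h₂ ⊢
    have hconv : ‖a • θ₁ + b • θ₂‖ ≤ max ‖θ₁‖ ‖θ₂‖ := by
      refine (norm_add_le _ _).trans ?_
      rw [norm_smul, norm_smul, Real.norm_of_nonneg ha, Real.norm_of_nonneg hb]
      calc a * ‖θ₁‖ + b * ‖θ₂‖ ≤ a * max ‖θ₁‖ ‖θ₂‖ + b * max ‖θ₁‖ ‖θ₂‖ := by
            gcongr
            · exact le_max_left _ _
            · exact le_max_right _ _
        _ = _ := by rw [← add_mul, hab, one_mul]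
    rcases le_max_iff.1 hconv with h | h
    · exact h₁.trans (hanti _ _ h)
    · exact h₂.trans (hanti _ _ h)
  · have hq : ConcaveOn ℝ (Metric.ball (0 : Vec D) (t / 2))
        (fun θ => -((N : ℝ) / 2 * (4 * T ^ 2)) * ‖θ‖ ^ 2 + -((N : ℝ) / 2)) := by
      have h1 : ConvexOn ℝ (Metric.ball (0 : Vec D) (t / 2)) (fun θ => ‖θ‖ ^ 2) :=
        (convexOn_norm (convex_ball _ _)).pow (fun _ _ => norm_nonneg _) 2
      have h2 := (h1.smul (show 0 ≤ (N : ℝ) / 2 * (4 * T ^ 2) by positivity)).neg.add_const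
        (-((N : ℝ) / 2))
      refine h2.congr fun θ _ => ?_
      simp
    rw [havg]
    refine hq.congr fun θ hθ => ?_
    rw [mem_ball_zero_iff] at hθ
    simp only [profile_of_lt_half hθ]
    ring
  · rw [havg]
    simp only [h]
  · obtain ⟨K, hK, hlip⟩ := exists_profile_lipschitz (T := T) (ρ := ρ) ht htL
    refine ⟨NNReal.mk (N / 2 * K) (by positivity), LipschitzWith.of_dist_le_mul fun θ θ' => ?_⟩
    rw [havg, Real.dist_eq, ← mul_sub, abs_mul, abs_neg, abs_of_pos (by positivity : 0 < (N : ℝ) / 2),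
      NNReal.coe_mk, mul_assoc, add_sub_add_left_eq_sub]
    gcongr
    refine (hlip _ _ (norm_nonneg _) (norm_nonneg _)).trans ?_
    gcongr
    rw [dist_eq_norm]
    exact abs_norm_sub_norm_le _ _

/-- The bounds on the information hold almost surely, since `g` is bounded on `𝒳`. The score is a
sum of `N` centred i.i.d. terms of finite variance, so Chebyshev gives a failure probability of
order `1/N`. -/
theorem tendsto_compl_goodData (h𝒳m : MeasurableSet 𝒳) (h𝒳v : volume 𝒳 = 1) (hgm : Measurable g)
    (h0 : 0 < gmin) (hb : ∀ x ∈ 𝒳, g x ∈ Icc gmin gmax) {δ : ℝ} (hδ : 0 < δ) :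
    Tendsto (fun N : ℕ => (Measure.pi (fun _ : Fin N => noiseLaw 𝒳))
      (goodData g (gmin ^ 2) (gmax ^ 2) δ N)ᶜ) atTop (𝓝 0) := by
  have := isProbabilityMeasure_noiseLaw h𝒳v
  have := isProbabilityMeasure_restrict h𝒳v
  have hg2 := memLp_covariateFactor h𝒳m h𝒳v hgm h0 hb
  set X : ℝ × Vec d → ℝ := fun q => q.1 * g q.2 with hX
  have haeb : ∀ᵐ q ∂(noiseLaw 𝒳), g q.2 ∈ Icc gmin gmax :=
    Measure.quasiMeasurePreserving_snd.ae
      ((ae_restrict_mem h𝒳m).mono fun x hx => hb x hx)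
  have hXm : MemLp X 2 (noiseLaw 𝒳) := by
    have h1 : MemLp (fun q : ℝ × Vec d => q.1) 2 (noiseLaw 𝒳) :=
      memLp_id_gauss.comp_fst _
    refine h1.of_le_mul (c := gmax) (by fun_prop) ?_
    filter_upwards [haeb] with q hq
    rw [norm_mul, mul_comm, Real.norm_of_nonneg (h0.le.trans hq.1)]
    gcongr
    exact hq.2
  have hX0 : ∫ q, X q ∂(noiseLaw 𝒳) = 0 := by
    rw [noiseLaw, hX, integral_prod_mul (fun x : ℝ => x) g]
    simp
  set V := Var[X; noiseLaw 𝒳] with hV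
  have hbound : ∀ᶠ N : ℕ in atTop, (Measure.pi (fun _ : Fin N => noiseLaw 𝒳))
      (goodData g (gmin ^ 2) (gmax ^ 2) δ N)ᶜ ≤ ENNReal.ofReal (V / δ ^ 2 * ((N : ℝ))⁻¹) := by
    filter_upwards [eventually_gt_atTop 0] with N hN
    have hN0 : 0 < (N : ℝ) := by exact_mod_cast hN
    set P := Measure.pi (fun _ : Fin N => noiseLaw 𝒳) with hP
    have hae : ∀ᵐ z ∂P, ∀ i, g (z i).2 ∈ Icc gmin gmax :=
      ae_all_iff.2 fun i =>
        (measurePreserving_eval (fun _ : Fin N => noiseLaw 𝒳) i).quasiMeasurePreserving.ae haeb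
    have hSfun : (fun z : Data d N => score g z) = ∑ i, fun z : Data d N => X (z i) := by
      funext z
      simp [score, hX]
    have hSm : MemLp (fun z : Data d N => score g z) 2 P := by
      rw [hSfun]
      exact memLp_finsetSum' _ fun i _ =>
        hXm.comp_measurePreserving (measurePreserving_eval (fun _ : Fin N => noiseLaw 𝒳) i)
    have hSvar : Var[fun z : Data d N => score g z; P] = N * V := by
      rw [hSfun, hP, variance_sum_pi (X := fun _ : Fin N => X) fun _ => hXm]
      simp [hV]
    have hS0 : ∫ z, score g z ∂P = 0 := by
      have hi : ∀ i : Fin N, Integrable (fun z : Data d N => X (z i)) P := fun i =>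
        (measurePreserving_eval (fun _ : Fin N => noiseLaw 𝒳) i).integrable_comp_of_integrable
          (hXm.integrable one_le_two)
      have hS : ∀ z : Data d N, score g z = ∑ i, X (z i) := fun z => rfl
      simp_rw [hS]
      rw [integral_finsetSum _ fun i _ => hi i]
      refine Finset.sum_eq_zero fun i _ => ?_
      rw [hP, integral_comp_eval (μ := fun _ : Fin N => noiseLaw 𝒳) (i := i)
        hXm.aestronglyMeasurable, hX0]
    have hcheb := meas_ge_le_variance_div_sq hSm (c := δ * N) (by positivity)
    rw [hS0, hSvar] at hcheb
    calc P (goodData g (gmin ^ 2) (gmax ^ 2) δ N)ᶜ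
        ≤ P {z | δ * N ≤ |score g z - 0|} := by
          refine measure_mono_ae ?_
          filter_upwards [hae] with z hz hzc
          by_contra hcon
          apply hzc
          replace hcon : ¬ δ * N ≤ |score g z - 0| := hcon
          rw [sub_zero, not_le] at hcon
          refine ⟨hcon.le, ?_, ?_⟩
          · calc gmin ^ 2 * N = ∑ _i : Fin N, gmin ^ 2 := by simp; ring
              _ ≤ _ := Finset.sum_le_sum fun i _ => by
                have := (hz i).1
                gcongr
          · calc information g z ≤ ∑ _i : Fin N, gmax ^ 2 := Finset.sum_le_sum fun i _ => by
                  have := (hz i).2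
                  have h1 := h0.le.trans (hz i).1
                  gcongr
              _ = _ := by simp; ring
      _ ≤ _ := hcheb
      _ = _ := by
        congr 1
        field_simp
  have hlim : Tendsto (fun N : ℕ => ENNReal.ofReal (V / δ ^ 2 * ((N : ℝ))⁻¹)) atTop (𝓝 0) := by
    have := (tendsto_inv_atTop_nhds_zero_nat (𝕜 := ℝ)).const_mul (V / δ ^ 2)
    rw [mul_zero] at this
    simpa using ENNReal.tendsto_ofReal this
  exact tendsto_of_tendsto_of_tendsto_of_le_of_le' tendsto_const_nhds hlim
    (Eventually.of_forall fun _ => zero_le) hbound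

end Data

/-! ### Finite-dimensional laws of Markov chains -/

section Chain

variable {S : Type*} [MeasurableSpace S] (μ₀ : Measure S) (K : Kernel S S) [IsMarkovKernel K]

theorem chainLaw_map_zero : (chainLaw μ₀ K).map (fun x => x 0) = μ₀ := by
  unfold chainLaw Kernel.trajMeasure
  have hev : Measurable (fun h : (i : Finset.Iic 0) → S => h ⟨0, Finset.mem_Iic.2 le_rfl⟩) := by
    fun_prop
  have : (fun x : ℕ → S => x 0) = (fun h : (i : Finset.Iic 0) → S =>
      h ⟨0, Finset.mem_Iic.2 le_rfl⟩) ∘ (Preorder.frestrictLe 0) := rfl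
  rw [this, ← Measure.map_map hev (by fun_prop), Measure.map_comp _ _ (by fun_prop),
    Kernel.traj_map_frestrictLe, Kernel.partialTraj_self, Measure.id_comp,
    Measure.map_map hev (by fun_prop)]
  convert Measure.map_id
  funext x
  rfl

variable [IsProbabilityMeasure μ₀]

instance isProbabilityMeasure_chainLaw : IsProbabilityMeasure (chainLaw μ₀ K) := by
  unfold chainLaw
  infer_instance

/-- The Markov property in the only form needed: one-step pair laws suffice for evolving
expectations and for bounding jumps. -/
theorem chainLaw_map_pair (k : ℕ) :
    (chainLaw μ₀ K).map (fun x => (x k, x (k + 1))) =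
      ((chainLaw μ₀ K).map (fun x => x k)) ⊗ₘ K := by
  have h := Kernel.map_frestrictLe_trajMeasure_compProd_eq_map_trajMeasure (X := fun _ => S)
    (μ₀ := μ₀) (κ := fun n => K.comap
      (fun h : (i : Finset.Iic n) → S => h ⟨n, Finset.mem_Iic.2 le_rfl⟩) (by fun_prop)) (a := k)
  ext s hs
  have hev : Measurable (fun h : (i : Finset.Iic k) → S => h ⟨k, Finset.mem_Iic.2 le_rfl⟩) := by
    fun_prop
  have h1 := congrArg (fun ν => ν ((fun q : ((i : Finset.Iic k) → S) × S =>
    (q.1 ⟨k, Finset.mem_Iic.2 le_rfl⟩, q.2)) ⁻¹' s)) h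
  rw [Measure.map_apply (by fun_prop) (hs.preimage (by fun_prop)),
    Measure.compProd_apply (hs.preimage (by fun_prop)),
    lintegral_map (Kernel.measurable_kernel_prodMk_left (hs.preimage (by fun_prop)))
      (by fun_prop)] at h1
  rw [Measure.map_apply (by fun_prop) hs, Measure.compProd_apply hs,
    lintegral_map (Kernel.measurable_kernel_prodMk_left hs) (by fun_prop)]
  exact h1.symm

theorem lintegral_chainLaw_succ {F : S → ℝ≥0∞} (hF : Measurable F) (k : ℕ) :
    ∫⁻ x, F (x (k + 1)) ∂(chainLaw μ₀ K) =
      ∫⁻ x, ∫⁻ y, F y ∂(K (x k)) ∂(chainLaw μ₀ K) := by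
  have h := congrArg (fun ν => ∫⁻ q, F q.2 ∂ν) (chainLaw_map_pair μ₀ K k)
  rwa [lintegral_map (by fun_prop) (by fun_prop), Measure.lintegral_compProd (by fun_prop),
    lintegral_map (by fun_prop) (by fun_prop)] at h

theorem chainLaw_pair_le {J : Set (S × S)} (hJ : MeasurableSet J) {p : ℝ≥0∞}
    (hp : ∀ a, K a (Prod.mk a ⁻¹' J) ≤ p) (k : ℕ) :
    chainLaw μ₀ K {x | (x k, x (k + 1)) ∈ J} ≤ p := by
  have h : chainLaw μ₀ K {x | (x k, x (k + 1)) ∈ J} =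
      (chainLaw μ₀ K).map (fun x => (x k, x (k + 1))) J := by
    rw [Measure.map_apply (by fun_prop) hJ]
    rfl
  have : IsProbabilityMeasure ((chainLaw μ₀ K).map (fun x => x k)) :=
    Measure.isProbabilityMeasure_map (measurable_pi_apply k).aemeasurable
  rw [h, chainLaw_map_pair, Measure.compProd_apply hJ]
  refine (lintegral_mono hp).trans ?_
  simp

end Chain

/-! ### Chains in a random environment -/

section Environment

variable {Ω E : Type*} [MeasurableSpace Ω] [MeasurableSpace E]

/-- The function `(z, θ) ↦ ∫ F (z, ϑ) P ((z, θ), dϑ)`. -/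
def evolve (P : Kernel (Ω × E) E) (F : Ω × E → ℝ≥0∞) (q : Ω × E) : ℝ≥0∞ :=
  ∫⁻ ϑ, F (q.1, ϑ) ∂(P q)

/-- The kernel on the product space which keeps the environment fixed. -/
abbrev envKernel (P : Kernel (Ω × E) E) : Kernel (Ω × E) (Ω × E) :=
  Kernel.deterministic Prod.fst measurable_fst ×ₖ P

/-- The environment never moves, so a weight depending on it alone passes through the evolution.
This allows restriction to good data. -/
theorem evolve_iterate_mul (P : Kernel (Ω × E) E) {F : Ω × E → ℝ≥0∞} {w : Ω → ℝ≥0∞} (hw : ∀ z, w z ≠ ∞)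
    (k : ℕ) : (evolve P)^[k] (fun q => w q.1 * F q) = fun q => w q.1 * (evolve P)^[k] F q := by
  induction k generalizing F with
  | zero => rfl
  | succ k ih =>
    have h : evolve P (fun q => w q.1 * F q) = fun q => w q.1 * evolve P F q := by
      funext q
      simp only [evolve]
      rw [lintegral_const_mul' _ _ (hw _)]
    rw [Function.iterate_succ_apply, h, ih, Function.iterate_succ_apply]

variable (P : Kernel (Ω × E) E) [IsMarkovKernel P]

theorem measurable_evolve {F : Ω × E → ℝ≥0∞} (hF : Measurable F) : Measurable (evolve P F) := by
  have h : Measurable (fun r : (Ω × E) × E => F (r.1.1, r.2)) := hF.comp (by fun_prop)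
  exact h.lintegral_kernel_prod_right'

theorem measurable_evolve_iterate {F : Ω × E → ℝ≥0∞} (hF : Measurable F) (k : ℕ) :
    Measurable ((evolve P)^[k] F) := by
  induction k generalizing F with
  | zero => exact hF
  | succ k ih =>
    rw [Function.iterate_succ_apply]
    exact ih (measurable_evolve P hF)

theorem envKernel_apply (q : Ω × E) : envKernel P q = (P q).map (Prod.mk q.1) := by
  rw [envKernel, Kernel.prod_apply, Kernel.deterministic_apply, Measure.dirac_prod]

theorem lintegral_envKernel {F : Ω × E → ℝ≥0∞} (hF : Measurable F) (q : Ω × E) :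
    ∫⁻ y, F y ∂(envKernel P q) = evolve P F q := by
  rw [envKernel_apply, lintegral_map hF (by fun_prop), evolve]

theorem lintegral_chainLaw_envKernel (μ₀ : Measure (Ω × E)) [IsProbabilityMeasure μ₀]
    {F : Ω × E → ℝ≥0∞} (hF : Measurable F) (k : ℕ) :
    ∫⁻ x, F (x k) ∂(chainLaw μ₀ (envKernel P)) = ∫⁻ q, (evolve P)^[k] F q ∂μ₀ := by
  induction k generalizing F with
  | zero =>
    conv_rhs => rw [← chainLaw_map_zero μ₀ (envKernel P)]
    rw [Function.iterate_zero_apply, lintegral_map hF (by fun_prop)]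
  | succ k ih =>
    rw [lintegral_chainLaw_succ _ _ hF, Function.iterate_succ_apply, ← ih (measurable_evolve P hF)]
    simp_rw [lintegral_envKernel P hF]

/-- Started from the invariant law for a frozen environment, the chain has this law at every time.
The statement is for one `z`, as invariance is only known for good data. -/
theorem lintegral_evolve_of_invariant {z : Ω} {ν : Measure E}
    (hinv : (P.sectR z).Invariant ν) {F : Ω × E → ℝ≥0∞} (hF : Measurable F) (k : ℕ) :
    ∫⁻ θ, (evolve P)^[k] F (z, θ) ∂ν = ∫⁻ θ, F (z, θ) ∂ν := by
  induction k generalizing F with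
  | zero => rfl
  | succ k ih =>
    rw [Function.iterate_succ_apply, ih (measurable_evolve P hF)]
    conv_rhs => rw [← hinv.def]
    rw [Measure.lintegral_bind (Kernel.aemeasurable _) (by fun_prop)]
    rfl

/-- Mass comparison between a set `A` of the prior and a set `B` on which the
log-likelihood exceeds its values on `A` by at most `c`. -/
theorem setLIntegral_le_of_tilted {π : Measure E} [IsProbabilityMeasure π] {l : E → ℝ}
    (hint : Integrable (fun θ => Real.exp (l θ)) π) {A B : Set E} (hA : MeasurableSet A)
    (hB : MeasurableSet B) {M c : ℝ} (hlA : ∀ θ ∈ A, M - c ≤ l θ) (hlB : ∀ θ ∈ B, l θ ≤ M)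
    {h : E → ℝ≥0∞} (hh : ∫⁻ θ, h θ ∂(π.tilted l) = π.tilted l B) :
    ∫⁻ θ in A, h θ ∂π ≤ ENNReal.ofReal (Real.exp c) * π B := by
  set Z := ∫ θ, Real.exp (l θ) ∂π with hZ
  have hZ0 : 0 < Z := integral_exp_pos hint
  -- `w` bounds the tilted density from below on `A`, and `e^c w` bounds it from above on `B`; the
  -- data-dependent normalization `Z` cancels.
  set w := ENNReal.ofReal (Real.exp (M - c) / Z) with hw
  have hw0 : w ≠ 0 := by
    rw [hw, ne_eq, ENNReal.ofReal_eq_zero, not_le]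
    positivity
  rw [← ENNReal.mul_le_mul_iff_right hw0 ENNReal.ofReal_ne_top,
    ← lintegral_const_mul' _ _ ENNReal.ofReal_ne_top]
  calc ∫⁻ θ in A, w * h θ ∂π
      ≤ ∫⁻ θ in A, ENNReal.ofReal (Real.exp (l θ) / Z) * h θ ∂π := by
        refine setLIntegral_mono' hA fun θ hθ => ?_
        have := hlA θ hθ
        rw [hw]
        gcongr
    _ = ∫⁻ θ in A, h θ ∂(π.tilted l) := (setLIntegral_tilted' l h hA).symm
    _ ≤ ∫⁻ θ, h θ ∂(π.tilted l) := setLIntegral_le_lintegral _ _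
    _ = ∫⁻ θ in B, ENNReal.ofReal (Real.exp (l θ) / Z) ∂π := by rw [hh, tilted_apply' _ _ hB]
    _ ≤ ∫⁻ θ in B, ENNReal.ofReal (Real.exp M / Z) ∂π := by
        refine setLIntegral_mono' hB fun θ hθ => ?_
        have := hlB θ hθ
        gcongr
    _ = w * (ENNReal.ofReal (Real.exp c) * π B) := by
        rw [setLIntegral_const, ← mul_assoc, hw, ← ENNReal.ofReal_mul (by positivity)]
        congr 2
        rw [div_mul_eq_mul_div, ← Real.exp_add]
        congr 2
        ring

end Environment

/-! ### Hitting a ball from outside -/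

section Hitting

variable {Ω : Type*} {D : ℕ}

/-- The barrier around `B_s` of width `w`, together with the complement of `B_R`. -/
def barrier (D : ℕ) (s w R : ℝ) : Set (Vec D) := {θ | (s < ‖θ‖ ∧ ‖θ‖ ≤ s + w) ∨ R < ‖θ‖}

theorem measurableSet_barrier (D : ℕ) (s w R : ℝ) : MeasurableSet (barrier D s w R) := by
  have h : MeasurableSet ((fun θ : Vec D => ‖θ‖) ⁻¹' (Ioc s (s + w) ∪ Ioi R)) :=
    (measurableSet_Ioc.union measurableSet_Ioi).preimage (by fun_prop)
  exact h

/-- Outside the barrier and `B_s` the norm exceeds `s + w` and is at most `R`, so a step shorter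
than `w` cannot reach `B_s`. The region beyond `R` is counted as barrier because jumps are
controlled only inside `B_R`. A change of environment is excluded only almost surely, hence it is
listed among the exceptional jumps. -/
theorem hit_subset {s w R : ℝ} (G : Set Ω) (n : ℕ) :
    {x : ℕ → Ω × Vec D | ∃ k ≤ n, ‖(x k).2‖ ≤ s} ⊆
      {x | ¬ ((x 0).1 ∈ G ∧ s < ‖(x 0).2‖)} ∪
      (⋃ k ∈ Finset.range n, {x | x k ∈ G ×ˢ barrier D s w R}) ∪
      (⋃ k ∈ Finset.range n, {x | (x k, x (k + 1)) ∈ {r : (Ω × Vec D) × (Ω × Vec D) |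
        r.1.1 ∈ G ∧ ((‖r.1.2‖ ≤ R ∧ w ≤ ‖r.1.2 - r.2.2‖) ∨ r.2.1 ∉ G)}}) := by
  rintro x ⟨k, hkn, hk⟩
  by_contra hcon
  simp only [mem_union, mem_iUnion, not_or, not_exists, mem_ofPred_eq, not_not,
    Finset.mem_range, mem_prod, exists_prop] at hcon
  obtain ⟨⟨⟨hG0, hs0⟩, hbar⟩, hjump⟩ := hcon
  have key : ∀ j ≤ n, (x j).1 ∈ G ∧ s < ‖(x j).2‖ := by
    intro j
    induction j with
    | zero => exact fun _ => ⟨hG0, hs0⟩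
    | succ j ih =>
      intro hj
      obtain ⟨hG, hs⟩ := ih (by omega)
      have hb : ¬ (x j).2 ∈ barrier D s w R := fun h => hbar j ⟨by omega, hG, h⟩
      simp only [barrier, mem_ofPred_eq, not_or, not_and, not_le, not_lt] at hb
      obtain ⟨hb1, hb2⟩ := hb
      have h1 := hb1 hs
      have h2 : ‖(x j).2 - (x (j + 1)).2‖ < w := by
        by_contra h
        exact hjump j ⟨by omega, hG, Or.inl ⟨hb2, not_lt.1 h⟩⟩
      refine ⟨by_contra fun h => hjump j ⟨by omega, hG, Or.inr h⟩, ?_⟩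
      have h3 := norm_sub_norm_le (x j).2 (x (j + 1)).2
      linarith
  exact absurd hk (not_le.2 (key k hkn).2)

/-- The three terms are the cost of bad data, the expected number of barrier visits before time `n`,
and the union bound over long jumps. The second is estimated on average over starts in `A` under the
prior, and a start not above average is selected after integrating out the data, so it does not
depend on them. -/
theorem exists_start_hit_le [MeasurableSpace Ω] {μ : Measure Ω} [IsProbabilityMeasure μ] {π : Measure (Vec D)}
    [IsProbabilityMeasure π] {l : Ω → Vec D → ℝ} (P : Kernel (Ω × Vec D) (Vec D))
    [IsMarkovKernel P] {G : Set Ω} (hG : MeasurableSet G) {A : Set (Vec D)}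
    (hA : MeasurableSet A) (hπA : π A ≠ 0) {s w R c : ℝ} (hAs : ∀ θ ∈ A, s < ‖θ‖) {p : ℝ≥0∞}
    (hint : ∀ z ∈ G, Integrable (fun θ => Real.exp (l z θ)) π)
    (hinv : ∀ z ∈ G, (P.sectR z).Invariant (π.tilted (l z)))
    (hl : ∀ z ∈ G, ∃ M, (∀ θ ∈ A, M - c ≤ l z θ) ∧ ∀ θ ∈ barrier D s w R, l z θ ≤ M)
    (hstep : ∀ z ∈ G, ∀ θ : Vec D, ‖θ‖ ≤ R → P (z, θ) {ϑ | w ≤ ‖θ - ϑ‖} ≤ p) (n : ℕ) :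
    ∃ ϑ₀ ∈ A, chainLaw (μ.prod (Measure.dirac ϑ₀)) (envKernel P)
        {x | ∃ k ≤ n, ‖(x k).2‖ ≤ s} ≤
      μ Gᶜ + n * (ENNReal.ofReal (Real.exp c) * π (barrier D s w R) / π A) + n * p := by
  set B := barrier D s w R with hBdef
  have hB : MeasurableSet B := measurableSet_barrier D s w R
  set F : Ω × Vec D → ℝ≥0∞ := fun q => B.indicator 1 q.2 with hF
  have hFm : Measurable F := (measurable_one.indicator hB).comp measurable_snd
  -- Expected number of visits to the barrier on good data, as a function of the start.
  set f : Vec D → ℝ≥0∞ := fun ϑ => ∑ k ∈ Finset.range n,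
    ∫⁻ z in G, (evolve P)^[k] F (z, ϑ) ∂μ with hf
  have hfm : Measurable f := by
    refine Finset.measurable_fun_sum _ fun k _ => ?_
    have h : Measurable (fun r : Vec D × Ω => (evolve P)^[k] F (r.2, r.1)) :=
      (measurable_evolve_iterate P hFm k).comp (by fun_prop)
    exact h.lintegral_prod_right'
  have hfA : ∫⁻ ϑ in A, f ϑ ∂π ≤ n * (ENNReal.ofReal (Real.exp c) * π B) := by
    rw [hf, lintegral_finsetSum _ fun k _ => by
      have h : Measurable (fun r : Vec D × Ω => (evolve P)^[k] F (r.2, r.1)) :=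
        (measurable_evolve_iterate P hFm k).comp (by fun_prop)
      exact h.lintegral_prod_right']
    have hk : ∀ k ∈ Finset.range n, ∫⁻ ϑ in A, ∫⁻ z in G, (evolve P)^[k] F (z, ϑ) ∂μ ∂π ≤
        ENNReal.ofReal (Real.exp c) * π B := by
      intro k _
      rw [lintegral_lintegral_swap (f := fun ϑ z => (evolve P)^[k] F (z, ϑ))
        ((measurable_evolve_iterate P hFm k).comp measurable_swap).aemeasurable]
      calc ∫⁻ z in G, ∫⁻ ϑ in A, (evolve P)^[k] F (z, ϑ) ∂π ∂μ
          ≤ ∫⁻ _z in G, ENNReal.ofReal (Real.exp c) * π B ∂μ := by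
            refine setLIntegral_mono' hG fun z hz => ?_
            obtain ⟨M, hM1, hM2⟩ := hl z hz
            refine setLIntegral_le_of_tilted (hint z hz) hA hB hM1 hM2 ?_
            rw [lintegral_evolve_of_invariant P (hinv z hz) hFm]
            simp only [hF]
            rw [lintegral_indicator_one hB]
        _ ≤ _ := by
            rw [setLIntegral_const]
            exact mul_le_of_le_one_right' prob_le_one
    refine (Finset.sum_le_sum hk).trans ?_
    simp
  -- First moment method: some point of `A` lies at or below the average of `f` over `A`.
  obtain ⟨ϑ₀, hϑA, hϑ⟩ := exists_le_setLAverage hπA (measure_ne_top π A)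
    (hfm.aemeasurable (μ := π.restrict A))
  refine ⟨ϑ₀, hϑA, ?_⟩
  set Q := chainLaw (μ.prod (Measure.dirac ϑ₀)) (envKernel P) with hQ
  have hGB : MeasurableSet (G ×ˢ B) := hG.prod hB
  set J : Set ((Ω × Vec D) × (Ω × Vec D)) := {r |
    r.1.1 ∈ G ∧ ((‖r.1.2‖ ≤ R ∧ w ≤ ‖r.1.2 - r.2.2‖) ∨ r.2.1 ∉ G)} with hJ
  have hJm : MeasurableSet J := by
    have h1 : MeasurableSet {r : (Ω × Vec D) × (Ω × Vec D) | r.1.1 ∈ G} :=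
      hG.preimage (by fun_prop)
    have h2 : MeasurableSet {r : (Ω × Vec D) × (Ω × Vec D) | ‖r.1.2‖ ≤ R} :=
      measurableSet_le (by fun_prop) (by fun_prop)
    have h3 : MeasurableSet {r : (Ω × Vec D) × (Ω × Vec D) | w ≤ ‖r.1.2 - r.2.2‖} :=
      measurableSet_le (by fun_prop) (by fun_prop)
    have h4 : MeasurableSet {r : (Ω × Vec D) × (Ω × Vec D) | r.2.1 ∉ G} :=
      hG.compl.preimage (f := fun r : (Ω × Vec D) × (Ω × Vec D) => r.2.1) (by fun_prop)
    exact h1.inter ((h2.inter h3).union h4)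
  refine (measure_mono (hit_subset (w := w) (R := R) G n)).trans ?_
  refine (measure_union_le _ _).trans (add_le_add ((measure_union_le _ _).trans
    (add_le_add ?_ ?_)) ?_)
  · have hm : MeasurableSet {q : Ω × Vec D | ¬ (q.1 ∈ G ∧ s < ‖q.2‖)} := by
      have h : MeasurableSet (G ×ˢ {θ : Vec D | s < ‖θ‖})ᶜ :=
        (hG.prod (measurableSet_lt (by fun_prop) (by fun_prop))).compl
      exact h
    have h0 : Q {x | ¬ ((x 0).1 ∈ G ∧ s < ‖(x 0).2‖)} =
        (Q.map (fun x => x 0)) {q | ¬ (q.1 ∈ G ∧ s < ‖q.2‖)} := by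
      rw [Measure.map_apply (by fun_prop) hm]
      rfl
    rw [h0, hQ, chainLaw_map_zero, Measure.prod_dirac, Measure.map_apply (by fun_prop) hm]
    refine measure_mono fun z hz => ?_
    simp only [mem_preimage, mem_ofPred_eq, not_and] at hz
    exact fun hzG => hz hzG (hAs _ hϑA)
  · have h1 : ∀ k, Q {x | x k ∈ G ×ˢ B} = ∫⁻ z in G, (evolve P)^[k] F (z, ϑ₀) ∂μ := by
      intro k
      have hwF : (G ×ˢ B).indicator (1 : Ω × Vec D → ℝ≥0∞) =
          fun q => G.indicator 1 q.1 * F q := by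
        funext q
        by_cases h1 : q.1 ∈ G <;> by_cases h2 : q.2 ∈ B <;> simp [hF, h1, h2, mem_prod, indicator]
      calc Q {x | x k ∈ G ×ˢ B} = ∫⁻ x, (G ×ˢ B).indicator 1 (x k) ∂Q := by
            have : MeasurableSet ((fun x : ℕ → Ω × Vec D => x k) ⁻¹' (G ×ˢ B)) :=
              hGB.preimage (by fun_prop)
            rw [← lintegral_map (f := (G ×ˢ B).indicator (1 : Ω × Vec D → ℝ≥0∞))
              (measurable_one.indicator hGB) (by fun_prop : Measurable fun x : ℕ → Ω × Vec D => x k),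
              lintegral_indicator_one hGB, Measure.map_apply (by fun_prop) hGB]
            rfl
        _ = _ := by
            rw [hQ, lintegral_chainLaw_envKernel P _ (measurable_one.indicator hGB), hwF,
              evolve_iterate_mul P (w := G.indicator 1)
                (fun z => by by_cases h : z ∈ G <;> simp [h]), Measure.prod_dirac, lintegral_map
                (f := fun q : Ω × Vec D => G.indicator 1 q.1 * (evolve P)^[k] F q)
                (((measurable_one.indicator hG).comp measurable_fst).mul
                  (measurable_evolve_iterate P hFm k)) (by fun_prop), ← lintegral_indicator hG]
            congr 1
            funext z
            by_cases h : z ∈ G <;> simp [h]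
    calc Q (⋃ k ∈ Finset.range n, {x | x k ∈ G ×ˢ B})
        ≤ ∑ k ∈ Finset.range n, Q {x | x k ∈ G ×ˢ B} := measure_biUnion_finset_le _ _
      _ = f ϑ₀ := by simp only [h1, hf]
      _ ≤ _ := hϑ
      _ ≤ _ := by
        rw [setLAverage_eq, ← mul_div_assoc]
        exact ENNReal.div_le_div_right hfA _
  · calc Q (⋃ k ∈ Finset.range n, {x | (x k, x (k + 1)) ∈ J})
        ≤ ∑ k ∈ Finset.range n, Q {x | (x k, x (k + 1)) ∈ J} := measure_biUnion_finset_le _ _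
      _ ≤ ∑ k ∈ Finset.range n, p := by
        refine Finset.sum_le_sum fun k _ => chainLaw_pair_le _ _ hJm (fun q => ?_) k
        rw [envKernel_apply, Measure.map_apply (by fun_prop) (hJm.preimage (by fun_prop))]
        -- The kernel keeps the environment, so a transition into `J` from good data must be a long
        -- jump from within `B_R`; otherwise the section is empty.
        by_cases hq : q.1 ∈ G ∧ ‖q.2‖ ≤ R
        · refine (measure_mono fun ϑ hϑ => ?_).trans (hstep q.1 hq.1 q.2 hq.2)
          simp only [hJ, mem_preimage, mem_ofPred_eq] at hϑ ⊢
          tauto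
        · have : (Prod.mk q.1 : Vec D → Ω × Vec D) ⁻¹' (Prod.mk q ⁻¹' J) = ∅ := by
            ext ϑ
            simp only [hJ, mem_preimage, mem_ofPred_eq, mem_empty_iff_false]
            tauto
          rw [this]
          simp
      _ = _ := by simp

end Hitting

/-! ### Invariance of the posterior under pCN -/

section PCN

variable {D : ℕ} {C : Matrix (Fin D) (Fin D) ℝ} {β : ℝ}

theorem integral_strongDual_priorLaw (L : StrongDual ℝ (Vec D)) : ∫ x, L x ∂(priorLaw C) = 0 := by
  rw [L.integral_comp_id_comm IsGaussian.integrable_id, integral_id_multivariateGaussian, map_zero]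

theorem map_rotation_priorLaw (φ : ℝ) :
    ((priorLaw C).prod (priorLaw C)).map (ContinuousLinearMap.rotation φ) =
      (priorLaw C).prod (priorLaw C) :=
  IsGaussian.map_rotation_eq_self_of_forall_strongDual_eq_zero integral_strongDual_priorLaw φ

/-- Rotation by `π` negates both components of an independent pair; the first marginal gives the
symmetry. -/
theorem measurePreserving_neg_priorLaw :
    MeasurePreserving (fun x : Vec D => -x) (priorLaw C) (priorLaw C) := by
  refine ⟨by fun_prop, ?_⟩
  have h1 := congrArg (fun ν => ν.map Prod.fst) (map_rotation_priorLaw (C := C) Real.pi)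
  simp only [Measure.map_fst_prod, measure_univ, one_smul] at h1
  rw [Measure.map_map (by fun_prop) (by fun_prop)] at h1
  have h2 : (Prod.fst ∘ ContinuousLinearMap.rotation (E := Vec D) Real.pi) =
      (fun x => -x) ∘ Prod.fst := by
    funext q
    simp [ContinuousLinearMap.rotation_apply]
  rw [h2, ← Measure.map_map (by fun_prop) (by fun_prop), Measure.map_fst_prod] at h1
  simpa using h1

/-- The reflection which exchanges the current state with the pCN proposal. -/
theorem measurePreserving_pcnSwap (hβ0 : 0 ≤ β) (hβ1 : β ≤ 1) :
    MeasurePreserving (fun q : Vec D × Vec D => (Real.sqrt (1 - β) • q.1 + Real.sqrt β • q.2,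
        Real.sqrt β • q.1 - Real.sqrt (1 - β) • q.2))
      ((priorLaw C).prod (priorLaw C)) ((priorLaw C).prod (priorLaw C)) := by
  have h1 : MeasurePreserving (ContinuousLinearMap.rotation (E := Vec D)
      (Real.arcsin (Real.sqrt β))) ((priorLaw C).prod (priorLaw C))
      ((priorLaw C).prod (priorLaw C)) := ⟨by fun_prop, map_rotation_priorLaw _⟩
  have h2 := ((MeasurePreserving.id (priorLaw C)).prod
    (measurePreserving_neg_priorLaw (C := C))).comp h1
  convert h2 using 1
  funext q
  have hs := Real.sqrt_nonneg β
  have hs1 : Real.sqrt β ≤ 1 := Real.sqrt_le_one.2 hβ1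
  simp only [Function.comp_apply, ContinuousLinearMap.rotation_apply, Prod.map, id_eq,
    Real.cos_arcsin, Real.sin_arcsin (by linarith) hs1, Real.sq_sqrt hβ0]
  congr 1
  module

theorem lintegral_accept {X : Type*} {a : ℝ} (ha0 : 0 ≤ a) (ha1 : a ≤ 1) (h : X → ℝ≥0∞) (p θ : X) :
    ∫⁻ u in Icc (0 : ℝ) 1, h (if u ≤ a then p else θ) =
      ENNReal.ofReal a * h p + ENNReal.ofReal (1 - a) * h θ := by
  have e : (fun u : ℝ => h (if u ≤ a then p else θ)) =
      fun u => (Iic a).indicator (fun _ => h p) u + (Ioi a).indicator (fun _ => h θ) u := by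
    funext u
    by_cases hu : u ≤ a
    · simp [hu]
    · simp [hu, not_le.1 hu]
  rw [e, lintegral_add_left (measurable_const.indicator measurableSet_Iic),
    lintegral_indicator_const measurableSet_Iic, lintegral_indicator_const measurableSet_Ioi,
    Measure.restrict_apply measurableSet_Iic, Measure.restrict_apply measurableSet_Ioi]
  have e1 : Iic a ∩ Icc (0 : ℝ) 1 = Icc 0 a := by
    ext u
    simp only [mem_inter_iff, mem_Iic, mem_Icc]
    constructor
    · rintro ⟨h1, h2, -⟩
      exact ⟨h2, h1⟩
    · rintro ⟨h1, h2⟩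
      exact ⟨h2, h1, h2.trans ha1⟩
  have e2 : Ioi a ∩ Icc (0 : ℝ) 1 = Ioc a 1 := by
    ext u
    simp only [mem_inter_iff, mem_Ioi, mem_Icc, mem_Ioc]
    constructor
    · rintro ⟨h1, -, h2⟩
      exact ⟨h1, h2⟩
    · rintro ⟨h1, h2⟩
      exact ⟨h1, ha0.trans h1.le, h2⟩
  rw [e1, e2, Real.volume_Icc, Real.volume_Ioc, sub_zero, mul_comm, mul_comm (h θ)]

theorem pcnKernel_apply {d N : ℕ} (G : ForwardMap D d) (q : Data d N × Vec D) :
    pcnKernel N G C β q = ((priorLaw C).prod (volume.restrict (Icc (0 : ℝ) 1))).map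
      (fun r => pcnStep β (logLik G q.1) q.2 r.1 r.2) := by
  have := isProbabilityMeasure_uniform
  unfold pcnKernel
  rw [Kernel.map_apply _ (measurable_pcnStep G β), Kernel.prod_apply, Kernel.id_apply,
    Kernel.const_apply, Measure.dirac_prod,
    Measure.map_map (measurable_pcnStep G β) (by fun_prop)]
  rfl

theorem measurable_logLik_right {d N : ℕ} (G : ForwardMap D d) (z : Data d N) :
    Measurable (logLik G z) := by
  have h : Measurable (Function.uncurry fun (z : Data d N) (θ : Vec D) => logLik G z θ) :=
    measurable_logLik G
  exact h.of_uncurry_left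

theorem logLik_nonpos {d N : ℕ} (G : ForwardMap D d) (z : Data d N) (θ : Vec D) :
    logLik G z θ ≤ 0 := by
  unfold logLik
  have : 0 ≤ ∑ i, |(z i).1 - G.toFun θ (z i).2| ^ 2 := Finset.sum_nonneg fun i _ => by positivity
  linarith

theorem integrable_exp_logLik {d N : ℕ} (G : ForwardMap D d) (z : Data d N) (π : Measure (Vec D))
    [IsProbabilityMeasure π] : Integrable (fun θ => Real.exp (logLik G z θ)) π := by
  refine Integrable.of_bound (C := 1) (measurable_logLik_right G z).exp.aestronglyMeasurable
    (Eventually.of_forall fun θ => ?_)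
  rw [Real.norm_of_nonneg (Real.exp_pos _).le]
  exact Real.exp_le_one_iff.2 (logLik_nonpos G z θ)

/-- Detailed balance. The reflection `S` preserves the product of two priors and exchanges state and
proposal, while the accepted weight `e^(l(θ)) min(1, e^(l(p) - l(θ)))` is the minimum of `e^(l(θ))`
and `e^(l(p))`, symmetric under this exchange. So the accepted mass arriving equals the accepted
mass leaving, and rejection restores the rest. -/
theorem lintegral_pcn_invariant {l : Vec D → ℝ} (hl : Measurable l) {Z : ℝ} (hZ : 0 < Z)
    (hβ0 : 0 ≤ β) (hβ1 : β ≤ 1) {h : Vec D → ℝ≥0∞} (hh : Measurable h) :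
    ∫⁻ θ, ENNReal.ofReal (Real.exp (l θ) / Z) *
      ∫⁻ ξ, (∫⁻ u in Icc (0 : ℝ) 1, h (pcnStep β l θ ξ u)) ∂(priorLaw C) ∂(priorLaw C) =
    ∫⁻ θ, ENNReal.ofReal (Real.exp (l θ) / Z) * h θ ∂(priorLaw C) := by
  set π := priorLaw C with hπ
  set p : Vec D × Vec D → Vec D := fun q => Real.sqrt (1 - β) • q.1 + Real.sqrt β • q.2 with hp
  have hpm : Measurable p := by fun_prop
  set a : Vec D × Vec D → ℝ := fun q => min 1 (Real.exp (l (p q) - l q.1)) with ha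
  have ham : Measurable a :=
    measurable_const.min ((hl.comp hpm).sub (hl.comp measurable_fst)).exp
  have ha0 : ∀ q, 0 ≤ a q := fun q => le_min zero_le_one (Real.exp_pos _).le
  have ha1 : ∀ q, a q ≤ 1 := fun q => min_le_left _ _
  set w : Vec D → ℝ≥0∞ := fun θ => ENNReal.ofReal (Real.exp (l θ) / Z) with hw
  have hwm : Measurable w := by fun_prop
  set S : Vec D × Vec D → Vec D × Vec D := fun q => (p q,
    Real.sqrt β • q.1 - Real.sqrt (1 - β) • q.2) with hS
  have hSmp : MeasurePreserving S (π.prod π) (π.prod π) := measurePreserving_pcnSwap hβ0 hβ1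
  have hpS : ∀ q, p (S q) = q.1 := by
    intro q
    have h1 := Real.mul_self_sqrt hβ0
    have h2 := Real.mul_self_sqrt (sub_nonneg.2 hβ1)
    simp only [hS, hp, smul_add, smul_sub, smul_smul, h1, h2]
    rw [mul_comm (Real.sqrt β) (Real.sqrt (1 - β))]
    module
  have hsymm : ∀ q, w q.1 * ENNReal.ofReal (a q) = w (p q) * ENNReal.ofReal (a (S q)) := by
    intro q
    have hk : ∀ x y : ℝ, Real.exp x / Z * min 1 (Real.exp (y - x)) =
        min (Real.exp x) (Real.exp y) / Z := by
      intro x y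
      rw [div_mul_eq_mul_div, mul_min_of_nonneg _ _ (Real.exp_pos x).le, mul_one, ← Real.exp_add,
        add_sub_cancel]
    simp only [hw, ha]
    rw [← ENNReal.ofReal_mul (by positivity), ← ENNReal.ofReal_mul (by positivity), hk, hpS, hk,
      min_comm]
  have hm1 : Measurable fun q : Vec D × Vec D => w q.1 * (ENNReal.ofReal (a q) * h (p q)) :=
    (hwm.comp measurable_fst).mul (ham.ennreal_ofReal.mul (hh.comp hpm))
  have hm2 : Measurable fun q : Vec D × Vec D => w q.1 * (ENNReal.ofReal (a q) * h q.1) :=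
    (hwm.comp measurable_fst).mul (ham.ennreal_ofReal.mul (hh.comp measurable_fst))
  have hm3 : Measurable fun q : Vec D × Vec D => w q.1 * (ENNReal.ofReal (1 - a q) * h q.1) :=
    (hwm.comp measurable_fst).mul ((measurable_const.sub ham).ennreal_ofReal.mul
      (hh.comp measurable_fst))
  have hexch : ∫⁻ q, w q.1 * (ENNReal.ofReal (a q) * h (p q)) ∂(π.prod π) =
      ∫⁻ q, w q.1 * (ENNReal.ofReal (a q) * h q.1) ∂(π.prod π) := by
    rw [← hSmp.lintegral_comp hm2]
    refine lintegral_congr fun q => ?_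
    rw [← mul_assoc, hsymm q, mul_assoc]
  calc ∫⁻ θ, w θ * ∫⁻ ξ, (∫⁻ u in Icc (0 : ℝ) 1, h (pcnStep β l θ ξ u)) ∂π ∂π
      = ∫⁻ θ, ∫⁻ ξ, (w θ * (ENNReal.ofReal (a (θ, ξ)) * h (p (θ, ξ))) +
          w θ * (ENNReal.ofReal (1 - a (θ, ξ)) * h θ)) ∂π ∂π := by
        refine lintegral_congr fun θ => ?_
        rw [← lintegral_const_mul' _ _ ENNReal.ofReal_ne_top]
        refine lintegral_congr fun ξ => ?_
        rw [← mul_add, ← lintegral_accept (ha0 _) (ha1 _)]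
        rfl
    _ = ∫⁻ q, (w q.1 * (ENNReal.ofReal (a q) * h (p q)) +
          w q.1 * (ENNReal.ofReal (1 - a q) * h q.1)) ∂(π.prod π) :=
        (lintegral_prod _ (hm1.add hm3).aemeasurable).symm
    _ = ∫⁻ q, (w q.1 * (ENNReal.ofReal (a q) * h q.1) +
          w q.1 * (ENNReal.ofReal (1 - a q) * h q.1)) ∂(π.prod π) := by
        rw [lintegral_add_left hm1, hexch, lintegral_add_left hm2]
    _ = ∫⁻ q, w q.1 * h q.1 ∂(π.prod π) := by
        refine lintegral_congr fun q => ?_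
        rw [← mul_add, ← add_mul, ← ENNReal.ofReal_add (ha0 q) (sub_nonneg.2 (ha1 q)),
          add_sub_cancel, ENNReal.ofReal_one, one_mul]
    _ = ∫⁻ θ, w θ * h θ ∂π := by
        rw [lintegral_prod (fun q : Vec D × Vec D => w q.1 * h q.1)
          ((hwm.mul hh).comp measurable_fst).aemeasurable]
        simp

theorem pcnKernel_invariant {d N : ℕ} (G : ForwardMap D d) (z : Data d N) (hβ0 : 0 ≤ β)
    (hβ1 : β ≤ 1) : ((pcnKernel N G C β).sectR z).Invariant (posteriorLaw G C z) := by
  have hu := isProbabilityMeasure_uniform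
  have hl := measurable_logLik_right G z
  have hZ : 0 < ∫ θ, Real.exp (logLik G z θ) ∂(priorLaw C) :=
    integral_exp_pos (integrable_exp_logLik G z _)
  unfold posteriorLaw
  ext s hs
  rw [Measure.bind_apply hs (Kernel.aemeasurable _), lintegral_tilted, tilted_apply' _ _ hs]
  have hstep : ∀ θ : Vec D, Measurable fun r : Vec D × ℝ => pcnStep β (logLik G z) θ r.1 r.2 :=
    fun θ => (measurable_pcnStep G β).comp
      ((measurable_const (a := (z, θ))).prodMk measurable_id)
  have hker : ∀ θ, (pcnKernel N G C β).sectR z θ s = ∫⁻ ξ, (∫⁻ u in Icc (0 : ℝ) 1,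
      s.indicator 1 (pcnStep β (logLik G z) θ ξ u)) ∂(priorLaw C) := by
    intro θ
    rw [Kernel.sectR_apply, pcnKernel_apply, ← lintegral_indicator_one hs,
      lintegral_map (measurable_one.indicator hs) (hstep θ),
      lintegral_prod (fun r : Vec D × ℝ => s.indicator 1 (pcnStep β (logLik G z) θ r.1 r.2))
        ((measurable_one.indicator hs).comp (hstep θ)).aemeasurable]
  simp_rw [hker]
  rw [lintegral_pcn_invariant hl hZ hβ0 hβ1 (measurable_one.indicator hs),
    ← lintegral_indicator hs]
  refine lintegral_congr fun θ => ?_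
  by_cases hθ : θ ∈ s <;> simp [hθ]

/-- If `‖ξ‖ ≤ R`, the proposal moves by at most `(1 - √(1-β)) R + √β R`, and `1 - √(1-β) ≤ β`. A
long step thus needs an increment outside `B_R`. -/
theorem pcnKernel_step_le {d N : ℕ} (G : ForwardMap D d) (z : Data d N) (hβ0 : 0 ≤ β)
    (hβ1 : β ≤ 1) {R w : ℝ} (hw0 : 0 < w) (hw : β * R + Real.sqrt β * R < w) {θ : Vec D}
    (hθ : ‖θ‖ ≤ R) :
    pcnKernel N G C β (z, θ) {ϑ | w ≤ ‖θ - ϑ‖} ≤ priorLaw C {ξ | R < ‖ξ‖} := by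
  have hu := isProbabilityMeasure_uniform
  have hstep : Measurable fun r : Vec D × ℝ => pcnStep β (logLik G z) θ r.1 r.2 :=
    (measurable_pcnStep G β).comp ((measurable_const (a := (z, θ))).prodMk measurable_id)
  rw [pcnKernel_apply, Measure.map_apply hstep (measurableSet_le (by fun_prop) (by fun_prop))]
  calc _ ≤ ((priorLaw C).prod (volume.restrict (Icc (0 : ℝ) 1))) ({ξ | R < ‖ξ‖} ×ˢ univ) := by
        refine measure_mono fun r hr => ?_
        simp only [mem_preimage, mem_ofPred_eq, mem_prod, mem_univ, and_true] at hr ⊢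
        by_contra hcon
        rw [not_lt] at hcon
        refine absurd hr (not_le.2 ?_)
        simp only [pcnStep]
        split_ifs
        · have e : θ - (Real.sqrt (1 - β) • θ + Real.sqrt β • r.1) =
              (1 - Real.sqrt (1 - β)) • θ - Real.sqrt β • r.1 := by module
          have h1 : Real.sqrt (1 - β) ≤ 1 := Real.sqrt_le_one.2 (by linarith)
          have h2 : 1 - β ≤ Real.sqrt (1 - β) :=
            Real.le_sqrt_of_sq_le (by nlinarith)
          rw [e]
          refine (norm_sub_le _ _).trans_lt (lt_of_le_of_lt ?_ hw)
          rw [norm_smul, norm_smul, Real.norm_of_nonneg (by linarith),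
            Real.norm_of_nonneg (Real.sqrt_nonneg _)]
          gcongr
          linarith
        · simpa using hw0
    _ = _ := by
        rw [Measure.prod_prod]
        simp

end PCN

/-! ### Comparison of log-likelihood values -/

section Likelihood

variable {d D N : ℕ} {g : Vec d → ℝ} {T t ρ L m M δ U : ℝ} {z : Data d N}

theorem abs_sqrt_mul_score_le (hU : 0 ≤ U) (hδU : δ * U ≤ 1 / 2)
    (hz : z ∈ goodData g m M δ N) {w : ℝ} (hw : w ≤ U ^ 2) :
    |Real.sqrt w * score g z| ≤ N / 2 := by
  rw [abs_mul, abs_of_nonneg (Real.sqrt_nonneg w)]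
  calc Real.sqrt w * |score g z| ≤ U * (δ * N) :=
        mul_le_mul (Real.sqrt_le_left hU |>.2 hw) hz.1 (abs_nonneg _) hU
    _ = δ * U * N := by ring
    _ ≤ 1 / 2 * N := by gcongr
    _ = N / 2 := by ring

theorem logLik_le_of_knee_le (hgm : Measurable g) (ht : 0 < t) (htL : t ≤ L) (hT : 0 ≤ T)
    (hρ : 0 ≤ ρ) (hU : 0 ≤ U) (hUw : (T * t) ^ 2 + T * t / 2 + ρ * L ≤ U ^ 2)
    (hδU : δ * U ≤ 1 / 2) (hz : z ∈ goodData g m M δ N) {θ : Vec D} (hθ : t ≤ ‖θ‖) :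
    logLik (radialMap D g hgm T t ρ L) z θ ≤ -(1 / 2) * ∑ i, (z i).1 ^ 2 + N / 2
      - ((T * t) ^ 2 + T * t / 2) * information g z / 2 := by
  have hle := profile_le (T := T) (ρ := ρ) ht htL hT hρ (norm_nonneg θ)
  have hge := profile_mono (T := T) (ρ := ρ) ht htL hT hρ ht.le hθ
  rw [profile_knee ht htL] at hge
  rw [logLik_radialMap hgm z (profile_nonneg ht htL hT hρ (norm_nonneg θ))]
  have h1 := (abs_le.1 (abs_sqrt_mul_score_le hU hδU hz (hle.trans hUw))).2
  have hI : 0 ≤ information g z := Finset.sum_nonneg fun i _ => sq_nonneg _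
  have h2 := mul_le_mul_of_nonneg_right hge hI
  linarith

theorem le_logLik_of_profile_le (hgm : Measurable g) (ht : 0 < t) (htL : t ≤ L) (hT : 0 ≤ T)
    (hρ : 0 ≤ ρ) (hU : 0 ≤ U) (hδU : δ * U ≤ 1 / 2) (hz : z ∈ goodData g m M δ N) {θ : Vec D}
    {w : ℝ} (hw : profile T t ρ L ‖θ‖ ≤ w) (hwU : w ≤ U ^ 2) :
    -(1 / 2) * ∑ i, (z i).1 ^ 2 - N / 2 - w * information g z / 2 ≤
      logLik (radialMap D g hgm T t ρ L) z θ := by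
  rw [logLik_radialMap hgm z (profile_nonneg ht htL hT hρ (norm_nonneg θ))]
  have h1 := (abs_le.1 (abs_sqrt_mul_score_le hU hδU hz (hw.trans hwU))).1
  have hI : 0 ≤ information g z := Finset.sum_nonneg fun i _ => sq_nonneg _
  have h2 := mul_le_mul_of_nonneg_right hw hI
  linarith

/-- In the variable `x = √w` the log-likelihood is a concave parabola with vertex `S/I`. On good
data with `δ ≤ u m` the vertex is at most `u`, to the left of every value of `√w` attained beyond
radius `r`. -/
theorem radiallyDecreasingFrom_logLik (hgm : Measurable g) (ht : 0 < t) (htL : t ≤ L) (hT : 0 ≤ T)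
    (hρ : 0 ≤ ρ) {r u : ℝ} (hr : 0 ≤ r) (hu : 0 ≤ u) (hur : u ^ 2 ≤ profile T t ρ L r)
    (hδ : δ ≤ u * m) (hz : z ∈ goodData g m M δ N) :
    RadiallyDecreasingFrom r (logLik (radialMap D g hgm T t ρ L) z) := by
  intro θ θ' h1 h2
  have hw1 := profile_mono (T := T) (ρ := ρ) ht htL hT hρ hr h1
  have hw2 := profile_mono (T := T) (ρ := ρ) ht htL hT hρ (norm_nonneg θ) h2
  have hn1 := profile_nonneg (T := T) (ρ := ρ) ht htL hT hρ (norm_nonneg θ)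
  have hn2 := profile_nonneg (T := T) (ρ := ρ) ht htL hT hρ (norm_nonneg θ')
  rw [logLik_radialMap hgm z hn1, logLik_radialMap hgm z hn2]
  set w := profile T t ρ L ‖θ‖
  set w' := profile T t ρ L ‖θ'‖
  have hx : u ≤ Real.sqrt w := Real.le_sqrt_of_sq_le (hur.trans hw1)
  have hxy : Real.sqrt w ≤ Real.sqrt w' := Real.sqrt_le_sqrt hw2
  have hI : 0 ≤ information g z := Finset.sum_nonneg fun i _ => sq_nonneg _
  have hS : score g z ≤ u * information g z := by
    calc score g z ≤ δ * N := (le_abs_self _).trans hz.1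
      _ ≤ u * m * N := by gcongr
      _ = u * (m * N) := by ring
      _ ≤ u * information g z := by gcongr; exact hz.2.1
  have hSx : score g z ≤ (Real.sqrt w + Real.sqrt w') / 2 * information g z :=
    hS.trans (mul_le_mul_of_nonneg_right (by linarith) hI)
  have e1 := Real.sq_sqrt hn1
  have e2 := Real.sq_sqrt hn2
  have key := mul_nonneg (sub_nonneg.2 hxy) (sub_nonneg.2 hSx)
  nlinarith

end Likelihood

/-! ### Posterior density and posterior mass -/

theorem radiallyDecreasingFrom_priorDensity {D : ℕ} (hD : 0 < D) {θ θ' : Vec D} (h : ‖θ‖ ≤ ‖θ'‖) :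
    priorDensity (isoCov D) θ' ≤ priorDensity (isoCov D) θ := by
  have hD0 : (D : ℝ) ≠ 0 := by positivity
  have hinv : (isoCov D)⁻¹ = (D : ℝ) • 1 := by
    refine Matrix.inv_eq_right_inv ?_
    rw [isoCov, smul_mul_smul_comm, inv_mul_cancel₀ hD0, one_smul, one_mul]
  have hq : ∀ θ : Vec D, WithLp.ofLp θ ⬝ᵥ (isoCov D)⁻¹.mulVec (WithLp.ofLp θ) = D * ‖θ‖ ^ 2 := by
    intro θ
    rw [hinv, Matrix.smul_mulVec, Matrix.one_mulVec, dotProduct_smul, EuclideanSpace.real_norm_sq_eq,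
      smul_eq_mul]
    congr 1
    exact Finset.sum_congr rfl fun i _ => (sq _).symm
  unfold priorDensity
  rw [hq, hq]
  have : (D : ℝ) * ‖θ‖ ^ 2 ≤ D * ‖θ'‖ ^ 2 := by gcongr
  exact mul_le_mul_of_nonneg_left (Real.exp_le_exp.2 (by linarith)) (by positivity)

theorem radiallyDecreasingFrom_posteriorDensity {D d N : ℕ} (hD : 0 < D) {G : ForwardMap D d}
    {z : Data d N} {r : ℝ} (h : RadiallyDecreasingFrom r (logLik G z)) :
    RadiallyDecreasingFrom r (posteriorDensity G (isoCov D) z) := by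
  intro θ θ' h1 h2
  unfold posteriorDensity
  have h3 := h θ θ' h1 h2
  have h4 := radiallyDecreasingFrom_priorDensity hD h2
  have h5 : 0 ≤ priorDensity (isoCov D) θ' := by unfold priorDensity; positivity
  have h6 : 0 ≤ ∫ ϑ, Real.exp (logLik G z ϑ) ∂(priorLaw (isoCov D)) :=
    integral_nonneg fun _ => (Real.exp_pos _).le
  gcongr

/-- The posterior mass of a set on which the likelihood is exponentially smaller than on a set `A`
of the prior. -/
theorem posteriorLaw_mul_le {D d N : ℕ} (G : ForwardMap D d) (C : Matrix (Fin D) (Fin D) ℝ)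
    (z : Data d N) {A B : Set (Vec D)} (hA : MeasurableSet A) (hB : MeasurableSet B) {K c : ℝ}
    (hlA : ∀ θ ∈ A, K - c ≤ logLik G z θ) (hlB : ∀ θ ∈ B, logLik G z θ ≤ K) :
    posteriorLaw G C z B * priorLaw C A ≤ ENNReal.ofReal (Real.exp c) := by
  have hint := integrable_exp_logLik G z (priorLaw C)
  have hprob : IsProbabilityMeasure ((priorLaw C).tilted (logLik G z)) :=
    isProbabilityMeasure_tilted hint
  have h := setLIntegral_le_of_tilted hint hA hB hlA hlB
    (h := fun _ => (priorLaw C).tilted (logLik G z) B) (by simp)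
  rw [setLIntegral_const] at h
  exact h.trans (mul_le_of_le_one_right' prob_le_one)

/-! ### Asymptotics -/

theorem WithHighProbability.mono {Ω : ℕ → Type*} [∀ N, MeasurableSpace (Ω N)]
    {μ : ∀ N, Measure (Ω N)} {A B : ∀ N, Set (Ω N)} (hA : WithHighProbability μ A)
    (h : ∀ᶠ N in atTop, A N ⊆ B N) : WithHighProbability μ B :=
  tendsto_of_tendsto_of_tendsto_of_le_of_le' tendsto_const_nhds hA
    (Eventually.of_forall fun _ => zero_le)
    (h.mono fun _ hN => measure_mono (compl_subset_compl.2 hN))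

theorem tendsto_ofReal_exp_neg {a : ℝ} (ha : 0 < a) :
    Tendsto (fun N : ℕ => ENNReal.ofReal (Real.exp (-(a * N)))) atTop (𝓝 0) := by
  have h : Tendsto (fun N : ℕ => a * (N : ℝ)) atTop atTop :=
    tendsto_natCast_atTop_atTop.const_mul_atTop ha
  simpa using ENNReal.tendsto_ofReal (Real.tendsto_exp_neg_atTop_nhds_zero.comp h)

theorem scale_bounds {b : ℝ} (hb : 0 ≤ b) {N : ℕ} (hN : 1 ≤ N) :
    0 < (N : ℝ) ^ (-b) ∧ (N : ℝ) ^ (-b) ≤ 1 ∧ (N : ℝ) ^ b * (N : ℝ) ^ (-b) = 1 ∧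
      0 < (N : ℝ) ^ b := by
  have hN0 : 0 < (N : ℝ) := by exact_mod_cast hN
  refine ⟨by positivity, Real.rpow_le_one_of_one_le_of_nonpos (by exact_mod_cast hN) (by linarith),
    ?_, by positivity⟩
  rw [← Real.rpow_add hN0, add_neg_cancel, Real.rpow_zero]

/-- A hitting time beyond the integer part of `e^a` is at least that integer plus one, hence at
least `e^a`. -/
theorem compl_late_subset {E : Type*} {Ω : Type*} (A : Set E) (a : ℝ) :
    {ω : ℕ → Ω × E | ENNReal.ofReal (Real.exp a) ≤
      ((hittingTime A (fun k => (ω k).2) : ℕ∞) : ℝ≥0∞)}ᶜ ⊆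
    {ω | ∃ k ≤ ⌊Real.exp a⌋₊, (ω k).2 ∈ A} := by
  intro ω hω
  by_contra hcon
  refine hω ?_
  simp only [mem_ofPred_eq, not_exists, not_and] at hcon ⊢
  have h1 : ((⌊Real.exp a⌋₊ + 1 : ℕ) : ℕ∞) ≤ hittingTime A (fun k => (ω k).2) := by
    refine le_iInf₂ fun k hk => ?_
    have : ¬ k ≤ ⌊Real.exp a⌋₊ := fun h => hcon k h hk
    exact_mod_cast (by omega : ⌊Real.exp a⌋₊ + 1 ≤ k)
  calc ENNReal.ofReal (Real.exp a) ≤ ENNReal.ofReal ((⌊Real.exp a⌋₊ + 1 : ℕ) : ℝ) := by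
        apply ENNReal.ofReal_le_ofReal
        push_cast
        exact (Nat.lt_floor_add_one _).le
    _ = (((⌊Real.exp a⌋₊ + 1 : ℕ) : ℕ∞) : ℝ≥0∞) := by
        rw [ENNReal.ofReal_natCast]
        rfl
    _ ≤ _ := by exact_mod_cast h1

/-! ### Posterior concentration and hitting times on the scale `N^(-b)` -/

section Scaled

variable {d : ℕ} {𝒳 : Set (Vec d)} {g : Vec d → ℝ} {b T t ρ L gmin gmax κ s : ℝ}
  {C : ∀ D, Matrix (Fin D) (Fin D) ℝ} {τ : ℕ → ℝ} {D : ℕ → ℕ}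

theorem scaledMap_zero (D : ℕ → ℕ) (hgm : Measurable g) (T t ρ L : ℝ) (N : ℕ) :
    scaledMap 0 D g hgm T t ρ L N = radialMap (D N) g hgm T t ρ L := by
  simp [scaledMap]

theorem dataLaw_scaledMap (h𝒳v : volume 𝒳 = 1) (hgm : Measurable g) (hb : 0 ≤ b) (ht : 0 < t)
    {N : ℕ} (hN : 1 ≤ N) :
    dataLaw 𝒳 (scaledMap b D g hgm T t ρ L N) N = Measure.pi (fun _ => noiseLaw 𝒳) :=
  dataLaw_radialMap h𝒳v hgm (mul_pos ht (scale_bounds hb hN).1) N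

theorem withHighProbability_goodData (h𝒳m : MeasurableSet 𝒳) (h𝒳v : volume 𝒳 = 1)
    (hgm : Measurable g) (h0 : 0 < gmin) (hgb : ∀ x ∈ 𝒳, g x ∈ Icc gmin gmax) (hb : 0 ≤ b)
    (ht : 0 < t) {δ : ℝ} (hδ : 0 < δ) :
    WithHighProbability (fun N => dataLaw 𝒳 (scaledMap b D g hgm T t ρ L N) N)
      (fun N => goodData g (gmin ^ 2) (gmax ^ 2) δ N) := by
  refine (tendsto_compl_goodData h𝒳m h𝒳v hgm h0 hgb hδ).congr' ?_
  filter_upwards [eventually_ge_atTop 1] with N hN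
  rw [dataLaw_scaledMap h𝒳v hgm hb ht hN]

theorem scaled_knee {N : ℕ} (hb : 0 ≤ b) (hN : 1 ≤ N) (T t : ℝ) :
    T * (N : ℝ) ^ b * (t * (N : ℝ) ^ (-b)) = T * t := by
  calc T * (N : ℝ) ^ b * (t * (N : ℝ) ^ (-b)) = T * t * ((N : ℝ) ^ b * (N : ℝ) ^ (-b)) := by ring
    _ = T * t := by rw [(scale_bounds hb hN).2.2.1, mul_one]

/-- `U` bounds `√w` and `δ` is the admissible relative size of the score, so that the random term
`√w S` is at most `N/2` in absolute value. -/
theorem exists_score_bounds (W : ℝ) : ∃ U δ : ℝ, 0 ≤ U ∧ W ≤ U ^ 2 ∧ 0 < δ ∧ δ * U ≤ 1 / 2 := by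
  refine ⟨Real.sqrt |W|, 1 / (2 * (Real.sqrt |W| + 1)), by positivity, ?_, by positivity, ?_⟩
  · rw [Real.sq_sqrt (abs_nonneg W)]
    exact le_abs_self W
  · have := Real.sqrt_nonneg |W|
    rw [div_mul_eq_mul_div, div_le_iff₀ (by positivity)]
    linarith

theorem withHighProbability_radiallyDecreasingFrom (h𝒳m : MeasurableSet 𝒳) (h𝒳v : volume 𝒳 = 1)
    (hgm : Measurable g) (h0 : 0 < gmin) (hgb : ∀ x ∈ 𝒳, g x ∈ Icc gmin gmax) (hb : 0 ≤ b)
    (ht : 0 < t) (htL : t ≤ L) (hT : 0 < T) (hρ : 0 ≤ ρ) {r : ℝ} (hr : 0 < r) :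
    WithHighProbability (fun N => dataLaw 𝒳 (scaledMap b D g hgm T t ρ L N) N)
      (fun N => {z | RadiallyDecreasingFrom (r * (N : ℝ) ^ (-b))
        (logLik (scaledMap b D g hgm T t ρ L N) z)}) := by
  -- `u²` is the value of the profile at radius `min r (t/4)` on the scale `N^(-b)`; the cap `t/4`
  -- keeps this radius in the quadratic part, and the powers of `N` cancel.
  set u := 2 * (T * min r (t / 4)) with hu
  have hmin : 0 < min r (t / 4) := lt_min hr (by positivity)
  have hu0 : 0 < u := by positivity
  refine (withHighProbability_goodData h𝒳m h𝒳v hgm h0 hgb hb ht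
    (show 0 < u * gmin ^ 2 by positivity)).mono ?_
  filter_upwards [eventually_ge_atTop 1] with N hN z hz
  obtain ⟨hq0, hq1, hqq, hqi⟩ := scale_bounds hb hN
  refine radiallyDecreasingFrom_logLik hgm (by positivity) (by gcongr) (by positivity) hρ
    (by positivity) hu0.le ?_ le_rfl hz
  have hlt : min r (t / 4) * (N : ℝ) ^ (-b) < t * (N : ℝ) ^ (-b) / 2 := by
    have h1 : min r (t / 4) ≤ t / 4 := min_le_right _ _
    nlinarith
  calc u ^ 2 = 4 * (T * (N : ℝ) ^ b * (min r (t / 4) * (N : ℝ) ^ (-b))) ^ 2 := by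
        rw [scaled_knee hb hN, hu]
        ring
    _ = profile (T * (N : ℝ) ^ b) (t * (N : ℝ) ^ (-b)) ρ (L * (N : ℝ) ^ (-b))
          (min r (t / 4) * (N : ℝ) ^ (-b)) := (profile_of_lt_half hlt).symm
    _ ≤ _ := by
        refine profile_mono (by positivity) (by gcongr) (by positivity) hρ (by positivity) ?_
        gcongr
        exact min_le_left _ _

/-- Between radius `t/2` and the knee `w` gains `T t / 2`, so the log-likelihood drops by at least
`(a + 2) N`, minus `N` for the two score terms. The prior mass of the inner ball costs `a N`; what
remains is `e^(-N)`. -/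
theorem withHighProbability_posterior_concentrates (h𝒳m : MeasurableSet 𝒳) (h𝒳v : volume 𝒳 = 1)
    (hgm : Measurable g) (h0 : 0 < gmin) (hgb : ∀ x ∈ 𝒳, g x ∈ Icc gmin gmax) (hb : 0 ≤ b)
    (ht : 0 < t) (htL : t ≤ L) (hT : 0 < T) (hρ : 0 ≤ ρ) (hts : t ≤ s) {a : ℝ}
    (hball : ∀ᶠ N : ℕ in atTop, ENNReal.ofReal (Real.exp (-(a * N))) ≤
      priorLaw (C (D N)) (centredBall (D N) (t / 2 * (N : ℝ) ^ (-b))))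
    (hTa : a + 2 ≤ T * t * gmin ^ 2 / 4) {δ : ℝ} (hδ : 0 < δ) :
    WithHighProbability (fun N => dataLaw 𝒳 (scaledMap b D g hgm T t ρ L N) N)
      (fun N => {z | 1 - δ ≤ (posteriorLaw (scaledMap b D g hgm T t ρ L N) (C (D N)) z).real
        (centredBall (D N) (s * (N : ℝ) ^ (-b)))}) := by
  obtain ⟨U, δ', hU, hUW, hδ', hδU⟩ := exists_score_bounds ((T * t) ^ 2 + T * t / 2 + ρ * L)
  refine (withHighProbability_goodData h𝒳m h𝒳v hgm h0 hgb hb ht hδ').mono ?_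
  have hsmall : ∀ᶠ N : ℕ in atTop, ENNReal.ofReal (Real.exp (-(1 * (N : ℝ)))) < ENNReal.ofReal δ :=
    (tendsto_ofReal_exp_neg one_pos).eventually_lt_const (by simpa using hδ)
  filter_upwards [eventually_ge_atTop 1, hball, hsmall] with N hN hballN hsmallN z hz
  obtain ⟨hq0, hq1, hqq, hqi⟩ := scale_bounds hb hN
  set q := (N : ℝ) ^ (-b) with hq
  have hTt := scaled_knee hb hN T t
  rw [← hq] at hTt
  set G := scaledMap b D g hgm T t ρ L N with hG
  have hprob : IsProbabilityMeasure (posteriorLaw G (C (D N)) z) :=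
    isProbabilityMeasure_tilted (integrable_exp_logLik G z _)
  have hρL : 0 ≤ ρ * L := mul_nonneg hρ (ht.le.trans htL)
  have hTt0 : 0 < T * t := mul_pos hT ht
  have hWN : (T * (N : ℝ) ^ b * (t * q)) ^ 2 + T * (N : ℝ) ^ b * (t * q) / 2 + ρ * (L * q)
      ≤ U ^ 2 := by
    rw [hTt]
    refine le_trans ?_ hUW
    gcongr
    exact mul_le_of_le_one_right (ht.le.trans htL) hq1
  set base := -(1 / 2) * ∑ i, (z i).1 ^ 2 with hbase
  have hout : ∀ θ ∈ (centredBall (D N) (s * q))ᶜ, logLik G z θ ≤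
      base + N / 2 - ((T * t) ^ 2 + T * t / 2) * information g z / 2 := by
    intro θ hθ
    simp only [mem_compl_iff, Metric.mem_closedBall, dist_zero_right, not_le] at hθ
    have h := logLik_le_of_knee_le (D := D N) hgm (by positivity) (by gcongr) (by positivity) hρ hU
      hWN hδU hz (θ := θ) (le_trans (by gcongr) hθ.le)
    rwa [hTt] at h
  have hin : ∀ θ ∈ centredBall (D N) (t / 2 * q),
      base + N / 2 - ((T * t) ^ 2 + T * t / 2) * information g z / 2 - -((a + 1) * N) ≤
        logLik G z θ := by
    intro θ hθ
    simp only [Metric.mem_closedBall, dist_zero_right] at hθ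
    have hw : profile (T * (N : ℝ) ^ b) (t * q) ρ (L * q) ‖θ‖ ≤ (T * t) ^ 2 := by
      rw [← hTt, ← profile_half (T := T * (N : ℝ) ^ b) (t := t * q) (ρ := ρ) (L := L * q)
        (by positivity)]
      exact profile_mono (by positivity) (by gcongr) (by positivity) hρ (norm_nonneg _)
        (hθ.trans (by linarith))
    have h := le_logLik_of_profile_le (D := D N) hgm (by positivity) (by gcongr) (by positivity) hρ
      hU hδU hz hw (by linarith)
    refine le_trans ?_ h
    have hI := hz.2.1
    have h1 : (a + 2) * N ≤ T * t * gmin ^ 2 / 4 * N := by gcongr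
    have h2 : T * t / 4 * (gmin ^ 2 * N) ≤ T * t / 4 * information g z := by gcongr
    linarith
  have hmass := posteriorLaw_mul_le G (C (D N)) z measurableSet_closedBall
    measurableSet_closedBall.compl hin hout
  have hle : posteriorLaw G (C (D N)) z (centredBall (D N) (s * q))ᶜ ≤ ENNReal.ofReal δ := by
    refine le_trans ?_ hsmallN.le
    have h1 := (mul_le_mul_right hballN _).trans hmass
    rw [← ENNReal.le_div_iff_mul_le (by left; simp [Real.exp_pos]) (by left; simp),
      ← ENNReal.ofReal_div_of_pos (Real.exp_pos _), ← Real.exp_sub] at h1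
    refine h1.trans (ENNReal.ofReal_le_ofReal (Real.exp_le_exp.2 ?_))
    linarith
  have hreal := probReal_compl_eq_one_sub (μ := posteriorLaw G (C (D N)) z)
    (measurableSet_closedBall (x := (0 : Vec (D N))) (ε := s * q))
  have h2 : (posteriorLaw G (C (D N)) z).real (centredBall (D N) (s * q))ᶜ ≤ δ :=
    ENNReal.toReal_le_of_le_ofReal hδ.le hle
  simp only [mem_ofPred_eq]
  linarith

/-- A chain with small steps whose initial state is a suitable point of the annulus needs
exponentially many steps to reach `B_s`. -/
theorem exists_hitsLate (h𝒳m : MeasurableSet 𝒳) (h𝒳v : volume 𝒳 = 1)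
    (hgm : Measurable g) (h0 : 0 < gmin) (hgb : ∀ x ∈ 𝒳, g x ∈ Icc gmin gmax) (hb : 0 ≤ b)
    (ht : 0 < t) (htL : t ≤ L) (hT : 0 < T) (hρ : 0 ≤ ρ) (hts : t ≤ s) (hs1 : s ≤ 1)
    {ε a R c : ℝ} (hc : c = 1 + ρ * L * gmax ^ 2 / 2)
    (hann : ∀ᶠ N : ℕ in atTop, ENNReal.ofReal (Real.exp (-(a * N))) ≤
      priorLaw (C (D N)) (annulus (D N) ((N : ℝ) ^ (-b)) (ε * (N : ℝ) ^ (-b))))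
    (hball : ∀ᶠ N : ℕ in atTop, priorLaw (C (D N)) (centredBall (D N) (2 * s * (N : ℝ) ^ (-b))) ≤
      ENNReal.ofReal (Real.exp (-((a + c + 2) * N))))
    (htail : ∀ᶠ N : ℕ in atTop, priorLaw (C (D N)) {θ | R * τ N < ‖θ‖} ≤
      ENNReal.ofReal (Real.exp (-((a + c + 2) * N))))
    (hRτ : ∀ᶠ N : ℕ in atTop, t * (N : ℝ) ^ (-b) ≤ R * τ N)
    (P : ∀ N, Kernel (Data d N × Vec (D N)) (Vec (D N))) [∀ N, IsMarkovKernel (P N)]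
    {c₀ : ℝ} (hc₀ : 0 < c₀) {η Ls : ℕ → ℝ}
    (hη : ∀ᶠ N : ℕ in atTop, η N ∈ Ioo 0 (s * (N : ℝ) ^ (-b)))
    (hLs : ∀ᶠ N : ℕ in atTop, R * τ N ≤ Ls N)
    (hP : StepAssumption 𝒳 (scaledMap b D g hgm T t ρ L) (fun N => C (D N)) P c₀ Ls η) :
    ∃ ϑ₀ : ∀ N, Vec (D N),
      (∀ᶠ N : ℕ in atTop, ϑ₀ N ∈ annulus (D N) ((N : ℝ) ^ (-b)) (ε * (N : ℝ) ^ (-b))) ∧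
      HitsLate 𝒳 (scaledMap b D g hgm T t ρ L) P ϑ₀
        (fun N => s * (N : ℝ) ^ (-b)) (fun N => min c₀ 1 * N / 2) := by
  obtain ⟨U, δ, hU, hUW, hδ, hδU⟩ := exists_score_bounds ((T * t) ^ 2 + T * t / 2 + ρ * L)
  set μ : ∀ N, Measure (Data d N) := fun N => dataLaw 𝒳 (scaledMap b D g hgm T t ρ L N) N with hμ
  set small : ∀ N, Set (Data d N) := fun N => {z | ∀ θ ∈ centredBall (D N) (Ls N),
      P N (z, θ) {ϑ | η N / 2 ≤ ‖θ - ϑ‖} ≤ ENNReal.ofReal (Real.exp (-(c₀ * N)))} with hsmall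
  -- Three ways for the data to fail: no invariance, long steps, or atypical score and information.
  set bad : ∀ N, Set (Data d N) := fun N => {z | ¬ ((P N).sectR z).Invariant
      (posteriorLaw (scaledMap b D g hgm T t ρ L N) (C (D N)) z)} ∪
    ((small N)ᶜ ∪ (goodData g (gmin ^ 2) (gmax ^ 2) δ N)ᶜ) with hbad
  have hbad0 : Tendsto (fun N => μ N (bad N)) atTop (𝓝 0) := by
    have h1 : Tendsto (fun N => μ N (small N)ᶜ + μ N (goodData g (gmin ^ 2) (gmax ^ 2) δ N)ᶜ)
        atTop (𝓝 0) := by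
      have := Tendsto.add hP.small_steps (withHighProbability_goodData (D := D) (T := T) (ρ := ρ)
        (L := L) h𝒳m h𝒳v hgm h0 hgb hb ht hδ)
      rw [add_zero] at this
      exact this
    refine tendsto_of_tendsto_of_tendsto_of_le_of_le' tendsto_const_nhds h1
      (Eventually.of_forall fun _ => zero_le) ?_
    filter_upwards [hP.invariant] with N hN
    refine (measure_union_le _ _).trans ?_
    rw [ae_iff.1 hN, zero_add]
    exact measure_union_le _ _
  set K : ∀ N, Set (ℕ → Data d N × Vec (D N)) := fun N =>
    {ω | ENNReal.ofReal (Real.exp (min c₀ 1 * N / 2)) ≤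
      ((hittingTime (centredBall (D N) (s * (N : ℝ) ^ (-b))) (fun k => (ω k).2) : ℕ∞) : ℝ≥0∞)}
    with hK
  set rem : ℕ → ℝ≥0∞ := fun N => ENNReal.ofReal (2 * Real.exp (-(1 * N))) +
    ENNReal.ofReal (Real.exp (-(c₀ / 2 * N))) with hrem
  have hrem0 : Tendsto rem atTop (𝓝 0) := by
    have h1 : Tendsto (fun N : ℕ => ENNReal.ofReal (2 * Real.exp (-(1 * (N : ℝ))))) atTop (𝓝 0) := by
      have := ENNReal.Tendsto.const_mul (a := 2) (tendsto_ofReal_exp_neg one_pos) (by simp)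
      rw [mul_zero] at this
      refine this.congr fun N => ?_
      rw [ENNReal.ofReal_mul (by norm_num)]
      simp
    have h2 := h1.add (tendsto_ofReal_exp_neg (show 0 < c₀ / 2 by positivity))
    rwa [add_zero] at h2
  have main : ∀ᶠ N : ℕ in atTop,
      ∃ ϑ₀ ∈ annulus (D N) ((N : ℝ) ^ (-b)) (ε * (N : ℝ) ^ (-b)),
        jointLaw (μ N) (P N) ϑ₀ (K N)ᶜ ≤ μ N (bad N) + rem N := by
    filter_upwards [eventually_ge_atTop 1, hann, hball, htail, hRτ, hη, hLs]
      with N hN hann hball htail hRτ hη hLs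
    obtain ⟨hq0, hq1, hqq, hqi⟩ := scale_bounds hb hN
    set q := (N : ℝ) ^ (-b) with hq
    have hTt := scaled_knee hb hN T t
    rw [← hq] at hTt
    have hN0 : 0 < (N : ℝ) := by exact_mod_cast hN
    have hnoise := isProbabilityMeasure_noiseLaw h𝒳v
    have hμN : IsProbabilityMeasure (μ N) := by
      simp only [hμ]
      rw [dataLaw_scaledMap h𝒳v hgm hb ht hN]
      infer_instance
    set A := annulus (D N) q (ε * q) with hA
    have hAm : MeasurableSet A :=
      measurableSet_Ioo.preimage (f := fun θ : Vec (D N) => ‖θ‖) (by fun_prop)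
    have hπA0 : 0 < priorLaw (C (D N)) A :=
      lt_of_lt_of_le (ENNReal.ofReal_pos.2 (Real.exp_pos _)) hann
    have hAnorm : ∀ θ ∈ A, q < ‖θ‖ := fun θ hθ => hθ.1
    have hρL : 0 ≤ ρ * L := mul_nonneg hρ (ht.le.trans htL)
    have hLq : L * q ≤ L := mul_le_of_le_one_right (ht.le.trans htL) hq1
    have hWN : (T * (N : ℝ) ^ b * (t * q)) ^ 2 + T * (N : ℝ) ^ b * (t * q) / 2 + ρ * (L * q)
        ≤ U ^ 2 := by
      rw [hTt]
      refine le_trans ?_ hUW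
      gcongr
    -- The bad set need not be measurable; its measurable hull has the same measure.
    set G : Set (Data d N) := (toMeasurable (μ N) (bad N))ᶜ with hG
    have hGgood : ∀ z ∈ G, z ∉ bad N := fun z hz hzb => hz (subset_toMeasurable _ _ hzb)
    have hGbad : μ N Gᶜ = μ N (bad N) := by rw [hG, compl_compl, measure_toMeasurable]
    obtain ⟨ϑ₀, hϑ₀, hle⟩ := exists_start_hit_le (μ := μ N) (π := priorLaw (C (D N)))
      (l := fun z => logLik (scaledMap b D g hgm T t ρ L N) z) (P N) (G := G)
      (measurableSet_toMeasurable _ _).compl hAm hπA0.ne' (s := s * q) (w := η N / 2)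
      (R := R * τ N) (c := c * N)
      (fun θ hθ => lt_of_le_of_lt (mul_le_of_le_one_left hq0.le hs1) (hAnorm θ hθ))
      (p := ENNReal.ofReal (Real.exp (-(c₀ * N))))
      (fun z _ => integrable_exp_logLik _ z _)
      (fun z hz => by
        have h := hGgood z hz
        simp only [hbad, mem_union, mem_ofPred_eq, not_or, not_not] at h
        exact h.1)
      (fun z hz => by
        have h := hGgood z hz
        simp only [hbad, mem_union, mem_compl_iff, not_or, not_not] at h
        have hzg := h.2.2
        refine ⟨-(1 / 2) * ∑ i, (z i).1 ^ 2 + N / 2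
          - ((T * t) ^ 2 + T * t / 2) * information g z / 2, fun θ hθ => ?_, fun θ hθ => ?_⟩
        · have hw := profile_le (T := T * (N : ℝ) ^ b) (t := t * q) (ρ := ρ) (L := L * q)
            (by positivity) (by gcongr) (by positivity) hρ (norm_nonneg θ)
          have h1 := le_logLik_of_profile_le (D := D N) hgm (by positivity) (by gcongr)
            (by positivity) hρ hU hδU hzg hw hWN
          refine le_trans ?_ h1
          -- The constant `(T t)² + T t / 2` occurs on both sides; the difference is `N` from the
          -- score terms plus `ρ L gmax² N / 2`.
          rw [hTt, hc]
          have hI0 : 0 ≤ information g z := Finset.sum_nonneg fun i _ => sq_nonneg _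
          have h2 : ρ * (L * q) * information g z ≤ ρ * L * (gmax ^ 2 * N) :=
            mul_le_mul (by gcongr) hzg.2.2 hI0 hρL
          linarith
        · have hθt : t * q ≤ ‖θ‖ := by
            rcases hθ with ⟨h1, -⟩ | h1
            · exact le_trans (by gcongr) h1.le
            · exact hRτ.trans h1.le
          have h1 := logLik_le_of_knee_le (D := D N) hgm (by positivity) (by gcongr)
            (by positivity) hρ hU hWN hδU hzg hθt
          rwa [hTt] at h1)
      (fun z hz θ hθ => by
        have h := hGgood z hz
        simp only [hbad, mem_union, mem_compl_iff, not_or, not_not] at h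
        exact h.2.1 θ (by simpa using hθ.trans hLs))
      ⌊Real.exp (min c₀ 1 * N / 2)⌋₊
    refine ⟨ϑ₀, hϑ₀, ?_⟩
    have hsub : (K N)ᶜ ⊆ {x : ℕ → Data d N × Vec (D N) |
        ∃ k ≤ ⌊Real.exp (min c₀ 1 * N / 2)⌋₊, ‖(x k).2‖ ≤ s * q} := by
      refine (compl_late_subset _ _).trans fun x hx => ?_
      simpa using hx
    refine (measure_mono hsub).trans (hle.trans ?_)
    rw [hGbad, hrem, add_assoc]
    have hfloor : ((⌊Real.exp (min c₀ 1 * N / 2)⌋₊ : ℕ) : ℝ≥0∞) ≤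
        ENNReal.ofReal (Real.exp (min c₀ 1 * N / 2)) := by
      rw [← ENNReal.ofReal_natCast]
      exact ENNReal.ofReal_le_ofReal (Nat.floor_le (Real.exp_pos _).le)
    have hbar : priorLaw (C (D N)) (barrier (D N) (s * q) (η N / 2) (R * τ N)) ≤
        ENNReal.ofReal (2 * Real.exp (-((a + c + 2) * N))) := by
      -- Since `η < s N^(-b)`, the shell lies in the ball of radius `2 s N^(-b)`.
      have hsub : barrier (D N) (s * q) (η N / 2) (R * τ N) ⊆
          centredBall (D N) (2 * s * q) ∪ {θ | R * τ N < ‖θ‖} := by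
        rintro θ (⟨-, h⟩ | h)
        · left
          have hη2 := hη.2
          have hη1 := hη.1
          simp only [Metric.mem_closedBall, dist_zero_right]
          linarith
        · exact Or.inr h
      refine (measure_mono hsub).trans ((measure_union_le _ _).trans
        ((add_le_add hball htail).trans (le_of_eq ?_)))
      rw [← ENNReal.ofReal_add (by positivity) (by positivity), two_mul]
    have hmin1 : min c₀ 1 ≤ 1 := min_le_right _ _
    have hmin2 : min c₀ 1 ≤ c₀ := min_le_left _ _
    refine add_le_add le_rfl (add_le_add ?_ ?_)
    -- The density ratio `e^(cN)` and the annulus mass `e^(-aN)` use up `a + c` of the exponent `a +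
    -- c + 2`; the remaining `e^(-2N)` beats the at most `e^(N/2)` steps.
    · calc _ ≤ ENNReal.ofReal (Real.exp (min c₀ 1 * N / 2)) * (ENNReal.ofReal (Real.exp (c * N)) *
            ENNReal.ofReal (2 * Real.exp (-((a + c + 2) * N))) /
            ENNReal.ofReal (Real.exp (-(a * N)))) := by gcongr
        _ = ENNReal.ofReal (2 * (Real.exp (min c₀ 1 * N / 2) * (Real.exp (c * N) *
            Real.exp (-((a + c + 2) * N)) / Real.exp (-(a * N))))) := by
          rw [← ENNReal.ofReal_mul (by positivity), ← ENNReal.ofReal_div_of_pos (by positivity),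
            ← ENNReal.ofReal_mul (by positivity)]
          congr 1
          ring
        _ ≤ _ := by
          rw [← Real.exp_add, ← Real.exp_sub, ← Real.exp_add]
          apply ENNReal.ofReal_le_ofReal
          gcongr
          nlinarith
    · calc _ ≤ ENNReal.ofReal (Real.exp (min c₀ 1 * N / 2)) *
            ENNReal.ofReal (Real.exp (-(c₀ * N))) := by gcongr
        _ ≤ _ := by
          rw [← ENNReal.ofReal_mul (by positivity), ← Real.exp_add]
          apply ENNReal.ofReal_le_ofReal
          gcongr
          nlinarith
  classical
  -- Starting points exist only for large `N`; the value `0` elsewhere is arbitrary.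
  refine ⟨fun N => if h : ∃ ϑ₀ ∈ annulus (D N) ((N : ℝ) ^ (-b)) (ε * (N : ℝ) ^ (-b)),
      jointLaw (μ N) (P N) ϑ₀ (K N)ᶜ ≤ μ N (bad N) + rem N then h.choose else 0, ?_, ?_⟩
  · filter_upwards [main] with N hN
    rw [dif_pos hN]
    exact hN.choose_spec.1
  · have hlim : Tendsto (fun N => μ N (bad N) + rem N) atTop (𝓝 0) := by
      simpa using hbad0.add hrem0
    refine tendsto_of_tendsto_of_tendsto_of_le_of_le' tendsto_const_nhds hlim
      (Eventually.of_forall fun _ => zero_le) ?_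
    filter_upwards [main] with N hN
    rw [dif_pos hN]
    exact hN.choose_spec.2

/-- With `η = s N^(-b) / 2` the step must stay below `s N^(-b) / 4`. The bound on `β` makes both
parts of the displacement at most `s N^(-b) / 9`, and `2/9 < 1/4`. It holds for all data, not only
with high probability. -/
theorem stepAssumption_pcn {hgm : Measurable g} (hb : 0 ≤ b) (hs : 0 < s) {R a : ℝ} (hR : 0 < R)
    (ha : 1 ≤ a) (hτ : ∀ᶠ N : ℕ in atTop, 1 ≤ τ N)
    (htail : ∀ᶠ N : ℕ in atTop, priorLaw (C (D N)) {θ | R * τ N < ‖θ‖} ≤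
      ENNReal.ofReal (Real.exp (-(a * N)))) {β : ℕ → ℝ}
    (hβ : ∀ᶠ N : ℕ in atTop, 0 < β N ∧
      β N ≤ (min 1 (s / (9 * R))) ^ 2 * ((N : ℝ) ^ (-b) / τ N) ^ 2) :
    StepAssumption 𝒳 (scaledMap b D g hgm T t ρ L) (fun N => C (D N))
      (fun N => pcnKernel N (scaledMap b D g hgm T t ρ L N) (C (D N)) (β N)) 1
      (fun N => R * τ N) (fun N => s * (N : ℝ) ^ (-b) / 2) := by
  have hsteps : ∀ᶠ N : ℕ in atTop, 0 ≤ β N ∧ β N ≤ 1 ∧ 0 < (N : ℝ) ^ (-b) ∧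
      β N * (R * τ N) + Real.sqrt (β N) * (R * τ N) < s * (N : ℝ) ^ (-b) / 2 / 2 := by
    filter_upwards [hβ, hτ, eventually_ge_atTop 1] with N ⟨hβ0, hβ1⟩ hτN hN
    obtain ⟨hq0, hq1, -, -⟩ := scale_bounds hb hN
    set q := (N : ℝ) ^ (-b) with hq
    have hτ0 : 0 < τ N := one_pos.trans_le hτN
    set k := min 1 (s / (9 * R)) with hk
    have hk0 : 0 < k := lt_min one_pos (by positivity)
    have hx : k * (q / τ N) ≤ 1 := by
      have h1 : q / τ N ≤ 1 := (div_le_one hτ0).2 (hq1.trans hτN)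
      exact mul_le_one₀ (min_le_left _ _) (by positivity) h1
    have hx0 : 0 < k * (q / τ N) := by positivity
    rw [← mul_pow] at hβ1
    have hsq : Real.sqrt (β N) ≤ k * (q / τ N) := (Real.sqrt_le_left hx0.le).2 hβ1
    have hβx : β N ≤ k * (q / τ N) := hβ1.trans (by nlinarith)
    refine ⟨hβ0.le, hβx.trans hx, hq0, ?_⟩
    have h3 : k * (q / τ N) * (R * τ N) = k * R * q := by field_simp
    have h4 : k * R ≤ s / 9 := by
      calc k * R ≤ s / (9 * R) * R := by gcongr; exact min_le_right _ _
        _ = s / 9 := by field_simp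
    have h5 : k * R * q ≤ s / 9 * q := by gcongr
    have h6 : β N * (R * τ N) ≤ k * (q / τ N) * (R * τ N) := by gcongr
    have h7 : Real.sqrt (β N) * (R * τ N) ≤ k * (q / τ N) * (R * τ N) := by gcongr
    have h8 : 0 < s * q := by positivity
    linarith
  constructor
  · filter_upwards [hsteps] with N hN
    exact Eventually.of_forall fun z => pcnKernel_invariant _ z hN.1 hN.2.1
  · refine tendsto_const_nhds.congr' ?_
    filter_upwards [hsteps, htail] with N ⟨h0, h1, hq, h2⟩ htailN
    have hall : {z : Data d N | ∀ θ ∈ centredBall (D N) (R * τ N),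
        pcnKernel N (scaledMap b D g hgm T t ρ L N) (C (D N)) (β N) (z, θ)
          {ϑ | s * (N : ℝ) ^ (-b) / 2 / 2 ≤ ‖θ - ϑ‖} ≤
        ENNReal.ofReal (Real.exp (-(1 * (N : ℝ))))} = univ := by
      refine eq_univ_of_forall fun z θ hθ => ?_
      refine (pcnKernel_step_le _ z h0 h1 (by positivity) h2 (by simpa using hθ)).trans
        (htailN.trans (ENNReal.ofReal_le_ofReal ?_))
      gcongr
    rw [hall, compl_univ, measure_empty]

/-- The choice of the parameters and all the asserted properties, for both priors at once. -/
theorem exists_scaled_parameters (h𝒳m : MeasurableSet 𝒳) (h𝒳v : volume 𝒳 = 1)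
    (hgm : Measurable g) (hg : IsCovariateFactor 𝒳 g) (hκ : 0 < κ) (hb : 0 ≤ b)
    (hC : PriorScaling C κ b τ) (hτ : ∀ᶠ N : ℕ in atTop, 1 ≤ τ N) :
    ∃ T t ρ L s : ℝ, 0 < t ∧ t < s ∧ s < 1 / 3 ∧ 1 / 2 < L ∧ 0 < ρ ∧ ρ ≤ 1 ∧ ρ < T ∧
      (∀ D : ℕ → ℕ, Tendsto (fun N => (D N : ℝ) / (N : ℝ)) atTop (𝓝 κ) →
        (∀ N, 1 ≤ N → HasNiceAverage 𝒳 (scaledMap b D g hgm T t ρ L N) N) ∧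
        (∀ r > 0, WithHighProbability (fun N => dataLaw 𝒳 (scaledMap b D g hgm T t ρ L N) N)
          (fun N => {z | RadiallyDecreasingFrom (r * (N : ℝ) ^ (-b))
            (logLik (scaledMap b D g hgm T t ρ L N) z)})) ∧
        (∀ δ > 0, WithHighProbability (fun N => dataLaw 𝒳 (scaledMap b D g hgm T t ρ L N) N)
          (fun N => {z | 1 - δ ≤
            (posteriorLaw (scaledMap b D g hgm T t ρ L N) (C (D N)) z).real
              (centredBall (D N) (s * (N : ℝ) ^ (-b)))}))) ∧
      (∃ ε > 0, ∃ R > 0, ∀ D : ℕ → ℕ, Tendsto (fun N => (D N : ℝ) / (N : ℝ)) atTop (𝓝 κ) →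
        ∀ (P : ∀ N, Kernel (Data d N × Vec (D N)) (Vec (D N))) [∀ N, IsMarkovKernel (P N)]
          (c₀ : ℝ) (η Ls : ℕ → ℝ), 0 < c₀ →
          (∀ᶠ N : ℕ in atTop, η N ∈ Ioo 0 (s * (N : ℝ) ^ (-b))) →
          (∀ᶠ N : ℕ in atTop, R * τ N ≤ Ls N) →
          StepAssumption 𝒳 (scaledMap b D g hgm T t ρ L) (fun N => C (D N)) P c₀ Ls η →
          ∃ ϑ₀ : ∀ N, Vec (D N),
            (∀ᶠ N : ℕ in atTop, ϑ₀ N ∈ annulus (D N) ((N : ℝ) ^ (-b)) (ε * (N : ℝ) ^ (-b))) ∧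
            HitsLate 𝒳 (scaledMap b D g hgm T t ρ L) P ϑ₀
              (fun N => s * (N : ℝ) ^ (-b)) (fun N => min c₀ 1 * N / 2)) ∧
      (∃ c₁ > 0, ∃ c₂ > 0, ∃ ε > 0,
        ∀ D : ℕ → ℕ, Tendsto (fun N => (D N : ℝ) / (N : ℝ)) atTop (𝓝 κ) →
        ∀ β : ℕ → ℝ,
          (∀ᶠ N : ℕ in atTop, 0 < β N ∧ β N ≤ c₁ * ((N : ℝ) ^ (-b) / τ N) ^ 2) →
          ∃ ϑ₀ : ∀ N, Vec (D N),
            (∀ᶠ N : ℕ in atTop, ϑ₀ N ∈ annulus (D N) ((N : ℝ) ^ (-b)) (ε * (N : ℝ) ^ (-b))) ∧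
            HitsLate 𝒳 (scaledMap b D g hgm T t ρ L)
              (fun N => pcnKernel N (scaledMap b D g hgm T t ρ L N) (C (D N)) (β N))
              ϑ₀ (fun N => s * (N : ℝ) ^ (-b)) (fun N => c₂ * D N)) := by
  obtain ⟨gmin, gmax, h0, hgg, hgb⟩ := hg.bounds
  obtain ⟨ε, hε, a, ha, hann⟩ := hC.le_annulus
  -- This is the variation rate of the log-likelihood beyond the knee for `ρ = 1/2`, `L = 1`. As `T`
  -- does not enter, the radii `s` and `t` can be fixed before `T`.
  set c : ℝ := 1 + 1 / 2 * 1 * gmax ^ 2 / 2 with hc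
  have hc0 : 1 ≤ c := by
    have : 0 ≤ 1 / 2 * 1 * gmax ^ 2 / 2 := by positivity
    linarith
  obtain ⟨r, hr, hball⟩ := hC.small_ball_le (a + c + 2)
  obtain ⟨R, hR, htail⟩ := hC.tail_le (a + c + 2)
  set s : ℝ := min (r / 2) (1 / 4) with hs
  have hs0 : 0 < s := lt_min (by positivity) (by norm_num)
  have hs4 : s ≤ 1 / 4 := min_le_right _ _
  have hsr : 2 * s ≤ r := by linarith [min_le_left (r / 2) (1 / 4)]
  -- `t ≤ R` places the complement of `B_R` beyond the knee as well, where the log-likelihood bound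
  -- on the barrier applies.
  set t : ℝ := min (s / 2) R with ht
  have ht0 : 0 < t := lt_min (by positivity) hR
  have hts : t < s := by linarith [min_le_left (s / 2) R]
  have htL : t ≤ 1 := by linarith
  obtain ⟨a', ha', hlow⟩ := hC.le_small_ball (t / 2) (by positivity)
  -- Chosen last, to outweigh the prior cost `a'` of the ball of radius `t/2`.
  set T : ℝ := 1 + 4 * (a' + 2) / (t * gmin ^ 2) with hT
  have hT1 : 1 ≤ T := by
    have : 0 ≤ 4 * (a' + 2) / (t * gmin ^ 2) := by positivity
    linarith
  have hT0 : 0 < T := by linarith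
  have hTa : a' + 2 ≤ T * t * gmin ^ 2 / 4 := by
    have h1 : T * t * gmin ^ 2 / 4 = t * gmin ^ 2 / 4 + (a' + 2) := by
      rw [hT]
      field_simp
    have : 0 ≤ t * gmin ^ 2 / 4 := by positivity
    linarith
  have hball' : ∀ D : ℕ → ℕ, Tendsto (fun N => (D N : ℝ) / (N : ℝ)) atTop (𝓝 κ) →
      ∀ᶠ N : ℕ in atTop, priorLaw (C (D N)) (centredBall (D N) (2 * s * (N : ℝ) ^ (-b))) ≤
        ENNReal.ofReal (Real.exp (-((a + c + 2) * N))) := by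
    intro D hD
    filter_upwards [hball D hD] with N hN
    exact (measure_mono (Metric.closedBall_subset_closedBall (by gcongr))).trans hN
  have hRτ : ∀ᶠ N : ℕ in atTop, t * (N : ℝ) ^ (-b) ≤ R * τ N := by
    filter_upwards [hτ, eventually_ge_atTop 1] with N hτN hN
    obtain ⟨hq0, hq1, -, -⟩ := scale_bounds hb hN
    exact mul_le_mul (min_le_right _ _) (hq1.trans hτN) hq0.le hR.le
  have hlate : ∀ D : ℕ → ℕ, Tendsto (fun N => (D N : ℝ) / (N : ℝ)) atTop (𝓝 κ) →
      ∀ (P : ∀ N, Kernel (Data d N × Vec (D N)) (Vec (D N))) [∀ N, IsMarkovKernel (P N)]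
        (c₀ : ℝ) (η Ls : ℕ → ℝ), 0 < c₀ →
        (∀ᶠ N : ℕ in atTop, η N ∈ Ioo 0 (s * (N : ℝ) ^ (-b))) →
        (∀ᶠ N : ℕ in atTop, R * τ N ≤ Ls N) →
        StepAssumption 𝒳 (scaledMap b D g hgm T t (1 / 2) 1) (fun N => C (D N)) P c₀ Ls η →
        ∃ ϑ₀ : ∀ N, Vec (D N),
          (∀ᶠ N : ℕ in atTop, ϑ₀ N ∈ annulus (D N) ((N : ℝ) ^ (-b)) (ε * (N : ℝ) ^ (-b))) ∧
          HitsLate 𝒳 (scaledMap b D g hgm T t (1 / 2) 1) P ϑ₀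
            (fun N => s * (N : ℝ) ^ (-b)) (fun N => min c₀ 1 * N / 2) :=
    fun D hD P _ c₀ η Ls hc₀ hη hLs hP => exists_hitsLate h𝒳m h𝒳v hgm h0 hgb hb ht0 htL hT0
      (by norm_num) hts.le (by linarith) hc (hann D hD) (hball' D hD) (htail D hD) hRτ P hc₀ hη hLs
      hP
  -- The rate for pCN comes from `c₀ = 1`: hitting times are at least `e^(N/2)`, and `D ≤ 2 κ N`
  -- gives `D / (4 κ) ≤ N / 2`.
  refine ⟨T, t, 1 / 2, 1, s, ht0, hts, by linarith, by norm_num, by norm_num, by norm_num,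
    by linarith, fun D hD => ⟨fun N hN => ?_, fun r' hr' => ?_, fun δ hδ => ?_⟩,
    ⟨ε, hε, R, hR, hlate⟩, ⟨(min 1 (s / (9 * R))) ^ 2, ?_, 1 / (4 * κ), by positivity, ε, hε,
      fun D hD β hβ => ?_⟩⟩
  · obtain ⟨hq0, hq1, hqq, hqi⟩ := scale_bounds hb hN
    exact hasNiceAverage_radialMap h𝒳m h𝒳v hgm hg (by positivity) (by gcongr) (by positivity)
      (by norm_num) _ hN
  · exact withHighProbability_radiallyDecreasingFrom h𝒳m h𝒳v hgm h0 hgb hb ht0 htL hT0 (by norm_num)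
      hr'
  · exact withHighProbability_posterior_concentrates h𝒳m h𝒳v hgm h0 hgb hb ht0 htL hT0
      (by norm_num) hts.le (hlow D hD) hTa hδ
  · have : 0 < min 1 (s / (9 * R)) := lt_min one_pos (by positivity)
    positivity
  · have hstep := stepAssumption_pcn (𝒳 := 𝒳) (T := T) (t := t) (ρ := 1 / 2) (L := 1) (hgm := hgm)
      hb hs0 hR (show 1 ≤ a + c + 2 by linarith) hτ (htail D hD) hβ
    obtain ⟨ϑ₀, hϑ₀, hhit⟩ := hlate D hD _ 1 _ _ one_pos (by
      filter_upwards [eventually_ge_atTop 1] with N hN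
      obtain ⟨hq0, -, -, -⟩ := scale_bounds hb hN
      have : 0 < s * (N : ℝ) ^ (-b) := by positivity
      exact ⟨by positivity, by linarith⟩) (Eventually.of_forall fun _ => le_rfl) hstep
    refine ⟨ϑ₀, hϑ₀, hhit.mono ?_⟩
    filter_upwards [eventually_dim_bounds hκ hD] with N ⟨_, _, _, hN⟩ ω hω
    refine le_trans (ENNReal.ofReal_le_ofReal (Real.exp_le_exp.2 ?_)) hω
    rw [min_self, one_mul]
    calc 1 / (4 * κ) * (D N : ℝ) ≤ 1 / (4 * κ) * (2 * κ * N) := by gcongr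
      _ = N / 2 := by field_simp; norm_num

end Scaled

end ColdStart

end

/-! ### The theorem for both priors -/

theorem mainTheorem3 {d : ℕ} (hd : 1 ≤ d) (𝒳 : Set (Vec d)) (h𝒳m : MeasurableSet 𝒳)
    (h𝒳b : Bornology.IsBounded 𝒳) (h𝒳v : volume 𝒳 = 1)
    (g : Vec d → ℝ) (hgm : Measurable g) (hg : IsCovariateFactor 𝒳 g) (κ : ℝ) (hκ : 0 < κ) :
    -- the prior `N(0, I_D / D)`
    (∃ T t ρ L s : ℝ, 0 < t ∧ t < s ∧ s < 1 / 3 ∧ 1 / 2 < L ∧ 0 < ρ ∧ ρ ≤ 1 ∧ ρ < T ∧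
      -- the properties of the regression map
      (∀ D : ℕ → ℕ, Tendsto (fun N => (D N : ℝ) / (N : ℝ)) atTop (𝓝 κ) →
        (∀ N, 1 ≤ N → HasNiceAverage 𝒳 (radialMap (D N) g hgm T t ρ L) N) ∧
        (∀ r > 0, WithHighProbability
          (fun N => dataLaw 𝒳 (radialMap (D N) g hgm T t ρ L) N)
          (fun N => {z |
            RadiallyDecreasingFrom r (logLik (radialMap (D N) g hgm T t ρ L) z) ∧
            RadiallyDecreasingFrom r
              (posteriorDensity (radialMap (D N) g hgm T t ρ L) (isoCov (D N)) z)})) ∧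
        (∀ δ > 0, WithHighProbability
          (fun N => dataLaw 𝒳 (radialMap (D N) g hgm T t ρ L) N)
          (fun N => {z | 1 - δ ≤
            (posteriorLaw (radialMap (D N) g hgm T t ρ L) (isoCov (D N)) z).real
              (centredBall (D N) s)}))) ∧
      -- the bound for general Markov chains
      (∃ ε > 0, ∀ D : ℕ → ℕ, Tendsto (fun N => (D N : ℝ) / (N : ℝ)) atTop (𝓝 κ) →
        ∀ (P : ∀ N, Kernel (Data d N × Vec (D N)) (Vec (D N))) [∀ N, IsMarkovKernel (P N)]
          (c₀ : ℝ) (η : ℕ → ℝ), 0 < c₀ → (∀ᶠ N : ℕ in atTop, η N ∈ Ioo 0 s) →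
          StepAssumption 𝒳 (fun N => radialMap (D N) g hgm T t ρ L) (fun N => isoCov (D N)) P c₀
            (fun _ => 1 + ε) η →
          ∃ ϑ₀ : ∀ N, Vec (D N), (∀ᶠ N : ℕ in atTop, ϑ₀ N ∈ annulus (D N) (2 / 3) ε) ∧
            HitsLate 𝒳 (fun N => radialMap (D N) g hgm T t ρ L) P ϑ₀ (fun _ => s)
              (fun N => min c₀ 1 * N / 2)) ∧
      -- the bound for pCN
      (∃ c₁ > 0, ∃ c₂ > 0, ∃ ε > 0,
        ∀ D : ℕ → ℕ, Tendsto (fun N => (D N : ℝ) / (N : ℝ)) atTop (𝓝 κ) →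
        ∀ β : ℕ → ℝ, (∀ᶠ N : ℕ in atTop, 0 < β N ∧ β N ≤ c₁) →
          ∃ ϑ₀ : ∀ N, Vec (D N), (∀ᶠ N : ℕ in atTop, ϑ₀ N ∈ annulus (D N) 1 ε) ∧
            HitsLate 𝒳 (fun N => radialMap (D N) g hgm T t ρ L)
              (fun N => pcnKernel N (radialMap (D N) g hgm T t ρ L) (isoCov (D N)) (β N))
              ϑ₀ (fun _ => s) (fun N => c₂ * D N))) ∧
    -- the prior `N(0, Σ_α)`
    (∀ α b : ℝ, (d : ℝ) / 2 < α → b = α / d - 1 / 2 →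
      ∃ T t ρ L s : ℝ, 0 < t ∧ t < s ∧ s < 1 / 2 ∧ 1 / 2 < L ∧ 0 < ρ ∧ ρ ≤ 1 ∧ ρ < T ∧
      -- the properties of the regression map
      (∀ D : ℕ → ℕ, Tendsto (fun N => (D N : ℝ) / (N : ℝ)) atTop (𝓝 κ) →
        (∀ N, 1 ≤ N → HasNiceAverage 𝒳 (scaledMap b D g hgm T t ρ L N) N) ∧
        (∀ r > 0, WithHighProbability (fun N => dataLaw 𝒳 (scaledMap b D g hgm T t ρ L N) N)
          (fun N => {z | RadiallyDecreasingFrom (r * (N : ℝ) ^ (-b))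
            (logLik (scaledMap b D g hgm T t ρ L N) z)})) ∧
        (∀ δ > 0, WithHighProbability (fun N => dataLaw 𝒳 (scaledMap b D g hgm T t ρ L N) N)
          (fun N => {z | 1 - δ ≤
            (posteriorLaw (scaledMap b D g hgm T t ρ L N) (maternCov d α (D N)) z).real
              (centredBall (D N) (s * (N : ℝ) ^ (-b)))}))) ∧
      -- the bound for general Markov chains
      (∃ ε > 0, ∃ C > 0, ∀ D : ℕ → ℕ, Tendsto (fun N => (D N : ℝ) / (N : ℝ)) atTop (𝓝 κ) →
        ∀ (P : ∀ N, Kernel (Data d N × Vec (D N)) (Vec (D N))) [∀ N, IsMarkovKernel (P N)]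
          (c₀ : ℝ) (η : ℕ → ℝ), 0 < c₀ →
          (∀ᶠ N : ℕ in atTop, η N ∈ Ioo 0 (s * (N : ℝ) ^ (-b))) →
          StepAssumption 𝒳 (scaledMap b D g hgm T t ρ L) (fun N => maternCov d α (D N)) P c₀
            (fun N => C * Real.sqrt N) η →
          ∃ ϑ₀ : ∀ N, Vec (D N),
            (∀ᶠ N : ℕ in atTop, ϑ₀ N ∈ annulus (D N) ((N : ℝ) ^ (-b)) (ε * (N : ℝ) ^ (-b))) ∧
            HitsLate 𝒳 (scaledMap b D g hgm T t ρ L) P ϑ₀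
              (fun N => s * (N : ℝ) ^ (-b)) (fun N => min c₀ 1 * N / 2)) ∧
      -- the bound for pCN
      (∃ c₁ > 0, ∃ c₂ > 0, ∃ ε > 0,
        ∀ D : ℕ → ℕ, Tendsto (fun N => (D N : ℝ) / (N : ℝ)) atTop (𝓝 κ) →
        ∀ β : ℕ → ℝ, (∀ᶠ N : ℕ in atTop, 0 < β N ∧ β N ≤ c₁ * (N : ℝ) ^ (-1 - 2 * b)) →
          ∃ ϑ₀ : ∀ N, Vec (D N),
            (∀ᶠ N : ℕ in atTop, ϑ₀ N ∈ annulus (D N) ((N : ℝ) ^ (-b)) (ε * (N : ℝ) ^ (-b))) ∧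
            HitsLate 𝒳 (scaledMap b D g hgm T t ρ L)
              (fun N => pcnKernel N (scaledMap b D g hgm T t ρ L N) (maternCov d α (D N)) (β N))
              ϑ₀ (fun N => s * (N : ℝ) ^ (-b)) (fun N => c₂ * D N))) := by
  constructor
  · obtain ⟨T, t, ρ, L, s, ht, hts, hs, hL, hρ0, hρ1, hρT, hprop, ⟨ε, hε, R, hR, hstep⟩,
      ⟨c₁, hc₁, c₂, hc₂, ε', hε', hpcn⟩⟩ := exists_scaled_parameters h𝒳m h𝒳v hgm hg hκ le_rfl
        (priorScaling_isoCov hκ) (by simp)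
    simp only [scaledMap_zero, neg_zero, Real.rpow_zero, mul_one, div_one, one_pow]
      at hprop hstep hpcn
    -- The start obtained has norm in `(1, 1 + ε)`. Enlarging the width to `max (ε + 1) R` puts it
    -- in the annulus from `2/3`, and makes the ball of the step condition contain `B_R`.
    refine ⟨T, t, ρ, L, s, ht, hts, hs, hL, hρ0, hρ1, hρT, fun D hD => ⟨(hprop D hD).1, ?_,
      (hprop D hD).2.2⟩, ⟨max (ε + 1) R, by positivity, ?_⟩, ⟨c₁, hc₁, c₂, hc₂, ε', hε', ?_⟩⟩
    · intro r hr
      refine ((hprop D hD).2.1 r hr).mono ?_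
      filter_upwards [eventually_dim_bounds hκ hD] with N ⟨_, hN, _, _⟩ z hz
      exact ⟨hz, radiallyDecreasingFrom_posteriorDensity (by exact_mod_cast hN) hz⟩
    · intro D hD P _ c₀ η hc₀ hη hP
      have hR1 : R ≤ 1 + max (ε + 1) R := by linarith [le_max_right (ε + 1) R]
      have hmap : scaledMap 0 D g hgm T t ρ L = fun N => radialMap (D N) g hgm T t ρ L :=
        funext fun N => scaledMap_zero D hgm T t ρ L N
      rw [← hmap] at hP ⊢
      obtain ⟨ϑ₀, hϑ₀, hhit⟩ := hstep D hD P c₀ η _ hc₀ hη (Eventually.of_forall fun _ => hR1) hP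
      refine ⟨ϑ₀, hϑ₀.mono fun N hN => ⟨?_, ?_⟩, hhit⟩
      · linarith [hN.1]
      · linarith [hN.2, le_max_left (ε + 1) R]
    · intro D hD β hβ
      have hmap : scaledMap 0 D g hgm T t ρ L = fun N => radialMap (D N) g hgm T t ρ L :=
        funext fun N => scaledMap_zero D hgm T t ρ L N
      rw [← hmap]
      exact hpcn D hD β hβ
  · intro α b hα hb
    have hd0 : (0 : ℝ) < d := by exact_mod_cast hd
    have hb0 : 0 < b := by
      have : (1 : ℝ) / 2 < α / d := by
        rw [lt_div_iff₀ hd0]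
        linarith
      linarith
    obtain ⟨T, t, ρ, L, s, ht, hts, hs, hL, hρ0, hρ1, hρT, hprop, ⟨ε, hε, R, hR, hstep⟩,
      ⟨c₁, hc₁, c₂, hc₂, ε', hε', hpcn⟩⟩ := exists_scaled_parameters h𝒳m h𝒳v hgm hg hκ hb0.le
        (priorScaling_maternCov (d := d) (α := α) hκ hb0 hb) (by
          filter_upwards [eventually_ge_atTop 1] with N hN
          exact Real.one_le_sqrt.2 (by exact_mod_cast hN))
    refine ⟨T, t, ρ, L, s, ht, hts, by linarith, hL, hρ0, hρ1, hρT, hprop, ⟨ε, hε, R, hR, ?_⟩,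
      ⟨c₁, hc₁, c₂, hc₂, ε', hε', ?_⟩⟩
    · intro D hD P _ c₀ η hc₀ hη hP
      exact hstep D hD P c₀ η _ hc₀ hη (Eventually.of_forall fun _ => le_rfl) hP
    · intro D hD β hβ
      refine hpcn D hD β ?_
      filter_upwards [hβ, eventually_gt_atTop 0] with N hN hN0
      have hN0' : (0 : ℝ) < N := by exact_mod_cast hN0
      -- Here `τ = √N`, so the admissible pCN step `(N^(-b)/τ)²` is `N^(-1-2b)`.
      have e : ((N : ℝ) ^ (-b) / Real.sqrt N) ^ 2 = (N : ℝ) ^ (-1 - 2 * b) := by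
        rw [div_pow, Real.sq_sqrt hN0'.le, ← Real.rpow_natCast, ← Real.rpow_mul hN0'.le,
          ← Real.rpow_sub_one hN0'.ne']
        congr 1
        push_cast
        ring
      rw [e]
      exact hN
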